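/- Let $M$ be a smooth (Hausdorff, finite-dimensional) manifold with tangent projection $\pi:TM\to M$, let $A\subset TM\setminus\mathbf 0$ be open with $\pi(A)=M$ and $\lambda v\in A$ for all $v\in A$, $\lambda>0$, and let $L:A\to\mathbb R$ be a pseudo-Finsler metric: a smooth function with $L(\lambda v)=\lambda^2L(v)$ for $v\in A$, $\lambda>0$, whose fundamental tensor $g_v(u,w)=\frac12\frac{\partial^2}{\partial t\,\partial s}L(v+tu+sw)\big|_{t=s=0}$ is nondegenerate for every $v\in A$. Let $C_v(w_1,w_2,w_3)=\frac12\frac{\partial}{\partial z}g_{v+zw_1}(w_2,w_3)\big|_{z=0}$ be its Cartan tensor. The Chern connection assigns to every vector field $V$ with values in $A$ on an open set the unique affine connection $\nabla^V$ that is torsion-free and satisfies $$X(g_V(Y,Z))=g_V(\nabla^V_XY,Z)+g_V(Y,\nabla^V_XZ)+2C_V(\nabla^V_XV,Y,Z).$$ In a chart its Christoffel symbols are $\Gamma^k_{ij}\circ V$ for functions $\Gamma^k_{ij}$ on the part of $A$ over the chart. For a smooth curve $\gamma$ and a vector field $W$ along $\gamma$ with values in $A$, the induced covariant derivative is, locally,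 $D^W_\gamma X=\sum_k\big(\dot X^k+\sum_{i,j}X^i\dot\gamma^j\,\Gamma^k_{ij}(W)\big)\partial_k$. If $\dot\gamma\in A$ throughout ($\gamma$ is admissible), write $X'=D^{\dot\gamma}_\gamma X$; $\gamma$ is a geodesic if $D^{\dot\gamma}_\gamma\dot\gamma=0$. For $v\in A\cap T_pM$ let $\gamma_v:[0,b_v)\to M$ be the maximal geodesic with $\dot\gamma_v(0)=v$; let $\mathcal D_p=\{v\in A\cap T_pM: b_v>1\}$ and $\exp_p:\mathcal D_p\to M$, $\exp_p(v)=\gamma_v(1)$. For an admissible curve $\gamma$ and vector fields $W,Z$ along $\gamma$ put $$R^\gamma(\dot\gamma,W)Z=\big(D^{\Lambda_t}_{\gamma_s}D^{\Lambda_t}_{\beta_t}\tilde Z-D^{\Lambda_t}_{\beta_t}D^{\Lambda_t}_{\gamma_s}\tilde Z\big)\big|_{s=0},$$ where $\Lambda(t,s)=\gamma_s(t)=\beta_t(s)$ is any smooth variation of $\gamma=\gamma_0$ through admissible curves $\gamma_s$ with variational field $\partial_s\Lambda(\cdot,0)=W$, $\Lambda_t=\dot\gamma_s$, and $\tilde Z$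 is any smooth extension of $Z$ to a vector field along $\Lambda$; the result does not depend on these choices. A Jacobi field of a geodesic $\gamma$ is a smooth vector field $J$ along $\gamma$ with $J''=R^\gamma(\dot\gamma,J)\dot\gamma$. **Proposition.** Let $p\in M$ and $v\in\mathcal D_p$. Then $\mathcal D_p$ is a neighbourhood of $v$ in $T_pM$, the map $\exp_p$ is differentiable at $v$, and for every $w\in T_v(T_pM)\cong T_pM$ there is a unique Jacobi field $J$ along $\gamma_v|_{[0,1]}$ with $J(0)=0$ and $J'(0)=w$, and $$d\exp_p(v)[w]=J(1).$$ -/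

import Mathlib

open Set Topology
open scoped Manifold ContDiff

noncomputable section

/-! ### Linear algebra of the Chern connection -/

namespace ChernAlgebra

variable {E : Type*} [NormedAddCommGroup E] [NormedSpace ℝ E]

/- In this block, at a fixed point `(x, y)` of the tangent bundle in coordinates, `g` is the
fundamental tensor, `dg X Y Z` is the derivative of `g(Y, Z)` in the direction `X` of the base
(with `y` held fixed), and `C` is the Cartan tensor. -/

/-- The vector `Γ(y, y)`:  `g(Γ(y, y), Z) = dg(y; y, Z) - dg(Z; y, y) / 2`. -/
def spray (g : E →L[ℝ] E →L[ℝ] ℝ) (dg : E →L[ℝ] E →L[ℝ] E →L[ℝ] ℝ) (y : E) : E :=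
  g.inverse (dg y y - (1 / 2 : ℝ) • (dg.flip y).flip y)

/-- The nonlinear connection `X ↦ Γ(X, y)`:
`2 g(Γ(X, y), Z) = dg(X; y, Z) + dg(y; X, Z) - dg(Z; y, X) - 2 C(Γ(y, y), X, Z)`. -/
def nonlinear (g : E →L[ℝ] E →L[ℝ] ℝ) (dg C : E →L[ℝ] E →L[ℝ] E →L[ℝ] ℝ) (y : E) : E →L[ℝ] E :=
  (1 / 2 : ℝ) • g.inverse.comp
    (dg.flip y + dg y - (dg.flip y).flip - (2 : ℝ) • C (spray g dg y))

/-- The Christoffel symbols of the Chern connection, as a function `(X, Y) ↦ Γ(X, Y)`.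
With `N X = Γ(X, y)` this is the Koszul-type formula
`2 g(Γ(X, Y), Z) = dg(X; Y, Z) + dg(Y; X, Z) - dg(Z; X, Y)
  - 2 C(N X, Y, Z) - 2 C(N Y, X, Z) + 2 C(X, Y, N Z)`. -/
def symbol (g : E →L[ℝ] E →L[ℝ] ℝ) (dg C : E →L[ℝ] E →L[ℝ] E →L[ℝ] ℝ) (y X Y : E) : E :=
  (1 / 2 : ℝ) • g.inverse
    (dg X Y + dg Y X - (dg.flip X).flip Y
      - (2 : ℝ) • C (nonlinear g dg C y X) Y - (2 : ℝ) • C (nonlinear g dg C y Y) X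
      + (2 : ℝ) • (C X Y).comp (nonlinear g dg C y))

/-- `symbol` is the one and only solution of the two conditions that define the Chern connection:
torsion-freeness, and almost `g`-compatibility.  For a vector field `V` through `y` the latter reads
`X (g_V(Y, Z)) = g_V(∇_X Y, Z) + g_V(Y, ∇_X Z) + 2 C_V(∇_X V, Y, Z)`; for constant `Y`, `Z` one has
`X (g_V(Y, Z)) = dg(X; Y, Z) + 2 C(DV[X], Y, Z)` and `∇_X V = DV[X] + Γ(X, y)`, so that the terms
with `DV[X]` cancel and the condition below is left. -/
theorem eq_symbol_iff (g : E →L[ℝ] E →L[ℝ] ℝ) (dg C : E →L[ℝ] E →L[ℝ] E →L[ℝ] ℝ) (y : E)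
    (hg : g.IsInvertible) (gs : ∀ X Y, g X Y = g Y X)
    (dgs : ∀ X Y Z, dg X Y Z = dg X Z Y)
    (Cs : ∀ X Y Z, C X Y Z = C Y X Z) (Cs' : ∀ X Y Z, C X Y Z = C X Z Y)
    (Cy : ∀ Y Z, C y Y Z = 0) (Γ : E → E → E) :
    ((∀ X Y, Γ X Y = Γ Y X) ∧
      ∀ X Y Z, dg X Y Z = g (Γ X Y) Z + g Y (Γ X Z) + 2 * C (Γ X y) Y Z) ↔
    ∀ X Y, Γ X Y = symbol g dg C y X Y := by
  obtain ⟨e, rfl⟩ := hg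
  have inj : ∀ a b : E, (∀ Z, e a Z = e b Z) → a = b := fun a b h =>
    e.injective (ContinuousLinearMap.ext h)
  have Cy2 : ∀ X Z, C X y Z = 0 := fun X Z => by rw [Cs, Cy]
  have gs' : ∀ X Y, e X Y = e Y X := gs
  have hS : ∀ Z, e (spray (e : E →L[ℝ] E →L[ℝ] ℝ) dg y) Z
      = dg y y Z - (1 / 2) * dg Z y y := fun Z => by
    simp [spray, ContinuousLinearMap.inverse_equiv]
  have hN : ∀ X Z, e (nonlinear (e : E →L[ℝ] E →L[ℝ] ℝ) dg C y X) Z = (1 / 2) *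
      (dg X y Z + dg y X Z - dg Z y X
        - 2 * C (spray (e : E →L[ℝ] E →L[ℝ] ℝ) dg y) X Z) := fun X Z => by
    simp [nonlinear, ContinuousLinearMap.inverse_equiv]
  have hG : ∀ X Y Z, e (symbol (e : E →L[ℝ] E →L[ℝ] ℝ) dg C y X Y) Z = (1 / 2) *
      (dg X Y Z + dg Y X Z - dg Z X Y
        - 2 * C (nonlinear (e : E →L[ℝ] E →L[ℝ] ℝ) dg C y X) Y Z
        - 2 * C (nonlinear (e : E →L[ℝ] E →L[ℝ] ℝ) dg C y Y) X Z
        + 2 * C X Y (nonlinear (e : E →L[ℝ] E →L[ℝ] ℝ) dg C y Z)) := fun X Y Z => by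
    simp [symbol, ContinuousLinearMap.inverse_equiv]
    ring
  have hNy : nonlinear (e : E →L[ℝ] E →L[ℝ] ℝ) dg C y y
      = spray (e : E →L[ℝ] E →L[ℝ] ℝ) dg y := inj _ _ fun Z => by
    rw [hN, hS, Cy2]; ring
  have hGy : ∀ X, symbol (e : E →L[ℝ] E →L[ℝ] ℝ) dg C y X y
      = nonlinear (e : E →L[ℝ] E →L[ℝ] ℝ) dg C y X := fun X => inj _ _ fun Z => by
    rw [hG, hN, Cy2, Cy2, hNy, dgs Z X y]; ring
  constructor
  · rintro ⟨sym, comp⟩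
    have comp' : ∀ X Y Z, dg X Y Z = e (Γ X Y) Z + e Y (Γ X Z) + 2 * C (Γ X y) Y Z := comp
    have k : ∀ X Y Z, e (Γ X Y) Z = (1 / 2) * (dg X Y Z + dg Y X Z - dg Z X Y
        - 2 * C (Γ X y) Y Z - 2 * C (Γ Y y) X Z + 2 * C X Y (Γ Z y)) := fun X Y Z => by
      rw [comp' X Y Z, comp' Y X Z, comp' Z X Y, sym Y X, sym Z X, sym Z Y,
        gs' Y (Γ X Z), gs' X (Γ Y Z), Cs (Γ Z y) X Y, Cs' X (Γ Z y) Y]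
      ring
    have k1 : Γ y y = spray (e : E →L[ℝ] E →L[ℝ] ℝ) dg y := inj _ _ fun Z => by
      rw [k, hS, Cy2, Cy]; ring
    have k2 : ∀ X, Γ X y = nonlinear (e : E →L[ℝ] E →L[ℝ] ℝ) dg C y X := fun X =>
      inj _ _ fun Z => by
        rw [k, hN, Cy2, Cy2, k1, dgs Z X y]; ring
    exact fun X Y => inj _ _ fun Z => by rw [k, hG, k2, k2, k2]
  · intro h
    have sym : ∀ X Y, Γ X Y = Γ Y X := fun X Y => inj _ _ fun Z => by
      rw [h, h, hG, hG, dgs Z X Y, Cs X Y]; ring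
    refine ⟨sym, fun X Y Z => ?_⟩
    change dg X Y Z = e (Γ X Y) Z + e Y (Γ X Z) + 2 * C (Γ X y) Y Z
    rw [gs' Y, h, h, h, hGy, hG, hG, dgs X Z Y, dgs Z X Y, dgs Y X Z,
      Cs' (nonlinear _ _ _ _ X) Z Y, Cs X Y (nonlinear _ _ _ _ Z),
      Cs X Z (nonlinear _ _ _ _ Y), Cs' Y X, Cs Y _ X, Cs' (nonlinear _ _ _ _ Z) Y X,
      Cs' Z X, Cs Z _ X, Cs' (nonlinear _ _ _ _ Y) Z X]
    ring

end ChernAlgebra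

/-! ### Pseudo-Finsler metrics -/

section

variable {E : Type*} [NormedAddCommGroup E] [NormedSpace ℝ E]
  {M : Type*} [TopologicalSpace M] [ChartedSpace E M] [IsManifold 𝓘(ℝ, E) ∞ M]

/-- The fundamental tensor `g_v(u, w) = ½ ∂²/∂t∂s L(v + t u + s w)` at `t = s = 0`. -/
def fundamentalTensor (L : TangentBundle 𝓘(ℝ, E) M → ℝ) (x : M)
    (v u w : TangentSpace 𝓘(ℝ, E) x) : ℝ :=
  (1 / 2) * deriv (fun t : ℝ => deriv (fun s : ℝ => L ⟨x, v + t • u + s • w⟩) 0) 0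

variable (E M) in
/-- A (conic, two-homogeneous) pseudo-Finsler metric `L : A → ℝ` on `M`; the values of `toFun`
outside `A = domain` play no role. -/
structure PseudoFinslerMetric where
  domain : Set (TangentBundle 𝓘(ℝ, E) M)
  toFun : TangentBundle 𝓘(ℝ, E) M → ℝ
  isOpen_domain : IsOpen domain
  zero_notMem (x : M) : (⟨x, 0⟩ : TangentBundle 𝓘(ℝ, E) M) ∉ domain
  exists_mem (x : M) : ∃ v : TangentSpace 𝓘(ℝ, E) x,
    (⟨x, v⟩ : TangentBundle 𝓘(ℝ, E) M) ∈ domain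
  smul_mem (x : M) (v : TangentSpace 𝓘(ℝ, E) x) (c : ℝ) :
    (⟨x, v⟩ : TangentBundle 𝓘(ℝ, E) M) ∈ domain → 0 < c →
      (⟨x, c • v⟩ : TangentBundle 𝓘(ℝ, E) M) ∈ domain
  contMDiffOn : ContMDiffOn 𝓘(ℝ, E).tangent 𝓘(ℝ, ℝ) ∞ toFun domain
  homogeneous (x : M) (v : TangentSpace 𝓘(ℝ, E) x) (c : ℝ) :
    (⟨x, v⟩ : TangentBundle 𝓘(ℝ, E) M) ∈ domain → 0 < c →
      toFun ⟨x, c • v⟩ = c ^ 2 * toFun ⟨x, v⟩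
  nondegenerate (x : M) (v : TangentSpace 𝓘(ℝ, E) x) :
    (⟨x, v⟩ : TangentBundle 𝓘(ℝ, E) M) ∈ domain →
      ∀ u : TangentSpace 𝓘(ℝ, E) x,
        (∀ w : TangentSpace 𝓘(ℝ, E) x, fundamentalTensor toFun x v u w = 0) → u = 0

/-- The coordinates `(x, y)` of a tangent vector, in the chart of the tangent bundle induced by the
preferred chart of `M` at `x₀`: `x` is the base point, `y` are the components of the vector. -/
def tangentCoord (x₀ : M) (v : TangentBundle 𝓘(ℝ, E) M) : E × E :=
  extChartAt 𝓘(ℝ, E).tangent (⟨x₀, 0⟩ : TangentBundle 𝓘(ℝ, E) M) v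

/-- The tangent vector with coordinates `q = (x, y)` in the chart at `x₀`. -/
def tangentCoordSymm (x₀ : M) (q : E × E) : TangentBundle 𝓘(ℝ, E) M :=
  (extChartAt 𝓘(ℝ, E).tangent (⟨x₀, 0⟩ : TangentBundle 𝓘(ℝ, E) M)).symm q

/-- The velocity at time `t` of a curve `γ` defined on `s` (one-sided at the end points of `s`). -/
def velocity (γ : ℝ → M) (s : Set ℝ) (t : ℝ) : TangentSpace 𝓘(ℝ, E) (γ t) :=
  mfderivWithin 𝓘(ℝ, ℝ) 𝓘(ℝ, E) γ s t (1 : ℝ)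

/-- `X` is a smooth vector field along the curve `γ` defined on `s`. -/
def IsSmoothFieldAlong (γ : ℝ → M) (s : Set ℝ) (X : ∀ t, TangentSpace 𝓘(ℝ, E) (γ t)) : Prop :=
  ContMDiffOn 𝓘(ℝ, ℝ) 𝓘(ℝ, E).tangent ∞
    (fun t => (⟨γ t, X t⟩ : TangentBundle 𝓘(ℝ, E) M)) s

namespace PseudoFinslerMetric

variable (L : PseudoFinslerMetric E M)

/-! ### The Chern connection in coordinates -/

/-- `L` in the chart at `x₀`. -/
def coord (x₀ : M) (q : E × E) : ℝ := L.toFun (tangentCoordSymm x₀ q)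

/-- The fundamental tensor in the chart at `x₀`: half the second derivative of `L` along the
fibre. -/
def coordG (x₀ : M) (q : E × E) : E →L[ℝ] E →L[ℝ] ℝ :=
  (1 / 2 : ℝ) • fderiv ℝ (fun y => fderiv ℝ (fun y' => L.coord x₀ (q.1, y')) y) q.2

/-- The derivative of the fundamental tensor with respect to the base point. -/
def coordDG (x₀ : M) (q : E × E) : E →L[ℝ] E →L[ℝ] E →L[ℝ] ℝ :=
  fderiv ℝ (fun x => L.coordG x₀ (x, q.2)) q.1

/-- The Cartan tensor in the chart at `x₀`, `C_v(w₁, w₂, w₃) = ½ ∂/∂z g_{v + z w₁}(w₂, w₃)` at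
`z = 0`, that is, a quarter of the third derivative of `L` along the fibre. -/
def coordC (x₀ : M) (q : E × E) : E →L[ℝ] E →L[ℝ] E →L[ℝ] ℝ :=
  fderiv ℝ (fun y => (1 / 2 : ℝ) • L.coordG x₀ (q.1, y)) q.2

/-- The Christoffel symbols of the Chern connection in the chart at `x₀`, at the tangent vector
with coordinates `q`: `X, Y ↦ ∑ Γᵏᵢⱼ(q) Xⁱ Yʲ ∂ₖ`. -/
def christoffel (x₀ : M) (q : E × E) (X Y : E) : E :=
  ChernAlgebra.symbol (L.coordG x₀ q) (L.coordDG x₀ q) (L.coordC x₀ q) q.2 X Y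

/-- The covariant derivative `D^W_γ X` at time `t` of a vector field `X` along `γ : s → M`, with
reference field `W`. It is computed in the preferred chart at `γ t`, in which the components of an
element of `TangentSpace 𝓘(ℝ, E) (γ t) = E` are that element itself. -/
def covDeriv (γ : ℝ → M) (s : Set ℝ) (W X : ∀ t, TangentSpace 𝓘(ℝ, E) (γ t)) (t : ℝ) :
    TangentSpace 𝓘(ℝ, E) (γ t) :=
  (derivWithin (fun τ => (tangentCoord (γ t) ⟨γ τ, X τ⟩).2) s t
    + L.christoffel (γ t) (tangentCoord (γ t) ⟨γ t, W t⟩)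
        (tangentCoord (γ t) ⟨γ t, X t⟩).2
        (derivWithin (fun τ => extChartAt 𝓘(ℝ, E) (γ t) (γ τ)) s t) : E)

/-- `X' = D^{γ'}_γ X`. -/
def covDerivAlong (γ : ℝ → M) (s : Set ℝ) (X : ∀ t, TangentSpace 𝓘(ℝ, E) (γ t)) (t : ℝ) :
    TangentSpace 𝓘(ℝ, E) (γ t) :=
  L.covDeriv γ s (velocity γ s) X t

/-! ### Geodesics and the exponential map -/

/-- The curve `γ : s → M` is `L`-admissible: its velocity stays in the domain of `L`. -/
def IsAdmissible (γ : ℝ → M) (s : Set ℝ) : Prop :=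
  ∀ t ∈ s, (⟨γ t, velocity γ s t⟩ : TangentBundle 𝓘(ℝ, E) M) ∈ L.domain

/-- A geodesic is a smooth admissible curve whose velocity is parallel. -/
structure IsGeodesic (γ : ℝ → M) (s : Set ℝ) : Prop where
  contMDiffOn : ContMDiffOn 𝓘(ℝ, ℝ) 𝓘(ℝ, E) ∞ γ s
  admissible : L.IsAdmissible γ s
  parallel : ∀ t ∈ s, L.covDerivAlong γ s (velocity γ s) t = 0

/-- `γ` is a geodesic on `[0, b)` with initial velocity `v ∈ T_p M`. -/
def IsGeodesicFrom (p : M) (v : TangentSpace 𝓘(ℝ, E) p) (γ : ℝ → M) (b : ℝ) : Prop :=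
  L.IsGeodesic γ (Ico 0 b) ∧
    (⟨γ 0, velocity γ (Ico 0 b) 0⟩ : TangentBundle 𝓘(ℝ, E) M) = ⟨p, v⟩

open Classical in
/-- The maximal geodesic `γ_v` with initial velocity `v ∈ T_p M`: its value at `t` is the value at
`t` of any geodesic with initial velocity `v` whose domain `[0, b)` contains `t`. The value is `p`
if there is none. -/
def geodesic (p : M) (v : TangentSpace 𝓘(ℝ, E) p) (t : ℝ) : M :=
  if h : ∃ γ : ℝ → M, ∃ b : ℝ, t ∈ Ico 0 b ∧ L.IsGeodesicFrom p v γ b then h.choose t else p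

/-- The domain `𝒟_p` of the exponential map: the `v ∈ A ∩ T_p M` such that the geodesic with initial
velocity `v` exists on some `[0, b)` with `b > 1`. -/
def expDomain (p : M) : Set (TangentSpace 𝓘(ℝ, E) p) :=
  {v | (⟨p, v⟩ : TangentBundle 𝓘(ℝ, E) M) ∈ L.domain ∧
    ∃ b : ℝ, 1 < b ∧ ∃ γ : ℝ → M, L.IsGeodesicFrom p v γ b}

/-- The exponential map `exp_p(v) = γ_v(1)`. -/
def exp (p : M) (v : TangentSpace 𝓘(ℝ, E) p) : M := L.geodesic p v 1

/-! ### Two-parameter maps and the curvature along a curve -/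

/-- `Λ_t`, the velocity of the longitudinal curves `t ↦ Λ(t, s)`, `t ∈ T`. -/
def longVelocity (Λ : ℝ → ℝ → M) (T : Set ℝ) (t s : ℝ) : TangentSpace 𝓘(ℝ, E) (Λ t s) :=
  velocity (fun τ => Λ τ s) T t

/-- `Λ_s`, the velocity of the transverse curves `s ↦ Λ(t, s)`, `s ∈ S`. -/
def transVelocity (Λ : ℝ → ℝ → M) (S : Set ℝ) (t s : ℝ) : TangentSpace 𝓘(ℝ, E) (Λ t s) :=
  velocity (fun σ => Λ t σ) S s

/-- The covariant derivative along the longitudinal curves, with reference field `Λ_t`. -/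
def covDerivLong (Λ : ℝ → ℝ → M) (T : Set ℝ) (Z : ∀ t s, TangentSpace 𝓘(ℝ, E) (Λ t s))
    (t s : ℝ) : TangentSpace 𝓘(ℝ, E) (Λ t s) :=
  L.covDeriv (fun τ => Λ τ s) T (fun τ => longVelocity Λ T τ s) (fun τ => Z τ s) t

/-- The covariant derivative along the transverse curves, with reference field `Λ_t`. -/
def covDerivTrans (Λ : ℝ → ℝ → M) (T S : Set ℝ) (Z : ∀ t s, TangentSpace 𝓘(ℝ, E) (Λ t s))
    (t s : ℝ) : TangentSpace 𝓘(ℝ, E) (Λ t s) :=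
  L.covDeriv (fun σ => Λ t σ) S (fun σ => longVelocity Λ T t σ) (fun σ => Z t σ) s

/-- `R^Λ(Z) = D_{γ_s} D_{β_t} Z - D_{β_t} D_{γ_s} Z`, all with reference field `Λ_t`. -/
def variationCurvature (Λ : ℝ → ℝ → M) (T S : Set ℝ)
    (Z : ∀ t s, TangentSpace 𝓘(ℝ, E) (Λ t s)) (t s : ℝ) : TangentSpace 𝓘(ℝ, E) (Λ t s) :=
  L.covDerivLong Λ T (L.covDerivTrans Λ T S Z) t s
    - L.covDerivTrans Λ T S (L.covDerivLong Λ T Z) t s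

/-- `Λ : T × S → M` is a smooth admissible variation of `γ : T → M` with variational vector field
`W`, and `Z'` is a smooth vector field along `Λ` that extends the vector field `Z` along `γ`. -/
structure IsVariation (γ : ℝ → M) (T S : Set ℝ) (W Z : ∀ t, TangentSpace 𝓘(ℝ, E) (γ t))
    (Λ : ℝ → ℝ → M) (Z' : ∀ t s, TangentSpace 𝓘(ℝ, E) (Λ t s)) : Prop where
  contMDiffOn : ContMDiffOn 𝓘(ℝ, ℝ × ℝ) 𝓘(ℝ, E) ∞ (fun q : ℝ × ℝ => Λ q.1 q.2) (T ×ˢ S)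
  admissible : ∀ s ∈ S, L.IsAdmissible (fun τ => Λ τ s) T
  base : ∀ t ∈ T, Λ t 0 = γ t
  variational : ∀ t ∈ T,
    (⟨Λ t 0, transVelocity Λ S t 0⟩ : TangentBundle 𝓘(ℝ, E) M) = ⟨γ t, W t⟩
  contMDiffOn_ext : ContMDiffOn 𝓘(ℝ, ℝ × ℝ) 𝓘(ℝ, E).tangent ∞
    (fun q : ℝ × ℝ => (⟨Λ q.1 q.2, Z' q.1 q.2⟩ : TangentBundle 𝓘(ℝ, E) M)) (T ×ˢ S)
  extends_field : ∀ t ∈ T, (⟨Λ t 0, Z' t 0⟩ : TangentBundle 𝓘(ℝ, E) M) = ⟨γ t, Z t⟩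

/-- `R^γ(γ', W) Z` at time `t`: the value `R^Λ(Z')(t, 0)`, for any admissible variation `Λ` of `γ`
with variational field `W` and any extension `Z'` of `Z` to `Λ`. The value does not depend on these
choices. Since it depends only on the germ of `(Λ, Z')` at `(t, 0)`, it suffices that
the variation is given for times near `t`. -/
def curvatureAlong (γ : ℝ → M) (s : Set ℝ) (W Z : ∀ t, TangentSpace 𝓘(ℝ, E) (γ t)) (t : ℝ) :
    TangentSpace 𝓘(ℝ, E) (γ t) :=
  Classical.epsilon fun r : TangentSpace 𝓘(ℝ, E) (γ t) =>
    ∃ ε : ℝ, 0 < ε ∧ ∃ (Λ : ℝ → ℝ → M) (Z' : ∀ t s, TangentSpace 𝓘(ℝ, E) (Λ t s)),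
      L.IsVariation γ (s ∩ Ioo (t - ε) (t + ε)) (Ioo (-ε) ε) W Z Λ Z' ∧
      (⟨Λ t 0, L.variationCurvature Λ (s ∩ Ioo (t - ε) (t + ε)) (Ioo (-ε) ε) Z' t 0⟩ :
        TangentBundle 𝓘(ℝ, E) M) = ⟨γ t, r⟩

/-- `J` is a Jacobi field of the geodesic `γ : [a, b] → M`: `J'' = R^γ(γ', J) γ'`. -/
structure IsJacobiField (γ : ℝ → M) (a b : ℝ) (J : ∀ t, TangentSpace 𝓘(ℝ, E) (γ t)) : Prop where
  geodesic : L.IsGeodesic γ (Icc a b)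
  smooth : IsSmoothFieldAlong γ (Icc a b) J
  equation : ∀ t ∈ Icc a b,
    L.covDerivAlong γ (Icc a b) (L.covDerivAlong γ (Icc a b) J) t
      = L.curvatureAlong γ (Icc a b) J (velocity γ (Icc a b)) t

/-- `J` is a Jacobi field of `γ : [0, 1] → M` with `J(0) = 0` and `J'(0) = w ∈ T_p M`, where
`p = γ(0)`. -/
def IsJacobiFieldFrom (γ : ℝ → M) (p : M) (w : TangentSpace 𝓘(ℝ, E) p)
    (J : ∀ t, TangentSpace 𝓘(ℝ, E) (γ t)) : Prop :=
  L.IsJacobiField γ 0 1 J ∧ J 0 = 0 ∧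
    (⟨γ 0, L.covDerivAlong γ (Icc 0 1) J 0⟩ : TangentBundle 𝓘(ℝ, E) M) = ⟨p, w⟩

end PseudoFinslerMetric

end

end

/-! In a chart of the tangent bundle, the lift (x, ẋ) of a geodesic is an integral curve of the
spray S(x, y) = (y, -Γ(x, y)(y, y)), which is smooth on the open set representing A
(`covDerivAlong_velocity_eq_zero_iff`, `contDiffOn_sprayField`). The proposition is then a statement
about this ODE and its linearisation ξ' = DS(q) ξ.

Analysis: a C² field has a local flow that is differentiable in the initial point, with a derivative
that solves the linearised equation (`ContDiffAt.exists_local_flow_fderiv`). Composing such flow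
boxes along γ_v (`IsGeodesicFrom.exists_flowBox`) and inducting over the time interval shows that,
at each time t of existence of γ_v, all geodesics with initial velocity near v live beyond t and the
geodesic flow at time t is differentiable at v. At t = 1, together with openness of A, this gives
the neighbourhood and the differentiability of exp_p.

Geometry: in coordinates the commutator of covariant derivatives along a two-parameter map contains
no derivative of the field it acts on, only the curve, the variational field and its first
derivative (`commutator_eq_coordCurvature`). So R^γ is well defined and explicit, and for a geodesic
the equation J'' = R^γ(γ', J)γ' becomes exactly ξ' = DS(q) ξ with ξ = (j, j')
(`IsGeodesic.jacobi_equation_iff`). Consequently J(t) = d(u ↦ γ_u(t))(v)[w] is a Jacobi field. It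
vanishes at 0 because every γ_u starts at p, its derivative there is w because the flow at time 0 is
the inclusion of T_pM, and J(1) = d exp_p(v)[w] by definition. Uniqueness is uniqueness for the
linearised ODE.

Joint smoothness of (u, t) ↦ γ_u(t) is never needed: the curvature is evaluated on an auxiliary
variation that is affine in a chart (`exists_isVariation`), not on the variation through geodesics.
Working in charts is legitimate by the transformation law `christoffel_transition`, which follows
from the axioms that characterise the symbols. -/

open scoped NNReal

set_option linter.unusedSectionVars false
set_option maxSynthPendingDepth 4

/-! ### Real induction. -/

section RealInduction

/-- Induction along a closed interval. -/
theorem forall_mem_Icc_of_step {b : ℝ} {P : ℝ → Prop}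
    (step : ∀ t ∈ Icc (0 : ℝ) b, (∀ τ ∈ Ico 0 t, P τ) →
      ∃ ε > 0, ∀ τ ∈ Ico t (t + ε) ∩ Icc 0 b, P τ) : ∀ t ∈ Icc (0 : ℝ) b, P t := by
  by_contra! h
  obtain ⟨t₁, ht₁, hP⟩ := h
  set B := {t | t ∈ Icc (0 : ℝ) b ∧ ¬ P t} with hB
  have hbdd : BddBelow B := ⟨0, fun t ht => ht.1.1⟩
  have hne : B.Nonempty := ⟨t₁, ht₁, hP⟩
  have h0 : 0 ≤ sInf B := le_csInf hne fun t ht => ht.1.1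
  have h1 : sInf B ≤ b := (csInf_le hbdd ⟨ht₁, hP⟩).trans ht₁.2
  -- Every time before the infimum of the bad set is good, so the step makes a whole interval to the
  -- right of the infimum good, and the infimum cannot be approached by bad times.
  obtain ⟨ε, hε, H⟩ := step (sInf B) ⟨h0, h1⟩ fun τ hτ => by
    by_contra hn
    exact absurd (csInf_le hbdd ⟨⟨hτ.1, hτ.2.le.trans h1⟩, hn⟩) (not_le.2 hτ.2)
  obtain ⟨t, ht, hlt⟩ := exists_lt_of_csInf_lt hne (show sInf B < sInf B + ε by linarith)
  exact ht.2 (H t ⟨⟨csInf_le hbdd ht, hlt⟩, ht.1⟩)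

end RealInduction

/-! ### Ordinary differential equations: differentiable flows, uniqueness, smoothness. -/

section ODE

variable {F : Type*} [NormedAddCommGroup F] [NormedSpace ℝ F]

/-- Local flow of a `C¹` vector field, staying in a prescribed neighbourhood. -/
theorem ContDiffAt.exists_local_flow [CompleteSpace F] {f : F → F} {q₀ : F}
    (hf : ContDiffAt ℝ 1 f q₀) {U : Set F} (hU : U ∈ 𝓝 q₀) :
    ∃ ε > 0, ∃ Φ : F → ℝ → F, ∀ q ∈ Metric.ball q₀ ε, Φ q 0 = q ∧
      ∀ t ∈ Ioo (-ε) ε, HasDerivAt (Φ q) (f (Φ q t)) t ∧ Φ q t ∈ U := by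
  obtain ⟨δ, hδ, a, r, K₁, K₂, hr, hpl⟩ := IsPicardLindelof.of_contDiffAt_one hf
  obtain ⟨α, hα, hcont⟩ := (hpl 0).exists_forall_mem_closedBall_eq_hasDerivWithinAt_continuousOn
  have hr' : (0 : ℝ) < r := hr
  have hmem : ((q₀, 0) : F × ℝ) ∈ Metric.closedBall q₀ (r : ℝ) ×ˢ Icc (0 - δ) (0 + δ) :=
    ⟨Metric.mem_closedBall_self hr'.le, by constructor <;> linarith⟩
  have hnhds : Metric.closedBall q₀ (r : ℝ) ×ˢ Icc (0 - δ) (0 + δ) ∈ 𝓝 ((q₀, 0) : F × ℝ) :=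
    prod_mem_nhds (Metric.closedBall_mem_nhds _ hr') (Icc_mem_nhds (by linarith) (by linarith))
  have hc : ContinuousAt α (q₀, 0) := hcont.continuousAt hnhds
  have hv : α (q₀, 0) = q₀ := (hα q₀ (Metric.mem_closedBall_self hr'.le)).1
  -- Joint continuity of the flow at `(q₀, 0)` is what confines all nearby trajectories to `U` for a
  -- common short time.
  have hpre : α ⁻¹' U ∈ 𝓝 ((q₀, 0) : F × ℝ) := hc (by rwa [hv])
  obtain ⟨ε, hε, hball⟩ := Metric.mem_nhds_iff.1 (Filter.inter_mem hnhds hpre)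
  refine ⟨min ε δ, lt_min hε hδ, fun q t => α (q, t), fun q hq => ?_⟩
  have hin : ∀ t ∈ Ioo (-min ε δ) (min ε δ), (q, t) ∈ Metric.ball ((q₀, 0) : F × ℝ) ε := by
    intro t ht
    rw [Metric.mem_ball, Prod.dist_eq, max_lt_iff]
    refine ⟨(Metric.mem_ball.1 hq).trans_le (min_le_left _ _), ?_⟩
    rw [Real.dist_eq, sub_zero]
    exact (abs_lt.2 ht).trans_le (min_le_left _ _)
  have h0 := hball (hin 0 ⟨neg_lt_zero.2 (lt_min hε hδ), lt_min hε hδ⟩)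
  obtain ⟨hq0, hd⟩ := hα q h0.1.1
  refine ⟨hq0, fun t ht => ⟨?_, (hball (hin t ht)).2⟩⟩
  have h1 : min ε δ ≤ δ := min_le_right _ _
  exact (hd t ⟨by linarith [ht.1], by linarith [ht.2]⟩).hasDerivAt
    (Icc_mem_nhds (by linarith [ht.1]) (by linarith [ht.2]))

/-- The remainder of the first order Taylor expansion of a `C²` function is quadratic. -/
theorem ContDiffAt.exists_ball_quadratic {f : F → F} {q₀ : F} (hf : ContDiffAt ℝ 2 f q₀) :
    ∃ r > 0, ∃ K C : ℝ≥0, LipschitzOnWith K f (Metric.ball q₀ r) ∧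
      (∀ x ∈ Metric.ball q₀ r, ‖fderiv ℝ f x‖ ≤ K) ∧
      ∀ x ∈ Metric.ball q₀ r, ∀ y ∈ Metric.ball q₀ r,
        ‖f y - f x - fderiv ℝ f x (y - x)‖ ≤ C * ‖y - x‖ ^ 2 := by
  have hdf : ContDiffAt ℝ 1 (fderiv ℝ f) q₀ := hf.fderiv_right (by norm_num)
  obtain ⟨C, s, hs, hC⟩ := hdf.exists_lipschitzOnWith
  have hd : ∀ᶠ x in 𝓝 q₀, DifferentiableAt ℝ f x := by
    filter_upwards [hf.eventually (by simp)] with x hx using hx.differentiableAt (by simp)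
  have hb : ∀ᶠ x in 𝓝 q₀, ‖fderiv ℝ f x‖ < ‖fderiv ℝ f q₀‖ + 1 :=
    hdf.continuousAt.norm.eventually_lt continuousAt_const (by linarith)
  obtain ⟨r, hr, hball⟩ := Metric.mem_nhds_iff.1 (Filter.inter_mem hs (Filter.inter_mem hd hb))
  have hK : ∀ x ∈ Metric.ball q₀ r, ‖fderiv ℝ f x‖ ≤ (‖fderiv ℝ f q₀‖₊ + 1 : ℝ≥0) := fun x hx => by
    simpa using (hball hx).2.2.le
  refine ⟨r, hr, ‖fderiv ℝ f q₀‖₊ + 1, C, ?_, hK, fun x hx y hy => ?_⟩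
  · exact (convex_ball q₀ r).lipschitzOnWith_of_nnnorm_fderiv_le (fun x hx => (hball hx).2.1)
      fun x hx => by exact_mod_cast hK x hx
  · have hseg : segment ℝ x y ⊆ Metric.ball q₀ r := (convex_ball q₀ r).segment_subset hx hy
    -- Mean value inequality for `f - fderiv ℝ f x` on the segment, where the derivative of this
    -- difference is at most `C * ‖y - x‖`.
    have := (convex_segment x y).norm_image_sub_le_of_norm_hasFDerivWithin_le' (𝕜 := ℝ)
      (f := f) (f' := fderiv ℝ f) (φ := fderiv ℝ f x) (C := C * ‖y - x‖)
      (fun z hz => (hball (hseg hz)).2.1.hasFDerivAt.hasFDerivWithinAt)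
      (fun z hz => by
        have h1 := hC.dist_le_mul z (hball (hseg hz)).1 x (hball hx).1
        rw [dist_eq_norm, dist_eq_norm] at h1
        refine h1.trans ?_
        gcongr
        exact norm_sub_le_of_mem_segment hz)
      (left_mem_segment ℝ x y) (right_mem_segment ℝ x y)
    rw [pow_two, ← mul_assoc]
    exact this

/-- Local flow of a `C²` vector field together with its derivative in the initial condition. -/
theorem ContDiffAt.exists_local_flow_fderiv [CompleteSpace F] {f : F → F} {q₀ : F}
    (hf : ContDiffAt ℝ 2 f q₀) {U : Set F} (hU : U ∈ 𝓝 q₀) :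
    ∃ ε > 0, ∃ Φ : F → ℝ → F, ∃ D : F → ℝ → F →L[ℝ] F, ∀ q ∈ Metric.ball q₀ ε, Φ q 0 = q ∧
      (∀ t ∈ Ioo (-ε) ε, HasDerivAt (Φ q) (f (Φ q t)) t ∧ Φ q t ∈ U) ∧
      (∀ t ∈ Ioo (-ε) ε, HasDerivAt (D q) ((fderiv ℝ f (Φ q t)).comp (D q t)) t) ∧
      ∀ t ∈ Ico 0 ε, HasFDerivAt (fun q' => Φ q' t) (D q t) q := by
  obtain ⟨r, hr, K, C, hK, hK', hC⟩ := hf.exists_ball_quadratic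
  have hdf : ContDiffAt ℝ 1 (fderiv ℝ f) q₀ := hf.fderiv_right (by norm_num)
  -- The flow and its candidate derivative are solved for together: the augmented field is `C¹`
  -- because `f` is `C²`, and the operator component starts at the identity.
  let fT : F × (F →L[ℝ] F) → F × (F →L[ℝ] F) := fun z => (f z.1, (fderiv ℝ f z.1).comp z.2)
  have hfT : ContDiffAt ℝ 1 fT (q₀, ContinuousLinearMap.id ℝ F) := by
    refine ContDiffAt.prodMk ?_ ?_
    · exact (hf.of_le (by norm_num)).comp (q₀, ContinuousLinearMap.id ℝ F) contDiffAt_fst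
    · exact ContDiffAt.clm_comp
        (ContDiffAt.comp (q₀, ContinuousLinearMap.id ℝ F) hdf contDiffAt_fst) contDiffAt_snd
  obtain ⟨ε, hε, Ψ, hΨ⟩ := hfT.exists_local_flow
    (U := (U ∩ Metric.ball q₀ r) ×ˢ univ)
    (prod_mem_nhds (Filter.inter_mem hU (Metric.ball_mem_nhds _ hr)) Filter.univ_mem)
  have hin : ∀ q ∈ Metric.ball q₀ ε, ((q, ContinuousLinearMap.id ℝ F) : F × (F →L[ℝ] F)) ∈
      Metric.ball ((q₀, ContinuousLinearMap.id ℝ F) : F × (F →L[ℝ] F)) ε := fun q hq => by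
    rw [Metric.mem_ball, Prod.dist_eq, max_lt_iff, dist_self]
    exact ⟨hq, hε⟩
  set Φ : F → ℝ → F := fun q t => (Ψ (q, ContinuousLinearMap.id ℝ F) t).1 with hΦ
  set D : F → ℝ → F →L[ℝ] F := fun q t => (Ψ (q, ContinuousLinearMap.id ℝ F) t).2 with hD
  have hΦ0 : ∀ q ∈ Metric.ball q₀ ε, Φ q 0 = q := fun q hq => by
    simp [hΦ, (hΨ _ (hin q hq)).1]
  have hD0 : ∀ q ∈ Metric.ball q₀ ε, D q 0 = ContinuousLinearMap.id ℝ F := fun q hq => by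
    simp [hD, (hΨ _ (hin q hq)).1]
  have hΦd : ∀ q ∈ Metric.ball q₀ ε, ∀ t ∈ Ioo (-ε) ε, HasDerivAt (Φ q) (f (Φ q t)) t :=
    fun q hq t ht => ((hΨ _ (hin q hq)).2 t ht).1.fst
  have hDd : ∀ q ∈ Metric.ball q₀ ε, ∀ t ∈ Ioo (-ε) ε,
      HasDerivAt (D q) ((fderiv ℝ f (Φ q t)).comp (D q t)) t :=
    fun q hq t ht => ((hΨ _ (hin q hq)).2 t ht).1.snd
  have hΦU : ∀ q ∈ Metric.ball q₀ ε, ∀ t ∈ Ioo (-ε) ε, Φ q t ∈ U ∩ Metric.ball q₀ r :=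
    fun q hq t ht => ((hΨ _ (hin q hq)).2 t ht).2.1
  refine ⟨ε, hε, Φ, D, fun q hq => ⟨hΦ0 q hq, fun t ht => ⟨hΦd q hq t ht, (hΦU q hq t ht).1⟩,
    hDd q hq, fun t ht => ?_⟩⟩
  have hIco : ∀ τ ∈ Icc 0 t, τ ∈ Ioo (-ε) ε := fun τ hτ =>
    ⟨by linarith [hτ.1], hτ.2.trans_lt ht.2⟩
  have hIco' : ∀ τ ∈ Ico 0 t, τ ∈ Ioo (-ε) ε := fun τ hτ => hIco τ ⟨hτ.1, hτ.2.le⟩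
  -- Lipschitz dependence on the initial condition
  have lip : ∀ q' ∈ Metric.ball q₀ ε, ∀ τ ∈ Icc 0 t,
      ‖Φ q' τ - Φ q τ‖ ≤ Real.exp (K * t) * ‖q' - q‖ := fun q' hq' τ hτ => by
    have h := dist_le_of_trajectories_ODE_of_mem (v := fun _ => f) (s := fun _ => Metric.ball q₀ r)
      (K := K) (f := Φ q') (g := Φ q) (a := 0) (b := t) (δ := ‖q' - q‖) (fun _ _ => hK)
      (fun τ hτ => (hΦd q' hq' τ (hIco τ hτ)).continuousAt.continuousWithinAt)
      (fun τ hτ => (hΦd q' hq' τ (hIco' τ hτ)).hasDerivWithinAt)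
      (fun τ hτ => (hΦU q' hq' τ (hIco' τ hτ)).2)
      (fun τ hτ => (hΦd q hq τ (hIco τ hτ)).continuousAt.continuousWithinAt)
      (fun τ hτ => (hΦd q hq τ (hIco' τ hτ)).hasDerivWithinAt)
      (fun τ hτ => (hΦU q hq τ (hIco' τ hτ)).2)
      (by rw [hΦ0 q' hq', hΦ0 q hq, dist_eq_norm]) τ hτ
    rw [dist_eq_norm, mul_comm] at h
    refine h.trans ?_
    gcongr
    linarith [hτ.2]
  -- The error `e` starts at zero and satisfies `‖e'‖ ≤ K ‖e‖ + C ‖Φ q' - Φ q‖²`. The last term is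
  -- quadratic in `q' - q` by `lip`, so Grönwall bounds `e` quadratically.
  have main : ∀ q' ∈ Metric.ball q₀ ε, ‖Φ q' t - Φ q t - D q t (q' - q)‖ ≤
      gronwallBound 0 K 1 t * (C * Real.exp (K * t) ^ 2) * ‖q' - q‖ ^ 2 := fun q' hq' => by
    have hE : ∀ τ ∈ Icc 0 t, HasDerivAt (fun τ => Φ q' τ - Φ q τ - D q τ (q' - q))
        (f (Φ q' τ) - f (Φ q τ) - fderiv ℝ f (Φ q τ) (D q τ (q' - q))) τ := fun τ hτ =>
      ((hΦd q' hq' τ (hIco τ hτ)).sub (hΦd q hq τ (hIco τ hτ))).sub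
        ((ContinuousLinearMap.apply ℝ F (q' - q)).hasFDerivAt.comp_hasDerivAt τ
          (hDd q hq τ (hIco τ hτ)))
    have h := norm_le_gronwallBound_of_norm_deriv_right_le
      (δ := 0) (K := K) (ε := C * Real.exp (K * t) ^ 2 * ‖q' - q‖ ^ 2) (a := 0) (b := t)
      (fun τ hτ => (hE τ hτ).continuousAt.continuousWithinAt)
      (fun τ hτ => (hE τ ⟨hτ.1, hτ.2.le⟩).hasDerivWithinAt)
      (by simp [hΦ0 q' hq', hΦ0 q hq, hD0 q hq])
      (fun τ hτ => by
        have hm := (hΦU q hq τ (hIco' τ hτ)).2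
        have e : f (Φ q' τ) - f (Φ q τ) - fderiv ℝ f (Φ q τ) (D q τ (q' - q))
            = fderiv ℝ f (Φ q τ) (Φ q' τ - Φ q τ - D q τ (q' - q))
              + (f (Φ q' τ) - f (Φ q τ) - fderiv ℝ f (Φ q τ) (Φ q' τ - Φ q τ)) := by
          simp only [map_sub]; abel
        rw [e]
        refine (norm_add_le _ _).trans (add_le_add ?_ ?_)
        · exact (ContinuousLinearMap.le_opNorm _ _).trans (by gcongr; exact hK' _ hm)
        · refine (hC _ hm _ (hΦU q' hq' τ (hIco' τ hτ)).2).trans ?_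
          rw [mul_assoc, ← mul_pow]
          gcongr
          exact lip q' hq' τ ⟨hτ.1, hτ.2.le⟩) t ⟨ht.1, le_rfl⟩
    refine h.trans (le_of_eq ?_)
    rw [sub_zero]
    -- `gronwallBound` is given by separate formulas for `K = 0` and `K ≠ 0`; with zero initial
    -- value both are linear in the inhomogeneity.
    by_cases hK0 : (K : ℝ) = 0
    · simp [hK0, gronwallBound_K0]; ring
    · simp [gronwallBound_of_K_ne_0 hK0]; ring
  rw [hasFDerivAt_iff_isLittleO]
  have hO : (fun q' => Φ q' t - Φ q t - D q t (q' - q)) =O[𝓝 q] fun q' => ‖q' - q‖ ^ 2 :=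
    Asymptotics.IsBigO.of_bound _ (by
      filter_upwards [Metric.isOpen_ball.mem_nhds hq] with q' hq'
      simpa using main q' hq')
  exact hO.trans_isLittleO ((Asymptotics.isLittleO_norm_pow_id one_lt_two).comp_tendsto
    (tendsto_sub_nhds_zero_iff.2 Filter.tendsto_id))

/-- Forward uniqueness: two solutions in an open set with the same value at `t`
agree for a short time. -/
theorem ODE_eq_of_eq_forward {f : F → F} {c₁ c₂ : ℝ → F} {a b : ℝ} (hab : a < b)
    (hf : ContDiffAt ℝ 1 f (c₁ a))
    (h₁ : ∀ t ∈ Ico a b, HasDerivWithinAt c₁ (f (c₁ t)) (Ico a b) t)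
    (h₂ : ∀ t ∈ Ico a b, HasDerivWithinAt c₂ (f (c₂ t)) (Ico a b) t) (h : c₁ a = c₂ a) :
    ∃ ε > 0, ∀ t ∈ Ico a (a + ε), c₁ t = c₂ t := by
  obtain ⟨K, s, hs, hK⟩ := hf.exists_lipschitzOnWith
  have ha : a ∈ Ico a b := ⟨le_rfl, hab⟩
  have e₁ : ∀ᶠ t in 𝓝[Ico a b] a, c₁ t ∈ s := (h₁ a ha).continuousWithinAt hs
  have e₂ : ∀ᶠ t in 𝓝[Ico a b] a, c₂ t ∈ s := (h₂ a ha).continuousWithinAt (by rwa [← h])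
  obtain ⟨ε, hε, H⟩ := Metric.mem_nhdsWithin_iff.1 (e₁.and e₂)
  have hsub : ∀ t, t ∈ Ico a (min (a + ε) b) → t ∈ Metric.ball a ε ∩ Ico a b := fun t ht => by
    refine ⟨?_, ht.1, ht.2.trans_le (min_le_right _ _)⟩
    rw [Metric.mem_ball, Real.dist_eq, abs_lt]
    constructor <;> linarith [ht.1, ht.2.trans_le (min_le_left _ _)]
  refine ⟨min ε (b - a), lt_min hε (by linarith), fun t ht => ?_⟩
  have ht' : t ∈ Ico a (min (a + ε) b) :=
    ⟨ht.1, ht.2.trans_le (by rw [← min_add_add_left]; simp)⟩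
  have hI : Icc a t ⊆ Ico a (min (a + ε) b) := fun τ hτ => ⟨hτ.1, hτ.2.trans_lt ht'.2⟩
  have hd : ∀ {c : ℝ → F}, (∀ t ∈ Ico a b, HasDerivWithinAt c (f (c t)) (Ico a b) t) →
      ∀ τ ∈ Ico a t, HasDerivWithinAt c (f (c τ)) (Ici τ) τ := fun {c} hc τ hτ => by
    have := hsub τ (hI ⟨hτ.1, hτ.2.le⟩)
    exact (hc τ this.2).mono_of_mem_nhdsWithin
      (mem_nhdsWithin.2 ⟨Iio b, isOpen_Iio, this.2.2, fun x hx => ⟨hτ.1.trans hx.2, hx.1⟩⟩)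
  exact ODE_solution_unique_of_mem_Icc_right (v := fun _ => f) (s := fun _ => s) (K := K)
    (fun _ _ => hK)
    (fun τ hτ => ((h₁ τ (hsub τ (hI hτ)).2).continuousWithinAt).mono
      fun x hx => (hsub x (hI hx)).2)
    (hd h₁) (fun τ hτ => (H (hsub τ (hI ⟨hτ.1, hτ.2.le⟩))).1)
    (fun τ hτ => ((h₂ τ (hsub τ (hI hτ)).2).continuousWithinAt).mono
      fun x hx => (hsub x (hI hx)).2)
    (hd h₂) (fun τ hτ => (H (hsub τ (hI ⟨hτ.1, hτ.2.le⟩))).2) h ⟨ht.1, le_rfl⟩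

/-- Solutions of an ODE with smooth right hand side are smooth. -/
theorem contDiffOn_infty_of_hasDerivWithinAt {f : F → F} {U : Set F} (hf : ContDiffOn ℝ ∞ f U)
    {c : ℝ → F} {s : Set ℝ} (hs : UniqueDiffOn ℝ s)
    (hc : ∀ t ∈ s, HasDerivWithinAt c (f (c t)) s t) (hU : MapsTo c s U) :
    ContDiffOn ℝ ∞ c s := by
  rw [contDiffOn_infty]
  intro n
  induction n with
  | zero => exact contDiffOn_zero.2 fun t ht => (hc t ht).continuousWithinAt
  | succ n ih =>
    push_cast
    rw [contDiffOn_succ_iff_derivWithin hs]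
    refine ⟨fun t ht => (hc t ht).differentiableWithinAt, by simp, ?_⟩
    -- Bootstrap: the derivative is `f ∘ c`, hence as smooth as `c` is already known to be.
    exact ((hf.of_le (by exact_mod_cast le_top)).comp ih hU).congr
      fun t ht => (hc t ht).derivWithin (hs t ht)

end ODE

/-! ### Charts of the tangent bundle and their transition maps. -/

section TangentCoordinates

variable {E : Type*} [NormedAddCommGroup E] [NormedSpace ℝ E]
  {M : Type*} [TopologicalSpace M] [ChartedSpace E M] [IsManifold 𝓘(ℝ, E) ∞ M]

/-- The transition map between the preferred charts at `x₀` and `x₁`. -/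
noncomputable def chartTransition (E : Type*) [NormedAddCommGroup E] [NormedSpace ℝ E]
    {M : Type*} [TopologicalSpace M] [ChartedSpace E M] (x₀ x₁ : M) : E → E :=
  extChartAt 𝓘(ℝ, E) x₁ ∘ (extChartAt 𝓘(ℝ, E) x₀).symm

/-- The domain of `chartTransition`. -/
noncomputable def chartOverlap (E : Type*) [NormedAddCommGroup E] [NormedSpace ℝ E]
    {M : Type*} [TopologicalSpace M] [ChartedSpace E M] (x₀ x₁ : M) : Set E :=
  (extChartAt 𝓘(ℝ, E) x₀).target ∩
    (extChartAt 𝓘(ℝ, E) x₀).symm ⁻¹' (chartAt E x₁).source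

theorem isOpen_chartOverlap (x₀ x₁ : M) : IsOpen (chartOverlap E x₀ x₁) :=
  (continuousOn_extChartAt_symm x₀).isOpen_inter_preimage (isOpen_extChartAt_target x₀)
    (chartAt E x₁).open_source

theorem contDiffOn_chartTransition (x₀ x₁ : M) :
    ContDiffOn ℝ ∞ (chartTransition E x₀ x₁) (chartOverlap E x₀ x₁) := by
  intro x hx
  have h := contDiffWithinAt_ext_coord_change (I := 𝓘(ℝ, E)) (n := ∞) x₁ x₀ (y := x)
    (by rw [PartialEquiv.trans_source, PartialEquiv.symm_source, extChartAt_source]; exact hx)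
  exact h.mono (by simp)

theorem extChartAt_mem_chartOverlap {x₀ x₁ x : M} (h₀ : x ∈ (chartAt E x₀).source)
    (h₁ : x ∈ (chartAt E x₁).source) : extChartAt 𝓘(ℝ, E) x₀ x ∈ chartOverlap E x₀ x₁ := by
  have h₀' : x ∈ (extChartAt 𝓘(ℝ, E) x₀).source := by rwa [extChartAt_source]
  refine ⟨(extChartAt 𝓘(ℝ, E) x₀).map_source h₀', ?_⟩
  rw [mem_preimage, (extChartAt 𝓘(ℝ, E) x₀).left_inv h₀']
  exact h₁

theorem chartTransition_extChartAt {x₀ x : M} (x₁ : M) (h₀ : x ∈ (chartAt E x₀).source) :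
    chartTransition E x₀ x₁ (extChartAt 𝓘(ℝ, E) x₀ x) = extChartAt 𝓘(ℝ, E) x₁ x := by
  rw [chartTransition, Function.comp_apply, (extChartAt 𝓘(ℝ, E) x₀).left_inv (by rwa [extChartAt_source])]

theorem tangentCoord_fst (x₀ : M) (z : TangentBundle 𝓘(ℝ, E) M) :
    (tangentCoord x₀ z).1 = extChartAt 𝓘(ℝ, E) x₀ z.1 := rfl

theorem tangentCoord_snd (x₀ : M) (z : TangentBundle 𝓘(ℝ, E) M) :
    (tangentCoord x₀ z).2 = tangentCoordChange 𝓘(ℝ, E) z.1 x₀ z.1 z.2 := rfl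

theorem extChartAt_tangent_source (x₀ : M) :
    (extChartAt 𝓘(ℝ, E).tangent (⟨x₀, 0⟩ : TangentBundle 𝓘(ℝ, E) M)).source
      = {z | z.1 ∈ (chartAt E x₀).source} := by
  ext z
  rw [extChartAt_source, TangentBundle.mem_chart_source_iff]
  rfl

theorem extChartAt_tangent_target (x₀ : M) :
    (extChartAt 𝓘(ℝ, E).tangent (⟨x₀, 0⟩ : TangentBundle 𝓘(ℝ, E) M)).target
      = (extChartAt 𝓘(ℝ, E) x₀).target ×ˢ univ := by
  ext q
  rw [extChartAt_target]
  simp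
  exact TangentBundle.mem_chart_target_iff q (⟨x₀, 0⟩ : TangentBundle 𝓘(ℝ, E) M)

theorem tangentCoordSymm_tangentCoord {x₀ : M} {z : TangentBundle 𝓘(ℝ, E) M}
    (h : z.1 ∈ (chartAt E x₀).source) : tangentCoordSymm x₀ (tangentCoord x₀ z) = z :=
  PartialEquiv.left_inv _ (by rw [extChartAt_tangent_source]; exact h)

theorem tangentCoord_tangentCoordSymm {x₀ : M} {q : E × E}
    (h : q.1 ∈ (extChartAt 𝓘(ℝ, E) x₀).target) :
    tangentCoord x₀ (tangentCoordSymm x₀ q) = q :=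
  PartialEquiv.right_inv _ (by rw [extChartAt_tangent_target]; exact ⟨h, mem_univ _⟩)

theorem tangentCoordSymm_mem {x₀ : M} {q : E × E} (h : q.1 ∈ (extChartAt 𝓘(ℝ, E) x₀).target) :
    (tangentCoordSymm x₀ q).1 ∈ (chartAt E x₀).source := by
  have := (extChartAt 𝓘(ℝ, E) x₀).map_target h
  rwa [extChartAt_source] at this

/-- Vectors over base points that are only propositionally equal lie in different types. Equality in
the total space, tested in coordinates, avoids transporting them. -/
theorem tangentCoord_injOn {x₀ : M} {z z' : TangentBundle 𝓘(ℝ, E) M}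
    (h : z.1 ∈ (chartAt E x₀).source) (h' : z'.1 ∈ (chartAt E x₀).source)
    (e : tangentCoord x₀ z = tangentCoord x₀ z') : z = z' := by
  rw [← tangentCoordSymm_tangentCoord h, e, tangentCoordSymm_tangentCoord h']

theorem tangentCoord_self_snd (x : M) (v : TangentSpace 𝓘(ℝ, E) x) :
    (tangentCoord x (⟨x, v⟩ : TangentBundle 𝓘(ℝ, E) M)).2 = v :=
  tangentCoordChange_self (mem_extChartAt_source x)

/-- Ties the bundle's coordinate change to an ordinary derivative on `E`, which can be
differentiated once more in the law for the Christoffel symbols. -/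
theorem tangentCoordChange_eq_fderiv (x₀ x₁ x : M) :
    tangentCoordChange 𝓘(ℝ, E) x₀ x₁ x
      = fderiv ℝ (chartTransition E x₀ x₁) (extChartAt 𝓘(ℝ, E) x₀ x) := by
  rw [tangentCoordChange_def, ModelWithCorners.range_eq_univ, fderivWithin_univ]
  rfl

/-- Components of tangent vectors are linear in the vector. -/
theorem tangentCoord_snd_add (x₀ x : M) (v w : TangentSpace 𝓘(ℝ, E) x) :
    (tangentCoord x₀ (⟨x, v + w⟩ : TangentBundle 𝓘(ℝ, E) M)).2
      = (tangentCoord x₀ ⟨x, v⟩).2 + (tangentCoord x₀ ⟨x, w⟩).2 :=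
  map_add (tangentCoordChange 𝓘(ℝ, E) x x₀ x) v w

theorem tangentCoord_snd_sub (x₀ x : M) (v w : TangentSpace 𝓘(ℝ, E) x) :
    (tangentCoord x₀ (⟨x, v - w⟩ : TangentBundle 𝓘(ℝ, E) M)).2
      = (tangentCoord x₀ ⟨x, v⟩).2 - (tangentCoord x₀ ⟨x, w⟩).2 :=
  map_sub (tangentCoordChange 𝓘(ℝ, E) x x₀ x) v w

theorem tangentCoord_snd_smul (x₀ x : M) (c : ℝ) (v : TangentSpace 𝓘(ℝ, E) x) :
    (tangentCoord x₀ (⟨x, c • v⟩ : TangentBundle 𝓘(ℝ, E) M)).2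
      = c • (tangentCoord x₀ ⟨x, v⟩).2 :=
  map_smul (tangentCoordChange 𝓘(ℝ, E) x x₀ x) c v

theorem tangentCoord_snd_zero (x₀ x : M) :
    (tangentCoord x₀ (⟨x, 0⟩ : TangentBundle 𝓘(ℝ, E) M)).2 = 0 :=
  map_zero (tangentCoordChange 𝓘(ℝ, E) x x₀ x)

theorem tangentCoord_snd_injective {x₀ x : M} (h : x ∈ (chartAt E x₀).source)
    {v w : TangentSpace 𝓘(ℝ, E) x}
    (e : (tangentCoord x₀ (⟨x, v⟩ : TangentBundle 𝓘(ℝ, E) M)).2 = (tangentCoord x₀ ⟨x, w⟩).2) :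
    v = w := by
  have := tangentCoord_injOn (z := ⟨x, v⟩) (z' := ⟨x, w⟩) h h (Prod.ext rfl e)
  simpa using this

/-- Change of coordinates on the tangent bundle. -/
theorem tangentCoord_transition {x₀ x₁ : M} {z : TangentBundle 𝓘(ℝ, E) M}
    (h₀ : z.1 ∈ (chartAt E x₀).source) (h₁ : z.1 ∈ (chartAt E x₁).source) :
    tangentCoord x₁ z = (chartTransition E x₀ x₁ (tangentCoord x₀ z).1,
      fderiv ℝ (chartTransition E x₀ x₁) (tangentCoord x₀ z).1 (tangentCoord x₀ z).2) := by
  refine Prod.ext ?_ ?_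
  · rw [tangentCoord_fst, tangentCoord_fst, chartTransition_extChartAt x₁ h₀]
  · rw [tangentCoord_fst, ← tangentCoordChange_eq_fderiv, tangentCoord_snd, tangentCoord_snd]
    refine (tangentCoordChange_comp (I := 𝓘(ℝ, E)) (v := (z.2 : E)) ?_).symm
    simp only [extChartAt_source]
    exact ⟨⟨mem_chart_source E z.1, h₀⟩, h₁⟩

theorem tangentCoordSymm_transition {x₀ x₁ : M} {q : E × E} (h : q.1 ∈ chartOverlap E x₀ x₁) :
    tangentCoordSymm x₀ q = tangentCoordSymm x₁ (chartTransition E x₀ x₁ q.1,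
      fderiv ℝ (chartTransition E x₀ x₁) q.1 q.2) := by
  have h₁ : (tangentCoordSymm x₀ q).1 ∈ (chartAt E x₁).source := h.2
  rw [← tangentCoordSymm_tangentCoord h₁,
    tangentCoord_transition (tangentCoordSymm_mem h.1) h₁, tangentCoord_tangentCoordSymm h.1]

/-- The inverse is the opposite change of coordinates, by the cocycle identity. -/
theorem isInvertible_fderiv_chartTransition {x₀ x₁ : M} {x : E} (h : x ∈ chartOverlap E x₀ x₁) :
    Function.Bijective (fderiv ℝ (chartTransition E x₀ x₁) x) := by
  set m := (extChartAt 𝓘(ℝ, E) x₀).symm x with hm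
  have hx : extChartAt 𝓘(ℝ, E) x₀ m = x := (extChartAt 𝓘(ℝ, E) x₀).right_inv h.1
  have h₀ : m ∈ (extChartAt 𝓘(ℝ, E) x₀).source := (extChartAt 𝓘(ℝ, E) x₀).map_target h.1
  have h₁ : m ∈ (extChartAt 𝓘(ℝ, E) x₁).source := by rw [extChartAt_source]; exact h.2
  rw [← hx, ← tangentCoordChange_eq_fderiv]
  refine Function.bijective_iff_has_inverse.2
    ⟨tangentCoordChange 𝓘(ℝ, E) x₁ x₀ m, fun v => ?_, fun v => ?_⟩
  · rw [tangentCoordChange_comp ⟨⟨h₀, h₁⟩, h₀⟩, tangentCoordChange_self h₀]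
  · rw [tangentCoordChange_comp ⟨⟨h₁, h₀⟩, h₁⟩, tangentCoordChange_self h₁]

theorem contMDiffOn_tangentCoord (x₀ : M) :
    ContMDiffOn 𝓘(ℝ, E).tangent 𝓘(ℝ, E × E) ∞ (tangentCoord x₀)
      {z : TangentBundle 𝓘(ℝ, E) M | z.1 ∈ (chartAt E x₀).source} := by
  have h := contMDiffOn_extChartAt (I := 𝓘(ℝ, E).tangent) (n := ∞)
    (x := (⟨x₀, 0⟩ : TangentBundle 𝓘(ℝ, E) M))
  rw [← extChartAt_source (I := 𝓘(ℝ, E).tangent), extChartAt_tangent_source] at h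
  exact h

theorem isOpen_setOf_proj_mem (x₀ : M) :
    IsOpen {z : TangentBundle 𝓘(ℝ, E) M | z.1 ∈ (chartAt E x₀).source} := by
  rw [← extChartAt_tangent_source]; exact isOpen_extChartAt_source _

theorem contMDiffOn_tangentCoordSymm (x₀ : M) :
    ContMDiffOn 𝓘(ℝ, E × E) 𝓘(ℝ, E).tangent ∞
      (tangentCoordSymm x₀ : E × E → TangentBundle 𝓘(ℝ, E) M)
      ((extChartAt 𝓘(ℝ, E) x₀).target ×ˢ univ) := by
  have h := contMDiffOn_extChartAt_symm (I := 𝓘(ℝ, E).tangent) (n := ∞)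
    (⟨x₀, 0⟩ : TangentBundle 𝓘(ℝ, E) M)
  rw [extChartAt_tangent_target] at h
  exact h

end TangentCoordinates

/-! ### Derivatives along the fibres of the tangent bundle in coordinates. -/

section FiberCalculus

variable {E G : Type*} [NormedAddCommGroup E] [NormedSpace ℝ E]
  [NormedAddCommGroup G] [NormedSpace ℝ G]

theorem fderiv_prodMk_right {f : E × E → G} {q : E × E} (hf : DifferentiableAt ℝ f q) :
    fderiv ℝ (fun y => f (q.1, y)) q.2 = (fderiv ℝ f q).comp (ContinuousLinearMap.inr ℝ E E) :=
  (hf.hasFDerivAt.comp q.2 (hasFDerivAt_prodMk_right q.1 q.2)).fderiv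

theorem fderiv_prodMk_left {f : E × E → G} {q : E × E} (hf : DifferentiableAt ℝ f q) :
    fderiv ℝ (fun x => f (x, q.2)) q.1 = (fderiv ℝ f q).comp (ContinuousLinearMap.inl ℝ E E) :=
  (hf.hasFDerivAt.comp q.1 (hasFDerivAt_prodMk_left q.1 q.2)).fderiv

/-- Half the second derivative of a function along the fibres of `E × E → E`. -/
noncomputable def fiberHessian (ℓ : E × E → ℝ) (q : E × E) : E →L[ℝ] E →L[ℝ] ℝ :=
  (1 / 2 : ℝ) • fderiv ℝ (fun y => fderiv ℝ (fun y' => ℓ (q.1, y')) y) q.2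

variable {ℓ : E × E → ℝ} {V : Set (E × E)}

theorem ContDiffOn.fiber (hℓ : ContDiffOn ℝ ∞ ℓ V) (x : E) :
    ContDiffOn ℝ ∞ (fun y => ℓ (x, y)) {y | (x, y) ∈ V} :=
  hℓ.comp (contDiff_const.prodMk contDiff_id).contDiffOn fun _ hy => hy

theorem IsOpen.fiber (hV : IsOpen V) (x : E) : IsOpen {y | (x, y) ∈ V} :=
  hV.preimage (by fun_prop : Continuous fun y : E => (x, y))

theorem ContDiffOn.contDiffOn_fderiv_of_isOpen {F : Type*} [NormedAddCommGroup F]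
    [NormedSpace ℝ F] {f : F → G} {U : Set F} (hf : ContDiffOn ℝ ∞ f U) (hU : IsOpen U) :
    ContDiffOn ℝ ∞ (fderiv ℝ f) U :=
  hf.fderiv_of_isOpen hU (by simp)

/-- A fibre derivative is the full derivative restricted to vertical vectors, so two fibre
derivatives of a jointly smooth function are jointly smooth, and not only smooth on each fibre. -/
theorem contDiffOn_fiberHessian (hV : IsOpen V) (hℓ : ContDiffOn ℝ ∞ ℓ V) :
    ContDiffOn ℝ ∞ (fiberHessian ℓ) V := by
  set h : E × E → E →L[ℝ] ℝ := fun q => (fderiv ℝ ℓ q).comp (ContinuousLinearMap.inr ℝ E E)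
  have hh : ContDiffOn ℝ ∞ h V :=
    (hℓ.contDiffOn_fderiv_of_isOpen hV).clm_comp contDiffOn_const
  have key : ∀ q ∈ V, fiberHessian ℓ q
      = (1 / 2 : ℝ) • (fderiv ℝ h q).comp (ContinuousLinearMap.inr ℝ E E) := fun q hq => by
    rw [fiberHessian, ← fderiv_prodMk_right
      ((hh.differentiableOn (by simp)).differentiableAt (hV.mem_nhds hq))]
    congr 1
    refine Filter.EventuallyEq.fderiv_eq ?_
    filter_upwards [(hV.fiber q.1).mem_nhds hq] with y hy
    exact fderiv_prodMk_right (q := (q.1, y))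
      ((hℓ.differentiableOn (by simp)).differentiableAt (hV.mem_nhds hy))
  exact (((hh.contDiffOn_fderiv_of_isOpen hV).clm_comp contDiffOn_const).const_smul
    (1 / 2 : ℝ)).congr key

theorem fiberHessian_symm (hV : IsOpen V) (hℓ : ContDiffOn ℝ ∞ ℓ V) {q : E × E} (hq : q ∈ V)
    (u w : E) : fiberHessian ℓ q u w = fiberHessian ℓ q w u := by
  have h : ContDiffAt ℝ ∞ (fun y => ℓ (q.1, y)) q.2 :=
    (hℓ.fiber q.1).contDiffAt ((hV.fiber q.1).mem_nhds hq)
  have := (h.isSymmSndFDerivAt (by simp; norm_cast)) u w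
  simp only [fiberHessian, _root_.smul_apply]
  rw [this]

theorem fderiv_clm_apply_apply {F : Type*} [NormedAddCommGroup F] [NormedSpace ℝ F]
    {f : F → E →L[ℝ] E →L[ℝ] G} {x : F} (hf : DifferentiableAt ℝ f x) (X : F) (Y Z : E) :
    fderiv ℝ f x X Y Z = fderiv ℝ (fun x => f x Y Z) x X := by
  rw [fderiv_clm_apply (hf.clm_apply (differentiableAt_const Y)) (differentiableAt_const Z),
    fderiv_clm_apply hf (differentiableAt_const Y)]
  simp

theorem fderiv_clm_symm {F : Type*} [NormedAddCommGroup F] [NormedSpace ℝ F]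
    {f : F → E →L[ℝ] E →L[ℝ] G} {x : F} (hf : DifferentiableAt ℝ f x)
    (hs : ∀ᶠ x' in 𝓝 x, ∀ Y Z, f x' Y Z = f x' Z Y) (X : F) (Y Z : E) :
    fderiv ℝ f x X Y Z = fderiv ℝ f x X Z Y := by
  rw [fderiv_clm_apply_apply hf, fderiv_clm_apply_apply hf]
  congr 1
  refine Filter.EventuallyEq.fderiv_eq ?_
  filter_upwards [hs] with x' hx' using hx' Y Z

/-- Up to the factor one half this is the second derivative of the fibre differential `k`, so it is
symmetric in its two directions of differentiation. With symmetry of the Hessian itself this gives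
total symmetry of the Cartan tensor. -/
theorem fderiv_fiberHessian_symm (hV : IsOpen V) (hℓ : ContDiffOn ℝ ∞ ℓ V) {q : E × E}
    (hq : q ∈ V) (X Y Z : E) :
    fderiv ℝ (fun y => fiberHessian ℓ (q.1, y)) q.2 X Y Z
      = fderiv ℝ (fun y => fiberHessian ℓ (q.1, y)) q.2 Y X Z := by
  set k : E → E →L[ℝ] ℝ := fderiv ℝ fun y => ℓ (q.1, y)
  have hk : ContDiffAt ℝ ∞ k q.2 :=
    ((hℓ.fiber q.1).contDiffOn_fderiv_of_isOpen (hV.fiber q.1)).contDiffAt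
      ((hV.fiber q.1).mem_nhds hq)
  have e : (fun y => fiberHessian ℓ (q.1, y)) = fun y => (1 / 2 : ℝ) • fderiv ℝ k y := rfl
  have hdk : DifferentiableAt ℝ (fderiv ℝ k) q.2 :=
    (hk.fderiv_right (m := ∞) (by simp)).differentiableAt (by simp)
  rw [e, fderiv_fun_const_smul hdk]
  have := (hk.isSymmSndFDerivAt (by simp; norm_cast)) X Y
  simp only [_root_.smul_apply]
  rw [this]

/-- If `ℓ` is positively two-homogeneous on the fibres, `fiberHessian` is invariant under small
dilations of the fibre variable, so that its derivative in the radial direction vanishes. -/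
theorem fderiv_fiberHessian_self (hV : IsOpen V) (hℓ : ContDiffOn ℝ ∞ ℓ V)
    (hom : ∀ x y, (x, y) ∈ V → ∀ c : ℝ, 0 < c → (x, c • y) ∈ V ∧ ℓ (x, c • y) = c ^ 2 * ℓ (x, y))
    {q : E × E} (hq : q ∈ V) :
    fderiv ℝ (fun y => fiberHessian ℓ (q.1, y)) q.2 q.2 = 0 := by
  set U := {y | (q.1, y) ∈ V} with hU
  have hUo : IsOpen U := hV.fiber q.1
  set k : E → ℝ := fun y => ℓ (q.1, y) with hk
  have hkU : ContDiffOn ℝ ∞ k U := hℓ.fiber q.1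
  -- Differentiating a homogeneity relation lowers the degree by one: from two to one here, and from
  -- one to zero in the next step.
  have h1 : ∀ c : ℝ, 0 < c → ∀ y ∈ U, fderiv ℝ k (c • y) = c • fderiv ℝ k y := fun c hc y hy => by
    have e : (fun y => k (c • y)) =ᶠ[𝓝 y] fun y => c ^ 2 • k y := by
      filter_upwards [hUo.mem_nhds hy] with y' hy' using (hom q.1 y' hy' c hc).2
    have h2 := e.fderiv_eq (𝕜 := ℝ)
    rw [fderiv_fun_const_smul ((hkU.differentiableOn (by simp)).differentiableAt
      (hUo.mem_nhds hy)), fderiv_comp_smul] at h2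
    have h3 := congrArg (fun T => c⁻¹ • T) h2
    simp only [smul_smul] at h3
    rw [inv_mul_cancel₀ hc.ne', one_smul] at h3
    rw [h3]
    congr 1
    field_simp
  have hdU : ContDiffOn ℝ ∞ (fderiv ℝ k) U := hkU.contDiffOn_fderiv_of_isOpen hUo
  have h2 : ∀ c : ℝ, 0 < c → fiberHessian ℓ (q.1, c • q.2) = fiberHessian ℓ (q.1, q.2) :=
    fun c hc => by
    have e : (fun y => fderiv ℝ k (c • y)) =ᶠ[𝓝 q.2] fun y => c • fderiv ℝ k y := by
      filter_upwards [hUo.mem_nhds hq] with y' hy' using h1 c hc y' hy'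
    have h2 := e.fderiv_eq (𝕜 := ℝ)
    rw [fderiv_fun_const_smul ((hdU.differentiableOn (by simp)).differentiableAt
      (hUo.mem_nhds hq)), fderiv_comp_smul] at h2
    have h3 := congrArg (fun T => c⁻¹ • T) h2
    simp only [smul_smul] at h3
    rw [inv_mul_cancel₀ hc.ne', one_smul, one_smul] at h3
    change (1 / 2 : ℝ) • fderiv ℝ (fderiv ℝ k) (c • q.2) = (1 / 2 : ℝ) • fderiv ℝ (fderiv ℝ k) q.2
    rw [h3]
  have hG : DifferentiableAt ℝ (fun y => fiberHessian ℓ (q.1, y)) q.2 := by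
    have := contDiffOn_fiberHessian hV hℓ
    exact (((this.comp (contDiff_const.prodMk contDiff_id).contDiffOn fun _ hy => hy :
      ContDiffOn ℝ ∞ (fun y => fiberHessian ℓ (q.1, y)) U)).differentiableOn
        (by simp)).differentiableAt (hUo.mem_nhds hq)
  have hs : HasDerivAt (fun c : ℝ => c • q.2) q.2 1 := by
    simpa using (hasDerivAt_id (1 : ℝ)).smul_const q.2
  have hG' : HasFDerivAt (fun y => fiberHessian ℓ (q.1, y))
      (fderiv ℝ (fun y => fiberHessian ℓ (q.1, y)) q.2) ((1 : ℝ) • q.2) := by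
    rw [one_smul]; exact hG.hasFDerivAt
  have h3 := hG'.comp_hasDerivAt (1 : ℝ) hs
  have h4 : ((fun y => fiberHessian ℓ (q.1, y)) ∘ fun c : ℝ => c • q.2)
      =ᶠ[𝓝 1] fun _ => fiberHessian ℓ (q.1, q.2) := by
    filter_upwards [lt_mem_nhds (zero_lt_one' ℝ)] with c hc using h2 c hc
  exact (h3.congr_of_eventuallyEq h4.symm).unique (hasDerivAt_const _ _)

/-- Transformation of `fiberHessian` under `(x, y) ↦ (ψ x, Dψ(x) y)`. -/
theorem fiberHessian_comp {ℓ₁ : E × E → ℝ} (hV : IsOpen V) (hℓ : ContDiffOn ℝ ∞ ℓ₁ V)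
    {x x' : E} {A : E →L[ℝ] E} (h : ∀ y, ℓ (x, y) = ℓ₁ (x', A y)) {y : E} (hy : (x', A y) ∈ V)
    (Y Z : E) : fiberHessian ℓ (x, y) Y Z = fiberHessian ℓ₁ (x', A y) (A Y) (A Z) := by
  set k : E → ℝ := fun y => ℓ₁ (x', y) with hk
  set U := {y | (x', y) ∈ V} with hU
  have hUo : IsOpen U := hV.fiber x'
  have hkU : ContDiffOn ℝ ∞ k U := hℓ.fiber x'
  have hdU : ContDiffOn ℝ ∞ (fderiv ℝ k) U := hkU.contDiffOn_fderiv_of_isOpen hUo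
  have e0 : (fun y => ℓ (x, y)) = fun y => k (A y) := funext h
  -- On the fibre the coordinate change is linear, so the chain rule produces no second derivative
  -- of it.
  have e1 : (fun y => fderiv ℝ (fun y => k (A y)) y) =ᶠ[𝓝 y]
      fun y => (fderiv ℝ k (A y)).comp A := by
    filter_upwards [(hUo.preimage A.continuous).mem_nhds hy] with y' hy'
    exact (((hkU.differentiableOn (by simp)).differentiableAt
      (hUo.mem_nhds hy')).hasFDerivAt.comp y' A.hasFDerivAt).fderiv
  have hd : HasFDerivAt (fun y => fderiv ℝ k (A y)) ((fderiv ℝ (fderiv ℝ k) (A y)).comp A) y :=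
    ((hdU.differentiableOn (by simp)).differentiableAt
      (hUo.mem_nhds hy)).hasFDerivAt.comp y A.hasFDerivAt
  have h2 := (hd.clm_comp (hasFDerivAt_const A y)).fderiv
  rw [← e1.fderiv_eq, ← e0] at h2
  simp only [fiberHessian, _root_.smul_apply]
  rw [h2]
  simp [hk]

end FiberCalculus

/-! ### Smooth dependence of the Koszul-type formula on its data. -/

section SymbolBilinear

namespace ChernAlgebra

variable {E : Type*} [NormedAddCommGroup E] [NormedSpace ℝ E]

open ContinuousLinearMap in
/-- `ChernAlgebra.symbol` as a continuous bilinear map. -/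
noncomputable def symbolL (g : E →L[ℝ] E →L[ℝ] ℝ) (dg C : E →L[ℝ] E →L[ℝ] E →L[ℝ] ℝ) (y : E) :
    E →L[ℝ] E →L[ℝ] E :=
  (1 / 2 : ℝ) • (compL ℝ E (E →L[ℝ] ℝ) E g.inverse).comp
    (dg + dg.flip - ((flipₗᵢ ℝ E E ℝ).toContinuousLinearEquiv : _ →L[ℝ] _).comp dg.flip
      - (2 : ℝ) • C.comp (nonlinear g dg C y) - (2 : ℝ) • (C.comp (nonlinear g dg C y)).flip
      + (2 : ℝ) • (compL ℝ E (E →L[ℝ] ℝ) (E →L[ℝ] ℝ)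
        ((compL ℝ E E ℝ).flip (nonlinear g dg C y))).comp C)

theorem symbolL_apply (g : E →L[ℝ] E →L[ℝ] ℝ) (dg C : E →L[ℝ] E →L[ℝ] E →L[ℝ] ℝ) (y X Y : E) :
    symbolL g dg C y X Y = symbol g dg C y X Y := by
  simp [symbolL, symbol]

variable {F : Type*} [NormedAddCommGroup F] [NormedSpace ℝ F] [CompleteSpace E]

/-- Inversion of operators is smooth at invertible ones; all else in the formula is composition,
evaluation and flipping. -/
theorem contDiffOn_symbolL {g : F → E →L[ℝ] E →L[ℝ] ℝ}
    {dg C : F → E →L[ℝ] E →L[ℝ] E →L[ℝ] ℝ} {y : F → E} {V : Set F}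
    (hg : ContDiffOn ℝ ∞ g V) (hdg : ContDiffOn ℝ ∞ dg V) (hC : ContDiffOn ℝ ∞ C V)
    (hy : ContDiffOn ℝ ∞ y V) (hi : ∀ q ∈ V, (g q).IsInvertible) :
    ContDiffOn ℝ ∞ (fun q => symbolL (g q) (dg q) (C q) (y q)) V := by
  have hinv : ContDiffOn ℝ ∞ (fun q => (g q).inverse) V := fun q hq => by
    obtain ⟨e, he⟩ := hi q hq
    have h := contDiffAt_map_inverse (𝕜 := ℝ) (n := ∞) e
    rw [he] at h
    exact h.comp_contDiffWithinAt q (hg q hq)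
  have hflip : ∀ {T : F → E →L[ℝ] E →L[ℝ] E →L[ℝ] ℝ}, ContDiffOn ℝ ∞ T V →
      ContDiffOn ℝ ∞ (fun q => (T q).flip) V := fun hT =>
    (ContinuousLinearMap.flipₗᵢ ℝ E E (E →L[ℝ] ℝ)).contDiff.comp_contDiffOn hT
  have hflip' : ∀ {T : F → E →L[ℝ] E →L[ℝ] ℝ}, ContDiffOn ℝ ∞ T V →
      ContDiffOn ℝ ∞ (fun q => (T q).flip) V := fun hT =>
    (ContinuousLinearMap.flipₗᵢ ℝ E E ℝ).contDiff.comp_contDiffOn hT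
  have hS : ContDiffOn ℝ ∞ (fun q => spray (g q) (dg q) (y q)) V :=
    hinv.clm_apply (((hdg.clm_apply hy).clm_apply hy).sub
      ((hflip' ((hflip hdg).clm_apply hy)).clm_apply hy |>.const_smul (1 / 2 : ℝ)))
  have hN : ContDiffOn ℝ ∞ (fun q => nonlinear (g q) (dg q) (C q) (y q)) V :=
    ContDiffOn.const_smul (1 / 2 : ℝ) (hinv.clm_comp
      ((((hflip hdg).clm_apply hy).add (hdg.clm_apply hy)).sub
        (hflip' ((hflip hdg).clm_apply hy)) |>.sub ((hC.clm_apply hS).const_smul (2 : ℝ))))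
  have hCN := hC.clm_comp hN
  refine ContDiffOn.const_smul (1 / 2 : ℝ) (ContDiffOn.clm_comp
    ((ContinuousLinearMap.compL ℝ E (E →L[ℝ] ℝ) E).contDiff.comp_contDiffOn hinv) ?_)
  refine ((((hdg.add (hflip hdg)).sub (contDiffOn_const.clm_comp (hflip hdg))).sub
    (hCN.const_smul (2 : ℝ))).sub ((hflip hCN).const_smul (2 : ℝ))).add
    (ContDiffOn.const_smul (2 : ℝ) (ContDiffOn.clm_comp ?_ hC))
  exact (ContinuousLinearMap.compL ℝ E (E →L[ℝ] ℝ) (E →L[ℝ] ℝ)).contDiff.comp_contDiffOn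
    ((ContinuousLinearMap.compL ℝ E E ℝ).flip.contDiff.comp_contDiffOn hN)

end ChernAlgebra

end SymbolBilinear

/-! ### The fundamental tensor, the Cartan tensor and the Christoffel symbols in a chart. -/

section ChristoffelSymbols

/-- The second derivative of a smooth function as an iterated derivative along lines. -/
theorem deriv_deriv_line {E : Type*} [NormedAddCommGroup E] [NormedSpace ℝ E] {k : E → ℝ}
    {D : Set E} (hDo : IsOpen D) (hkD : ContDiffOn ℝ ∞ k D) {y : E} (hy : y ∈ D) (U W : E) :
    deriv (fun t : ℝ => deriv (fun s : ℝ => k (y + t • U + s • W)) 0) 0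
      = fderiv ℝ (fderiv ℝ k) y U W := by
  have hdD : ContDiffOn ℝ ∞ (fderiv ℝ k) D := hkD.contDiffOn_fderiv_of_isOpen hDo
  have e1 : (fun t : ℝ => deriv (fun s : ℝ => k (y + t • U + s • W)) 0)
      =ᶠ[𝓝 0] fun t => fderiv ℝ k (y + t • U) W := by
    have hc : Continuous fun t : ℝ => y + t • U := by fun_prop
    have h0 : y + (0 : ℝ) • U = y := by simp
    have hmem : ∀ᶠ t : ℝ in 𝓝 0, y + t • U ∈ D :=
      hc.continuousAt (hDo.mem_nhds (by simpa only [h0] using hy))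
    filter_upwards [hmem] with t ht
    have hkd := ((hkD.differentiableOn (by simp)).differentiableAt (hDo.mem_nhds ht)).hasFDerivAt
    exact (hkd.hasLineDerivAt W).deriv
  rw [e1.deriv_eq]
  have hd := ((hdD.differentiableOn (by simp)).differentiableAt (hDo.mem_nhds hy)).hasFDerivAt
  exact ((hd.clm_apply (hasFDerivAt_const W y)).hasLineDerivAt U).deriv.trans (by simp)

namespace PseudoFinslerMetric

variable {E : Type*} [NormedAddCommGroup E] [NormedSpace ℝ E]
  {M : Type*} [TopologicalSpace M] [ChartedSpace E M] [IsManifold 𝓘(ℝ, E) ∞ M]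
  (L : PseudoFinslerMetric E M)

/-- The domain of `L` in the chart at `x₀`. -/
def coordDomain (x₀ : M) : Set (E × E) :=
  {q | q.1 ∈ (extChartAt 𝓘(ℝ, E) x₀).target ∧ tangentCoordSymm x₀ q ∈ L.domain}

theorem isOpen_coordDomain (x₀ : M) : IsOpen (L.coordDomain x₀) := by
  have h := (contMDiffOn_tangentCoordSymm (E := E) x₀).continuousOn.isOpen_inter_preimage
    ((isOpen_extChartAt_target x₀).prod isOpen_univ) L.isOpen_domain
  convert h using 1
  ext q
  simp [coordDomain]

theorem tangentCoord_mem_coordDomain {x₀ : M} {z : TangentBundle 𝓘(ℝ, E) M}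
    (h : z.1 ∈ (chartAt E x₀).source) (hz : z ∈ L.domain) :
    tangentCoord x₀ z ∈ L.coordDomain x₀ := by
  refine ⟨?_, by rwa [tangentCoordSymm_tangentCoord h]⟩
  rw [tangentCoord_fst]
  exact (extChartAt 𝓘(ℝ, E) x₀).map_source (by rwa [extChartAt_source])

theorem coord_tangentCoord {x₀ : M} {z : TangentBundle 𝓘(ℝ, E) M}
    (h : z.1 ∈ (chartAt E x₀).source) : L.coord x₀ (tangentCoord x₀ z) = L.toFun z := by
  rw [coord, tangentCoordSymm_tangentCoord h]

theorem contDiffOn_coord (x₀ : M) : ContDiffOn ℝ ∞ (L.coord x₀) (L.coordDomain x₀) := by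
  rw [← contMDiffOn_iff_contDiffOn]
  exact L.contMDiffOn.comp ((contMDiffOn_tangentCoordSymm (E := E) x₀).mono
    fun q hq => ⟨hq.1, mem_univ _⟩) fun q hq => hq.2

theorem contDiffOn_coordG (x₀ : M) : ContDiffOn ℝ ∞ (L.coordG x₀) (L.coordDomain x₀) :=
  contDiffOn_fiberHessian (L.isOpen_coordDomain x₀) (L.contDiffOn_coord x₀)

theorem differentiableAt_coordG {x₀ : M} {q : E × E} (hq : q ∈ L.coordDomain x₀) :
    DifferentiableAt ℝ (L.coordG x₀) q :=
  ((L.contDiffOn_coordG x₀).differentiableOn (by simp)).differentiableAt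
    ((L.isOpen_coordDomain x₀).mem_nhds hq)

theorem coordDG_eq {x₀ : M} {q : E × E} (hq : q ∈ L.coordDomain x₀) :
    L.coordDG x₀ q = (fderiv ℝ (L.coordG x₀) q).comp (ContinuousLinearMap.inl ℝ E E) :=
  fderiv_prodMk_left (L.differentiableAt_coordG hq)

theorem coordC_eq {x₀ : M} {q : E × E} (hq : q ∈ L.coordDomain x₀) :
    L.coordC x₀ q =
      (1 / 2 : ℝ) • (fderiv ℝ (L.coordG x₀) q).comp (ContinuousLinearMap.inr ℝ E E) := by
  have h := L.differentiableAt_coordG hq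
  rw [← fderiv_prodMk_right h, coordC, fderiv_fun_const_smul]
  exact h.comp (x := q.2) (f := fun y => (q.1, y)) (hasFDerivAt_prodMk_right q.1 q.2).differentiableAt

theorem contDiffOn_coordDG (x₀ : M) : ContDiffOn ℝ ∞ (L.coordDG x₀) (L.coordDomain x₀) :=
  (((L.contDiffOn_coordG x₀).contDiffOn_fderiv_of_isOpen (L.isOpen_coordDomain x₀)).clm_comp
    contDiffOn_const).congr fun _ hq => L.coordDG_eq hq

theorem contDiffOn_coordC (x₀ : M) : ContDiffOn ℝ ∞ (L.coordC x₀) (L.coordDomain x₀) :=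
  ((((L.contDiffOn_coordG x₀).contDiffOn_fderiv_of_isOpen (L.isOpen_coordDomain x₀)).clm_comp
    contDiffOn_const).const_smul (1 / 2 : ℝ)).congr fun _ hq => L.coordC_eq hq

theorem coordG_symm {x₀ : M} {q : E × E} (hq : q ∈ L.coordDomain x₀) (X Y : E) :
    L.coordG x₀ q X Y = L.coordG x₀ q Y X :=
  fiberHessian_symm (L.isOpen_coordDomain x₀) (L.contDiffOn_coord x₀) hq X Y

theorem fderiv_coordG_symm {x₀ : M} {q : E × E} (hq : q ∈ L.coordDomain x₀) (U : E × E)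
    (Y Z : E) : fderiv ℝ (L.coordG x₀) q U Y Z = fderiv ℝ (L.coordG x₀) q U Z Y :=
  fderiv_clm_symm (L.differentiableAt_coordG hq)
    (by filter_upwards [(L.isOpen_coordDomain x₀).mem_nhds hq] with q' hq' using
      L.coordG_symm hq') U Y Z

theorem coordDG_symm {x₀ : M} {q : E × E} (hq : q ∈ L.coordDomain x₀) (X Y Z : E) :
    L.coordDG x₀ q X Y Z = L.coordDG x₀ q X Z Y := by
  rw [L.coordDG_eq hq]
  exact L.fderiv_coordG_symm hq _ Y Z

theorem coordC_apply {x₀ : M} {q : E × E} (hq : q ∈ L.coordDomain x₀) (X Y Z : E) :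
    L.coordC x₀ q X Y Z = (1 / 2 : ℝ) * fderiv ℝ (L.coordG x₀) q (0, X) Y Z := by
  rw [L.coordC_eq hq]
  rfl

theorem coordC_apply' {x₀ : M} {q : E × E} (hq : q ∈ L.coordDomain x₀) (X Y Z : E) :
    L.coordC x₀ q X Y Z =
      (1 / 2 : ℝ) * fderiv ℝ (fun y => fiberHessian (L.coord x₀) (q.1, y)) q.2 X Y Z := by
  rw [L.coordC_apply hq]
  congr 1
  exact (congrArg (fun T : E →L[ℝ] E →L[ℝ] E →L[ℝ] ℝ => T X Y Z)
    (fderiv_prodMk_right (L.differentiableAt_coordG hq))).symm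

theorem coordC_symm {x₀ : M} {q : E × E} (hq : q ∈ L.coordDomain x₀) (X Y Z : E) :
    L.coordC x₀ q X Y Z = L.coordC x₀ q Y X Z := by
  rw [L.coordC_apply' hq, L.coordC_apply' hq,
    fderiv_fiberHessian_symm (L.isOpen_coordDomain x₀) (L.contDiffOn_coord x₀) hq]

theorem coordC_symm' {x₀ : M} {q : E × E} (hq : q ∈ L.coordDomain x₀) (X Y Z : E) :
    L.coordC x₀ q X Y Z = L.coordC x₀ q X Z Y := by
  rw [L.coordC_apply hq, L.coordC_apply hq, L.fderiv_coordG_symm hq]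

theorem tangentCoordSymm_smul {x₀ : M} {x : E} (hx : x ∈ (extChartAt 𝓘(ℝ, E) x₀).target)
    (y : E) (c : ℝ) : (tangentCoordSymm x₀ (x, c • y) : TangentBundle 𝓘(ℝ, E) M)
      = ⟨(tangentCoordSymm x₀ (x, y)).1, c • (tangentCoordSymm x₀ (x, y)).2⟩ := by
  refine tangentCoord_injOn (tangentCoordSymm_mem hx) (tangentCoordSymm_mem (q := (x, y)) hx) ?_
  rw [tangentCoord_tangentCoordSymm hx]
  have h := tangentCoord_tangentCoordSymm (q := (x, y)) hx
  refine Prod.ext (congrArg Prod.fst h).symm ?_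
  rw [tangentCoord_snd_smul]
  exact congrArg (c • ·) (congrArg Prod.snd h).symm

theorem coord_homogeneous {x₀ : M} (x y : E) (h : (x, y) ∈ L.coordDomain x₀) (c : ℝ)
    (hc : 0 < c) :
    (x, c • y) ∈ L.coordDomain x₀ ∧ L.coord x₀ (x, c • y) = c ^ 2 * L.coord x₀ (x, y) := by
  have e := tangentCoordSymm_smul (M := M) h.1 y c
  refine ⟨⟨h.1, ?_⟩, ?_⟩
  · rw [e]; exact L.smul_mem _ _ c h.2 hc
  · rw [coord, coord, e]; exact L.homogeneous _ _ c h.2 hc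

/-- By two-homogeneity of `L`, the fundamental tensor is constant along rays. This is the hypothesis
`Cy` that decouples the Koszul formula in `ChernAlgebra.eq_symbol_iff`. -/
theorem coordC_self {x₀ : M} {q : E × E} (hq : q ∈ L.coordDomain x₀) (Y Z : E) :
    L.coordC x₀ q q.2 Y Z = 0 := by
  rw [L.coordC_apply' hq, fderiv_fiberHessian_self (L.isOpen_coordDomain x₀)
    (L.contDiffOn_coord x₀) L.coord_homogeneous hq]
  simp

/-- The fundamental tensor in coordinates. -/
theorem fundamentalTensor_eq_coordG {x₀ x : M} (hx : x ∈ (chartAt E x₀).source)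
    (v u w : TangentSpace 𝓘(ℝ, E) x) (hv : (⟨x, v⟩ : TangentBundle 𝓘(ℝ, E) M) ∈ L.domain) :
    fundamentalTensor L.toFun x v u w = L.coordG x₀ (tangentCoord x₀ ⟨x, v⟩)
      (tangentCoord x₀ (⟨x, u⟩ : TangentBundle 𝓘(ℝ, E) M)).2
      (tangentCoord x₀ (⟨x, w⟩ : TangentBundle 𝓘(ℝ, E) M)).2 := by
  have hq := L.tangentCoord_mem_coordDomain (z := ⟨x, v⟩) hx hv
  have e0 : ∀ t s : ℝ, L.toFun ⟨x, v + t • u + s • w⟩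
      = L.coord x₀ ((tangentCoord x₀ (⟨x, v⟩ : TangentBundle 𝓘(ℝ, E) M)).1,
        (tangentCoord x₀ (⟨x, v⟩ : TangentBundle 𝓘(ℝ, E) M)).2
        + t • (tangentCoord x₀ (⟨x, u⟩ : TangentBundle 𝓘(ℝ, E) M)).2
        + s • (tangentCoord x₀ (⟨x, w⟩ : TangentBundle 𝓘(ℝ, E) M)).2) := fun t s => by
    rw [← L.coord_tangentCoord (z := ⟨x, v + t • u + s • w⟩) hx, ← tangentCoord_snd_smul,
      ← tangentCoord_snd_smul, ← tangentCoord_snd_add, ← tangentCoord_snd_add]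
    rfl
  simp only [fundamentalTensor, e0]
  generalize tangentCoord x₀ (⟨x, v⟩ : TangentBundle 𝓘(ℝ, E) M) = q at hq ⊢
  rw [deriv_deriv_line ((L.isOpen_coordDomain x₀).fiber q.1) ((L.contDiffOn_coord x₀).fiber q.1) hq]
  rfl

variable [FiniteDimensional ℝ E]

/-- `E` and its dual have the same finite dimension, so injectivity suffices; continuity of the
inverse is automatic. -/
theorem isInvertible_of_injective {g : E →L[ℝ] E →L[ℝ] ℝ} (h : ∀ u, (∀ w, g u w = 0) → u = 0) :
    g.IsInvertible := by
  have hinj : Function.Injective g.toLinearMap :=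
    (injective_iff_map_eq_zero g.toLinearMap).2 fun u hu => h u fun w => by
      rw [show g u = 0 from hu]; rfl
  have hfin : Module.finrank ℝ E = Module.finrank ℝ (E →L[ℝ] ℝ) := by
    rw [← (LinearMap.toContinuousLinearMap (𝕜 := ℝ) (E := E) (F' := ℝ)).finrank_eq]
    exact Subspace.dual_finrank_eq.symm
  exact ⟨(LinearEquiv.ofInjectiveOfFinrankEq g.toLinearMap hinj hfin).toContinuousLinearEquiv,
    by ext; rfl⟩

theorem isInvertible_coordG {x₀ : M} {q : E × E} (hq : q ∈ L.coordDomain x₀) :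
    (L.coordG x₀ q).IsInvertible := by
  refine isInvertible_of_injective fun U hU => ?_
  have hc : ∀ W : E, (tangentCoord x₀ (⟨(tangentCoordSymm x₀ q).1,
      (tangentCoordSymm x₀ (q.1, W)).2⟩ : TangentBundle 𝓘(ℝ, E) M)).2 = W := fun W =>
    congrArg Prod.snd (tangentCoord_tangentCoordSymm (M := M) (x₀ := x₀) (q := (q.1, W)) hq.1)
  set u : TangentSpace 𝓘(ℝ, E) (tangentCoordSymm x₀ q).1 := (tangentCoordSymm x₀ (q.1, U)).2
  have hu : u = 0 := by
    refine L.nondegenerate _ (tangentCoordSymm x₀ q).2 hq.2 u fun w => ?_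
    have e : tangentCoord x₀ (⟨(tangentCoordSymm x₀ q).1, (tangentCoordSymm x₀ q).2⟩ :
        TangentBundle 𝓘(ℝ, E) M) = q := tangentCoord_tangentCoordSymm hq.1
    have h := L.fundamentalTensor_eq_coordG (x₀ := x₀) (x := (tangentCoordSymm x₀ q).1)
      (tangentCoordSymm_mem hq.1) (tangentCoordSymm x₀ q).2 u w hq.2
    rw [e, hc U, hU] at h
    exact h
  rw [← hc U]
  change (tangentCoord x₀ (⟨(tangentCoordSymm x₀ q).1, u⟩ : TangentBundle 𝓘(ℝ, E) M)).2 = 0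
  rw [hu, tangentCoord_snd_zero]

/-- The Christoffel symbols are characterised by torsion-freeness and almost compatibility. -/
theorem eq_christoffel_iff {x₀ : M} {q : E × E} (hq : q ∈ L.coordDomain x₀) (Γ : E → E → E) :
    ((∀ X Y, Γ X Y = Γ Y X) ∧ ∀ X Y Z, L.coordDG x₀ q X Y Z =
      L.coordG x₀ q (Γ X Y) Z + L.coordG x₀ q Y (Γ X Z) + 2 * L.coordC x₀ q (Γ X q.2) Y Z) ↔
    ∀ X Y, Γ X Y = L.christoffel x₀ q X Y :=
  ChernAlgebra.eq_symbol_iff _ _ _ _ (L.isInvertible_coordG hq) (L.coordG_symm hq)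
    (L.coordDG_symm hq) (L.coordC_symm hq) (L.coordC_symm' hq) (L.coordC_self hq) Γ

theorem christoffel_symm {x₀ : M} {q : E × E} (hq : q ∈ L.coordDomain x₀) (X Y : E) :
    L.christoffel x₀ q X Y = L.christoffel x₀ q Y X :=
  ((L.eq_christoffel_iff hq _).2 fun _ _ => rfl).1 X Y

/-- The Christoffel symbols as a continuous bilinear map. -/
noncomputable def christoffelL (x₀ : M) (q : E × E) : E →L[ℝ] E →L[ℝ] E :=
  ChernAlgebra.symbolL (L.coordG x₀ q) (L.coordDG x₀ q) (L.coordC x₀ q) q.2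

theorem christoffelL_apply (x₀ : M) (q : E × E) (X Y : E) :
    L.christoffelL x₀ q X Y = L.christoffel x₀ q X Y :=
  ChernAlgebra.symbolL_apply _ _ _ _ _ _

theorem contDiffOn_christoffelL (x₀ : M) :
    ContDiffOn ℝ ∞ (L.christoffelL x₀) (L.coordDomain x₀) :=
  have := FiniteDimensional.complete ℝ E
  ChernAlgebra.contDiffOn_symbolL (L.contDiffOn_coordG x₀) (L.contDiffOn_coordDG x₀)
    (L.contDiffOn_coordC x₀) contDiffOn_snd fun _ hq => L.isInvertible_coordG hq

/-- Transformation law of the Christoffel symbols. -/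
theorem christoffel_transition {x₀ x₁ : M} {q : E × E} (hq : q ∈ L.coordDomain x₀)
    (hx : q.1 ∈ chartOverlap E x₀ x₁) (X Y : E) :
    fderiv ℝ (chartTransition E x₀ x₁) q.1 (L.christoffel x₀ q X Y) =
      L.christoffel x₁ (chartTransition E x₀ x₁ q.1,
          fderiv ℝ (chartTransition E x₀ x₁) q.1 q.2)
        (fderiv ℝ (chartTransition E x₀ x₁) q.1 X) (fderiv ℝ (chartTransition E x₀ x₁) q.1 Y)
      + fderiv ℝ (fderiv ℝ (chartTransition E x₀ x₁)) q.1 X Y := by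
  set ψ := chartTransition E x₀ x₁ with hψ
  set O := chartOverlap E x₀ x₁ with hO
  have hOo : IsOpen O := isOpen_chartOverlap x₀ x₁
  have hψO : ContDiffOn ℝ ∞ ψ O := contDiffOn_chartTransition x₀ x₁
  have hdψO : ContDiffOn ℝ ∞ (fderiv ℝ ψ) O := hψO.contDiffOn_fderiv_of_isOpen hOo
  have hψd : HasFDerivAt ψ (fderiv ℝ ψ q.1) q.1 :=
    ((hψO.differentiableOn (by simp)).differentiableAt (hOo.mem_nhds hx)).hasFDerivAt
  have hdψd : HasFDerivAt (fderiv ℝ ψ) (fderiv ℝ (fderiv ℝ ψ) q.1) q.1 :=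
    ((hdψO.differentiableOn (by simp)).differentiableAt (hOo.mem_nhds hx)).hasFDerivAt
  -- The change of tangent coordinates. Its second component depends on the base point through
  -- `fderiv ℝ ψ`, which is how `B` enters below.
  set τ : E × E → E × E := fun q => (ψ q.1, fderiv ℝ ψ q.1 q.2) with hτ
  set A := fderiv ℝ ψ q.1 with hA
  set B := fderiv ℝ (fderiv ℝ ψ) q.1 with hB
  have hBs : ∀ X Y, B X Y = B Y X := fun X Y =>
    ((hψO.contDiffAt (hOo.mem_nhds hx)).isSymmSndFDerivAt (by simp; norm_cast)) X Y
  have hmem : ∀ q' ∈ L.coordDomain x₀, q'.1 ∈ O → τ q' ∈ L.coordDomain x₁ := fun q' hq' hx' => by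
    have e := tangentCoordSymm_transition (x₁ := x₁) hx'
    refine ⟨?_, by rw [hτ, ← e]; exact hq'.2⟩
    exact (extChartAt 𝓘(ℝ, E) x₁).map_source (by rw [extChartAt_source]; exact hx'.2)
  have hτq : τ q ∈ L.coordDomain x₁ := hmem q hq hx
  have hG : ∀ q' ∈ L.coordDomain x₀, q'.1 ∈ O → ∀ Y Z, L.coordG x₀ q' Y Z =
      L.coordG x₁ (τ q') (fderiv ℝ ψ q'.1 Y) (fderiv ℝ ψ q'.1 Z) := fun q' hq' hx' Y Z =>
    fiberHessian_comp (L.isOpen_coordDomain x₁) (L.contDiffOn_coord x₁)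
      (fun y => congrArg L.toFun (tangentCoordSymm_transition (q := (q'.1, y)) hx'))
      (hmem q' hq' hx') Y Z
  have hτd : HasFDerivAt τ ((A.comp (ContinuousLinearMap.fst ℝ E E)).prod
      (A.comp (ContinuousLinearMap.snd ℝ E E) +
        (B.comp (ContinuousLinearMap.fst ℝ E E)).flip q.2)) q := by
    have h1 : HasFDerivAt (fun q : E × E => ψ q.1) _ q := hψd.comp q hasFDerivAt_fst
    have h2 : HasFDerivAt (fun q : E × E => fderiv ℝ ψ q.1) _ q := hdψd.comp q hasFDerivAt_fst
    exact h1.prodMk (h2.clm_apply hasFDerivAt_snd)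
  have hGd : ∀ U Y Z, fderiv ℝ (L.coordG x₀) q U Y Z
      = fderiv ℝ (L.coordG x₁) (τ q) (A U.1, A U.2 + B U.1 q.2) (A Y) (A Z)
        + L.coordG x₁ (τ q) (B U.1 Y) (A Z) + L.coordG x₁ (τ q) (A Y) (B U.1 Z) :=
    fun U Y Z => by
    have e : (fun q' => L.coordG x₀ q' Y Z) =ᶠ[𝓝 q] fun q' =>
        L.coordG x₁ (τ q') (fderiv ℝ ψ q'.1 Y) (fderiv ℝ ψ q'.1 Z) := by
      filter_upwards [(L.isOpen_coordDomain x₀).mem_nhds hq,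
        continuousAt_fst.preimage_mem_nhds (hOo.mem_nhds hx)] with q' h1 h2 using hG q' h1 h2 Y Z
    have h1 : HasFDerivAt (fun q' => L.coordG x₁ (τ q')) _ q :=
      (L.differentiableAt_coordG hτq).hasFDerivAt.comp q hτd
    have h2 : HasFDerivAt (fun q : E × E => fderiv ℝ ψ q.1) _ q := hdψd.comp q hasFDerivAt_fst
    rw [fderiv_clm_apply_apply (L.differentiableAt_coordG hq), e.fderiv_eq,
      ((h1.clm_apply (h2.clm_apply (hasFDerivAt_const Y q))).clm_apply
        (h2.clm_apply (hasFDerivAt_const Z q))).fderiv]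
    simp
    ring
  -- Holding `y` fixed in the chart at `x₀` moves the fibre coordinate at `x₁` by `B X y`. This
  -- vertical motion contributes the Cartan term, with factor two since `coordC` is half a
  -- derivative of `coordG`.
  have hDG : ∀ X Y Z, L.coordDG x₀ q X Y Z = L.coordDG x₁ (τ q) (A X) (A Y) (A Z)
      + 2 * L.coordC x₁ (τ q) (B X q.2) (A Y) (A Z)
      + L.coordG x₁ (τ q) (B X Y) (A Z) + L.coordG x₁ (τ q) (A Y) (B X Z) := fun X Y Z => by
    rw [L.coordDG_eq hq, L.coordDG_eq hτq, L.coordC_apply hτq]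
    have h := hGd (X, 0) Y Z
    have e : ((A X, A 0 + B X q.2) : E × E) = (A X, 0) + (0, B X q.2) := by simp
    simp only [e, map_add, add_apply] at h
    simp only [ContinuousLinearMap.comp_apply, ContinuousLinearMap.inl_apply]
    rw [h]; ring
  have hC : ∀ X Y Z, L.coordC x₀ q X Y Z = L.coordC x₁ (τ q) (A X) (A Y) (A Z) := fun X Y Z => by
    rw [L.coordC_apply hq, L.coordC_apply hτq, hGd]
    simp
  have hsurj : Function.Surjective A := (isInvertible_fderiv_chartTransition hx).2
  -- The symbols at `x₁`, pulled back with the inhomogeneous term `B`. They satisfy the two defining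
  -- conditions at `x₀`: `B` is symmetric, and its contributions to compatibility match those in
  -- `hDG`. Uniqueness then identifies them with the symbols at `x₀`.
  obtain ⟨Γ, hΓ⟩ : ∃ Γ : E → E → E, ∀ X Y,
      A (Γ X Y) = L.christoffel x₁ (τ q) (A X) (A Y) + B X Y :=
    ⟨fun X Y => Function.surjInv hsurj (L.christoffel x₁ (τ q) (A X) (A Y) + B X Y),
      fun X Y => Function.surjInv_eq hsurj _⟩
  obtain ⟨sym, comp⟩ := (L.eq_christoffel_iff hτq _).2 fun _ _ => rfl
  have key := (L.eq_christoffel_iff hq Γ).1 ⟨fun X Y =>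
    (isInvertible_fderiv_chartTransition hx).1 (by
      change A _ = A _
      rw [hΓ, hΓ, hBs, sym]), fun X Y Z => by
    have hq2 : (τ q).2 = A q.2 := rfl
    rw [hDG, hG q hq hx, hG q hq hx, hC]
    change _ = L.coordG x₁ (τ q) (A (Γ X Y)) (A Z) + L.coordG x₁ (τ q) (A Y) (A (Γ X Z)) + _
    rw [hΓ, hΓ, hΓ, comp (A X) (A Y) (A Z), hq2]
    simp only [map_add, add_apply]
    ring⟩
  rw [← key, hΓ]

end PseudoFinslerMetric

end ChristoffelSymbols

/-! ### Smoothness and derivatives of maps into M and TM, read in charts. -/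

section MapsIntoTangentBundle

variable {E : Type*} [NormedAddCommGroup E] [NormedSpace ℝ E]
  {M : Type*} [TopologicalSpace M] [ChartedSpace E M] [IsManifold 𝓘(ℝ, E) ∞ M]
  {F : Type*} [NormedAddCommGroup F] [NormedSpace ℝ F]

theorem ContMDiffWithinAt.contDiffWithinAt_extChartAt {h : F → M} {s : Set F} {z : F}
    {n : WithTop ℕ∞} (hn : n ≤ ∞)
    (hz : ContMDiffWithinAt 𝓘(ℝ, F) 𝓘(ℝ, E) n h s z) {x₀ : M}
    (hx : h z ∈ (chartAt E x₀).source) :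
    ContDiffWithinAt ℝ n (fun z => extChartAt 𝓘(ℝ, E) x₀ (h z)) s z := by
  rw [← contMDiffWithinAt_iff_contDiffWithinAt]
  exact (((contMDiffOn_extChartAt (I := 𝓘(ℝ, E)) (n := ∞) (x := x₀)).contMDiffAt
    ((chartAt E x₀).open_source.mem_nhds hx)).of_le hn).comp_contMDiffWithinAt z hz

theorem MDifferentiableWithinAt.differentiableWithinAt_extChartAt {h : F → M} {s : Set F} {z : F}
    (hz : MDifferentiableWithinAt 𝓘(ℝ, F) 𝓘(ℝ, E) h s z) {x₀ : M}
    (hx : h z ∈ (chartAt E x₀).source) :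
    DifferentiableWithinAt ℝ (fun z => extChartAt 𝓘(ℝ, E) x₀ (h z)) s z := by
  rw [← mdifferentiableWithinAt_iff_differentiableWithinAt]
  exact ((contMDiffOn_extChartAt (I := 𝓘(ℝ, E)) (n := ∞) (x := x₀)).contMDiffAt
    ((chartAt E x₀).open_source.mem_nhds hx)).mdifferentiableAt (by simp)
      |>.comp_mdifferentiableWithinAt z hz

theorem ContMDiffWithinAt.contDiffWithinAt_tangentCoord {f : F → TangentBundle 𝓘(ℝ, E) M}
    {s : Set F} {z : F} (hz : ContMDiffWithinAt 𝓘(ℝ, F) 𝓘(ℝ, E).tangent ∞ f s z) {x₀ : M}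
    (hx : (f z).1 ∈ (chartAt E x₀).source) :
    ContDiffWithinAt ℝ ∞ (fun z => tangentCoord x₀ (f z)) s z := by
  rw [← contMDiffWithinAt_iff_contDiffWithinAt]
  exact ((contMDiffOn_tangentCoord (E := E) x₀).contMDiffAt
    ((isOpen_setOf_proj_mem x₀).mem_nhds hx)).comp_contMDiffWithinAt z hz

theorem MDifferentiableAt.differentiableAt_tangentCoord {f : F → TangentBundle 𝓘(ℝ, E) M}
    {z : F} (hz : MDifferentiableAt 𝓘(ℝ, F) 𝓘(ℝ, E).tangent f z) {x₀ : M}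
    (hx : (f z).1 ∈ (chartAt E x₀).source) :
    DifferentiableAt ℝ (fun z => tangentCoord x₀ (f z)) z := by
  rw [← mdifferentiableAt_iff_differentiableAt]
  exact (((contMDiffOn_tangentCoord (E := E) x₀).contMDiffAt
    ((isOpen_setOf_proj_mem x₀).mem_nhds hx)).mdifferentiableAt (by simp)).comp z hz

theorem ContDiffWithinAt.contMDiffWithinAt_tangentCoordSymm {q : F → E × E} {s : Set F} {z : F}
    (hq : ContDiffWithinAt ℝ ∞ q s z) {x₀ : M}
    (hx : (q z).1 ∈ (extChartAt 𝓘(ℝ, E) x₀).target) :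
    ContMDiffWithinAt 𝓘(ℝ, F) 𝓘(ℝ, E).tangent ∞
      (fun z => (tangentCoordSymm x₀ (q z) : TangentBundle 𝓘(ℝ, E) M)) s z :=
  ((contMDiffOn_tangentCoordSymm (E := E) x₀).contMDiffAt
    (((isOpen_extChartAt_target x₀).prod isOpen_univ).mem_nhds ⟨hx, mem_univ _⟩))
      |>.comp_contMDiffWithinAt z (contMDiffWithinAt_iff_contDiffWithinAt.2 hq)

theorem DifferentiableAt.mdifferentiableAt_tangentCoordSymm {q : F → E × E} {z : F}
    (hq : DifferentiableAt ℝ q z) {x₀ : M}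
    (hx : (q z).1 ∈ (extChartAt 𝓘(ℝ, E) x₀).target) :
    MDifferentiableAt 𝓘(ℝ, F) 𝓘(ℝ, E).tangent
      (fun z => (tangentCoordSymm x₀ (q z) : TangentBundle 𝓘(ℝ, E) M)) z :=
  (((contMDiffOn_tangentCoordSymm (E := E) x₀).contMDiffAt
    (((isOpen_extChartAt_target x₀).prod isOpen_univ).mem_nhds ⟨hx, mem_univ _⟩)).mdifferentiableAt
      (by simp)).comp z (mdifferentiableAt_iff_differentiableAt.2 hq)

theorem ContDiffWithinAt.contMDiffWithinAt_extChartAt_symm {q : F → E} {s : Set F} {z : F}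
    (hq : ContDiffWithinAt ℝ ∞ q s z) {x₀ : M}
    (hx : q z ∈ (extChartAt 𝓘(ℝ, E) x₀).target) :
    ContMDiffWithinAt 𝓘(ℝ, F) 𝓘(ℝ, E) ∞ (fun z => (extChartAt 𝓘(ℝ, E) x₀).symm (q z)) s z :=
  ((contMDiffOn_extChartAt_symm (I := 𝓘(ℝ, E)) (n := ∞) x₀).contMDiffAt
    ((isOpen_extChartAt_target x₀).mem_nhds hx)).comp_contMDiffWithinAt z
      (contMDiffWithinAt_iff_contDiffWithinAt.2 hq)

/-- Both sides are the tangent bundle trivialisation at `x₀`; this turns manifold derivatives into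
components. -/
theorem mfderiv_extChartAt_apply {x₀ x : M} (hx : x ∈ (chartAt E x₀).source)
    (v : TangentSpace 𝓘(ℝ, E) x) : mfderiv 𝓘(ℝ, E) 𝓘(ℝ, E) (extChartAt 𝓘(ℝ, E) x₀) x v
      = (tangentCoord x₀ (⟨x, v⟩ : TangentBundle 𝓘(ℝ, E) M)).2 := by
  rw [← TangentBundle.continuousLinearMapAt_trivializationAt hx,
    TangentBundle.continuousLinearMapAt_trivializationAt_eq_core hx]
  rfl

/-- The components of the derivative of a map into `M`. -/
theorem tangentCoord_mfderivWithin {h : F → M} {s : Set F} {z : F}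
    (hz : MDifferentiableWithinAt 𝓘(ℝ, F) 𝓘(ℝ, E) h s z) (hs : UniqueDiffWithinAt ℝ s z)
    {x₀ : M} (hx : h z ∈ (chartAt E x₀).source) (w : F) :
    (tangentCoord x₀ (⟨h z, mfderivWithin 𝓘(ℝ, F) 𝓘(ℝ, E) h s z w⟩ :
      TangentBundle 𝓘(ℝ, E) M)).2
      = fderivWithin ℝ (fun z => extChartAt 𝓘(ℝ, E) x₀ (h z)) s z w := by
  have hφ : MDifferentiableAt 𝓘(ℝ, E) 𝓘(ℝ, E) (extChartAt 𝓘(ℝ, E) x₀) (h z) :=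
    ((contMDiffOn_extChartAt (I := 𝓘(ℝ, E)) (n := ∞) (x := x₀)).contMDiffAt
      ((chartAt E x₀).open_source.mem_nhds hx)).mdifferentiableAt (by simp)
  rw [← mfderiv_extChartAt_apply hx]
  let A : E →L[ℝ] E := mfderiv 𝓘(ℝ, E) 𝓘(ℝ, E) (extChartAt 𝓘(ℝ, E) x₀) (h z)
  let B : F →L[ℝ] E := mfderivWithin 𝓘(ℝ, F) 𝓘(ℝ, E) h s z
  have h2 : HasFDerivWithinAt (fun z => extChartAt 𝓘(ℝ, E) x₀ (h z)) (A.comp B) s z :=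
    hasMFDerivWithinAt_iff_hasFDerivWithinAt.1
      (hφ.hasMFDerivAt.comp_hasMFDerivWithinAt z hz.hasMFDerivWithinAt)
  rw [h2.fderivWithin hs]
  rfl

theorem tangentCoord_velocity {γ : ℝ → M} {s : Set ℝ} {t : ℝ}
    (hγ : MDifferentiableWithinAt 𝓘(ℝ, ℝ) 𝓘(ℝ, E) γ s t) (hs : UniqueDiffWithinAt ℝ s t)
    {x₀ : M} (hx : γ t ∈ (chartAt E x₀).source) :
    (tangentCoord x₀ (⟨γ t, velocity γ s t⟩ : TangentBundle 𝓘(ℝ, E) M)).2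
      = derivWithin (fun τ => extChartAt 𝓘(ℝ, E) x₀ (γ τ)) s t := by
  rw [← fderivWithin_derivWithin]
  exact tangentCoord_mfderivWithin hγ hs hx 1

theorem ContinuousWithinAt.eventually_mem_source {γ : F → M} {s : Set F} {t : F}
    (h : ContinuousWithinAt γ s t) {x₀ : M} (hx : γ t ∈ (chartAt E x₀).source) :
    ∀ᶠ τ in 𝓝[s] t, γ τ ∈ (chartAt E x₀).source :=
  h ((chartAt E x₀).open_source.mem_nhds hx)

end MapsIntoTangentBundle

/-! ### Chart independence of the covariant derivative along a curve. -/

section CovariantDerivative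

namespace PseudoFinslerMetric

variable {E : Type*} [NormedAddCommGroup E] [NormedSpace ℝ E] [FiniteDimensional ℝ E]
  {M : Type*} [TopologicalSpace M] [ChartedSpace E M] [IsManifold 𝓘(ℝ, E) ∞ M]
  (L : PseudoFinslerMetric E M)

/-- The covariant derivative along a curve in an arbitrary chart. -/
theorem tangentCoord_covDeriv {γ : ℝ → M} {s : Set ℝ} {W X : ∀ t, TangentSpace 𝓘(ℝ, E) (γ t)}
    {t : ℝ} (ht : t ∈ s) (hs : UniqueDiffWithinAt ℝ s t) (hγ : ContinuousWithinAt γ s t) {x₀ : M}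
    (hx : γ t ∈ (chartAt E x₀).source)
    (hW : (⟨γ t, W t⟩ : TangentBundle 𝓘(ℝ, E) M) ∈ L.domain)
    (hγd : DifferentiableWithinAt ℝ (fun τ => extChartAt 𝓘(ℝ, E) x₀ (γ τ)) s t)
    (hXd : DifferentiableWithinAt ℝ
      (fun τ => (tangentCoord x₀ (⟨γ τ, X τ⟩ : TangentBundle 𝓘(ℝ, E) M)).2) s t) :
    (tangentCoord x₀ (⟨γ t, L.covDeriv γ s W X t⟩ : TangentBundle 𝓘(ℝ, E) M)).2 =
      derivWithin (fun τ => (tangentCoord x₀ (⟨γ τ, X τ⟩ : TangentBundle 𝓘(ℝ, E) M)).2) s t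
      + L.christoffelL x₀ (tangentCoord x₀ ⟨γ t, W t⟩) (tangentCoord x₀ ⟨γ t, X t⟩).2
          (derivWithin (fun τ => extChartAt 𝓘(ℝ, E) x₀ (γ τ)) s t) := by
  set ψ := chartTransition E x₀ (γ t) with hψ
  set O := chartOverlap E x₀ (γ t) with hO
  have hOo : IsOpen O := isOpen_chartOverlap x₀ (γ t)
  have hψO : ContDiffOn ℝ ∞ ψ O := contDiffOn_chartTransition x₀ (γ t)
  have hdψO : ContDiffOn ℝ ∞ (fderiv ℝ ψ) O := hψO.contDiffOn_fderiv_of_isOpen hOo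
  set x : ℝ → E := fun τ => extChartAt 𝓘(ℝ, E) x₀ (γ τ) with hxdef
  set ξ : ℝ → E := fun τ => (tangentCoord x₀ (⟨γ τ, X τ⟩ : TangentBundle 𝓘(ℝ, E) M)).2 with hξ
  have hsrc : γ t ∈ (chartAt E (γ t)).source := mem_chart_source E _
  have hxO : x t ∈ O := extChartAt_mem_chartOverlap hx hsrc
  have hψd : HasFDerivAt ψ (fderiv ℝ ψ (x t)) (x t) :=
    ((hψO.differentiableOn (by simp)).differentiableAt (hOo.mem_nhds hxO)).hasFDerivAt
  have hdψd : HasFDerivAt (fderiv ℝ ψ) (fderiv ℝ (fderiv ℝ ψ) (x t)) (x t) :=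
    ((hdψO.differentiableOn (by simp)).differentiableAt (hOo.mem_nhds hxO)).hasFDerivAt
  have hBs : ∀ X Y, fderiv ℝ (fderiv ℝ ψ) (x t) X Y = fderiv ℝ (fderiv ℝ ψ) (x t) Y X :=
    fun X Y => ((hψO.contDiffAt (hOo.mem_nhds hxO)).isSymmSndFDerivAt (by simp; norm_cast)) X Y
  have hev : ∀ᶠ τ in 𝓝[s] t, γ τ ∈ (chartAt E x₀).source ∧ γ τ ∈ (chartAt E (γ t)).source :=
    (hγ.eventually_mem_source hx).and (hγ.eventually_mem_source hsrc)
  have e1 : (fun τ => extChartAt 𝓘(ℝ, E) (γ t) (γ τ)) =ᶠ[𝓝[s] t] fun τ => ψ (x τ) := by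
    filter_upwards [hev] with τ hτ using (chartTransition_extChartAt (γ t) hτ.1).symm
  have e2 : (fun τ => (tangentCoord (γ t) (⟨γ τ, X τ⟩ : TangentBundle 𝓘(ℝ, E) M)).2)
      =ᶠ[𝓝[s] t] fun τ => fderiv ℝ ψ (x τ) (ξ τ) := by
    filter_upwards [hev] with τ hτ
    exact congrArg Prod.snd (tangentCoord_transition (z := ⟨γ τ, X τ⟩) hτ.1 hτ.2)
  have d1 : derivWithin (fun τ => extChartAt 𝓘(ℝ, E) (γ t) (γ τ)) s t
      = fderiv ℝ ψ (x t) (derivWithin x s t) := by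
    rw [e1.derivWithin_eq_of_mem ht]
    exact (hψd.comp_hasDerivWithinAt t hγd.hasDerivWithinAt).derivWithin hs
  have d2 : derivWithin (fun τ => (tangentCoord (γ t) (⟨γ τ, X τ⟩ :
      TangentBundle 𝓘(ℝ, E) M)).2) s t = fderiv ℝ (fderiv ℝ ψ) (x t) (derivWithin x s t) (ξ t)
        + fderiv ℝ ψ (x t) (derivWithin ξ s t) := by
    rw [e2.derivWithin_eq_of_mem ht]
    exact ((hdψd.comp_hasDerivWithinAt t hγd.hasDerivWithinAt).clm_apply
      hXd.hasDerivWithinAt).derivWithin hs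
  have hq : tangentCoord x₀ (⟨γ t, W t⟩ : TangentBundle 𝓘(ℝ, E) M) ∈ L.coordDomain x₀ :=
    L.tangentCoord_mem_coordDomain (z := ⟨γ t, W t⟩) hx hW
  have tr := L.christoffel_transition (x₁ := γ t) hq hxO (ξ t) (derivWithin x s t)
  have hWt := tangentCoord_transition (z := (⟨γ t, W t⟩ : TangentBundle 𝓘(ℝ, E) M)) hx hsrc
  have hXt := congrArg Prod.snd (tangentCoord_transition
    (z := (⟨γ t, X t⟩ : TangentBundle 𝓘(ℝ, E) M)) hx hsrc)
  -- The comparison is made in the chart at `γ t`, where `covDeriv` is defined. The second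
  -- derivative of `ψ` from differentiating the components (`d2`) cancels the inhomogeneous term of
  -- the transformation law (`tr`).
  refine (isInvertible_fderiv_chartTransition hxO).1 ?_
  have hc := congrArg Prod.snd (tangentCoord_transition
    (z := (⟨γ t, L.covDeriv γ s W X t⟩ : TangentBundle 𝓘(ℝ, E) M)) hx hsrc)
  refine hc.symm.trans ?_
  rw [tangentCoord_self_snd, covDeriv, d1, d2, hWt, hXt, map_add, christoffelL_apply]
  refine Eq.trans ?_ (congrArg (fun v => fderiv ℝ ψ (x t) (derivWithin ξ s t) + v) tr).symm
  rw [hBs (derivWithin x s t)]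
  exact (show ∀ a b c : E, a + b + c = b + (c + a) from fun a b c => by abel) _ _ _

end PseudoFinslerMetric

end CovariantDerivative

/-! ### Geodesics as projections of integral curves of the spray. -/

section GeodesicEquation

/-- The velocity of a curve, as a curve in the tangent bundle. -/
noncomputable def velocityLift {E : Type*} [NormedAddCommGroup E] [NormedSpace ℝ E]
    {M : Type*} [TopologicalSpace M] [ChartedSpace E M] (γ : ℝ → M) (s : Set ℝ) (t : ℝ) :
    TangentBundle 𝓘(ℝ, E) M := ⟨γ t, velocity γ s t⟩

variable {E : Type*} [NormedAddCommGroup E] [NormedSpace ℝ E]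
  {M : Type*} [TopologicalSpace M] [ChartedSpace E M] [IsManifold 𝓘(ℝ, E) ∞ M]

/-- The velocity depends only on the germ of the curve within its time set. This permits passing
between time sets of different shape, such as `Ico`, `Icc` and `Ici`. -/
theorem velocityLift_congr {γ γ' : ℝ → M} {s s' : Set ℝ} {t : ℝ} (ht : t ∈ s)
    (hs : UniqueDiffWithinAt ℝ s t)
    (hγ' : MDifferentiableWithinAt 𝓘(ℝ, ℝ) 𝓘(ℝ, E) γ' s' t) (hss : s' ∈ 𝓝[s] t)
    (h : γ =ᶠ[𝓝[s] t] γ') : velocityLift (E := E) γ s t = velocityLift γ' s' t := by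
  have h0 : γ t = γ' t := h.eq_of_nhdsWithin ht
  have h1 := h.mfderivWithin_eq (I := 𝓘(ℝ, ℝ)) (I' := 𝓘(ℝ, E)) h0
  have h2 := hγ'.mfderivWithin_mono_of_mem_nhdsWithin hs.uniqueMDiffWithinAt hss
  have h3 : (velocity γ s t : E) = (velocity γ' s' t : E) :=
    (congrArg (fun T : ℝ →L[ℝ] E => T 1) h1).trans (congrArg (fun T : ℝ →L[ℝ] E => T 1) h2)
  rw [velocityLift, velocityLift, Bundle.TotalSpace.mk.injEq]
  exact ⟨h0, heq_of_eq h3⟩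

theorem tangentCoord_velocityLift {γ : ℝ → M} {s : Set ℝ} {t : ℝ}
    (hγ : MDifferentiableWithinAt 𝓘(ℝ, ℝ) 𝓘(ℝ, E) γ s t) (hs : UniqueDiffWithinAt ℝ s t)
    {x₀ : M} (hx : γ t ∈ (chartAt E x₀).source) :
    tangentCoord x₀ (velocityLift (E := E) γ s t) = (extChartAt 𝓘(ℝ, E) x₀ (γ t),
      derivWithin (fun τ => extChartAt 𝓘(ℝ, E) x₀ (γ τ)) s t) :=
  Prod.ext rfl (tangentCoord_velocity hγ hs hx)

theorem eventually_tangentCoord_velocityLift {γ : ℝ → M} {s : Set ℝ} {t : ℝ}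
    (hγ : ContMDiffOn 𝓘(ℝ, ℝ) 𝓘(ℝ, E) ∞ γ s) (hs : UniqueDiffOn ℝ s) (ht : t ∈ s)
    {x₀ : M} (hx : γ t ∈ (chartAt E x₀).source) :
    (fun τ => tangentCoord x₀ (velocityLift (E := E) γ s τ)) =ᶠ[𝓝[s] t]
      fun τ => (extChartAt 𝓘(ℝ, E) x₀ (γ τ),
        derivWithin (fun τ => extChartAt 𝓘(ℝ, E) x₀ (γ τ)) s τ) := by
  filter_upwards [(hγ t ht).continuousWithinAt.eventually_mem_source hx,
    self_mem_nhdsWithin] with τ h1 h2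
  exact tangentCoord_velocityLift ((hγ τ h2).mdifferentiableWithinAt (by simp)) (hs τ h2) h1

theorem contDiffWithinAt_velocityLift {γ : ℝ → M} {s : Set ℝ} {t : ℝ}
    (hγ : ContMDiffOn 𝓘(ℝ, ℝ) 𝓘(ℝ, E) ∞ γ s) (hs : UniqueDiffOn ℝ s) (ht : t ∈ s)
    {x₀ : M} (hx : γ t ∈ (chartAt E x₀).source) :
    ContDiffWithinAt ℝ ∞ (fun τ => tangentCoord x₀ (velocityLift (E := E) γ s τ)) s t := by
  have h := (hγ t ht).contDiffWithinAt_extChartAt le_rfl hx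
  exact (h.prodMk (h.derivWithin hs (by simp) ht)).congr_of_eventuallyEq_of_mem
    (eventually_tangentCoord_velocityLift hγ hs ht hx) ht

theorem hasDerivWithinAt_extChartAt {γ : ℝ → M} {s : Set ℝ} {t : ℝ}
    (hγ : MDifferentiableWithinAt 𝓘(ℝ, ℝ) 𝓘(ℝ, E) γ s t) (hs : UniqueDiffWithinAt ℝ s t)
    {x₀ : M} (hx : γ t ∈ (chartAt E x₀).source) :
    HasDerivWithinAt (fun τ => extChartAt 𝓘(ℝ, E) x₀ (γ τ))
      (tangentCoord x₀ (velocityLift (E := E) γ s t)).2 s t := by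
  rw [tangentCoord_velocityLift hγ hs hx]
  exact (hγ.differentiableWithinAt_extChartAt hx).hasDerivWithinAt

namespace PseudoFinslerMetric

variable [FiniteDimensional ℝ E] (L : PseudoFinslerMetric E M)

/-- The spray: the vector field on the tangent bundle whose integral curves are the lifts of the
geodesics, in the chart at `x₀`. -/
noncomputable def sprayField (x₀ : M) (q : E × E) : E × E := (q.2, -L.christoffelL x₀ q q.2 q.2)

theorem contDiffOn_sprayField (x₀ : M) :
    ContDiffOn ℝ ∞ (L.sprayField x₀) (L.coordDomain x₀) :=
  contDiffOn_snd.prodMk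
    (((L.contDiffOn_christoffelL x₀).clm_apply contDiffOn_snd).clm_apply contDiffOn_snd).neg

theorem contDiffAt_sprayField {x₀ : M} {q : E × E} (hq : q ∈ L.coordDomain x₀) :
    ContDiffAt ℝ ∞ (L.sprayField x₀) q :=
  (L.contDiffOn_sprayField x₀).contDiffAt ((L.isOpen_coordDomain x₀).mem_nhds hq)

/-- The geodesic equation at a time `t` in an arbitrary chart. -/
theorem covDerivAlong_velocity_eq_zero_iff {γ : ℝ → M} {s : Set ℝ} {t : ℝ}
    (hγ : ContMDiffOn 𝓘(ℝ, ℝ) 𝓘(ℝ, E) ∞ γ s) (hs : UniqueDiffOn ℝ s) (ht : t ∈ s)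
    (hA : velocityLift γ s t ∈ L.domain) {x₀ : M} (hx : γ t ∈ (chartAt E x₀).source) :
    L.covDerivAlong γ s (velocity γ s) t = 0 ↔
      HasDerivWithinAt (fun τ => tangentCoord x₀ (velocityLift γ s τ))
        (L.sprayField x₀ (tangentCoord x₀ (velocityLift γ s t))) s t := by
  have hc := (contDiffWithinAt_velocityLift hγ hs ht hx).differentiableWithinAt (by simp)
  have hγt := (hγ t ht).mdifferentiableWithinAt (n := ∞) (by simp)
  have hd := hasDerivWithinAt_extChartAt hγt (hs t ht) hx
  have key := L.tangentCoord_covDeriv (X := velocity γ s) ht (hs t ht)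
    (hγ t ht).continuousWithinAt hx hA hd.differentiableWithinAt hc.snd
  rw [hd.derivWithin (hs t ht)] at key
  change (tangentCoord x₀ (⟨γ t, L.covDerivAlong γ s (velocity γ s) t⟩ :
      TangentBundle 𝓘(ℝ, E) M)).2
    = derivWithin (fun τ => (tangentCoord x₀ (velocityLift γ s τ)).2) s t
      + L.christoffelL x₀ (tangentCoord x₀ (velocityLift γ s t))
        (tangentCoord x₀ (velocityLift γ s t)).2 (tangentCoord x₀ (velocityLift γ s t)).2 at key
  -- The first component of the spray equation holds for every lift of a curve; only the second one
  -- is the geodesic equation.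
  constructor
  · intro h0
    rw [h0, tangentCoord_snd_zero] at key
    have h2 := hc.snd.hasDerivWithinAt
    rw [eq_neg_of_add_eq_zero_left key.symm] at h2
    exact hd.prodMk h2
  · intro h0
    have h1 : HasDerivWithinAt (fun τ => (tangentCoord x₀ (velocityLift γ s τ)).2)
      (L.sprayField x₀ (tangentCoord x₀ (velocityLift γ s t))).2 s t := h0.snd
    rw [h1.derivWithin (hs t ht)] at key
    refine tangentCoord_snd_injective hx ?_
    rw [key, tangentCoord_snd_zero]
    exact neg_add_cancel _

variable {L}

theorem IsGeodesic.mdifferentiableWithinAt {γ : ℝ → M} {s : Set ℝ} (h : L.IsGeodesic γ s) {t : ℝ}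
    (ht : t ∈ s) : MDifferentiableWithinAt 𝓘(ℝ, ℝ) 𝓘(ℝ, E) γ s t :=
  (h.contMDiffOn t ht).mdifferentiableWithinAt (by simp)

theorem IsGeodesic.hasDerivWithinAt {γ : ℝ → M} {s : Set ℝ} (h : L.IsGeodesic γ s)
    (hs : UniqueDiffOn ℝ s) {t : ℝ} (ht : t ∈ s) {x₀ : M} (hx : γ t ∈ (chartAt E x₀).source) :
    HasDerivWithinAt (fun τ => tangentCoord x₀ (velocityLift γ s τ))
      (L.sprayField x₀ (tangentCoord x₀ (velocityLift γ s t))) s t :=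
  (L.covDerivAlong_velocity_eq_zero_iff h.contMDiffOn hs ht (h.admissible t ht) hx).1
    (h.parallel t ht)

theorem IsGeodesic.mem_coordDomain {γ : ℝ → M} {s : Set ℝ} (h : L.IsGeodesic γ s)
    {t : ℝ} (ht : t ∈ s) {x₀ : M} (hx : γ t ∈ (chartAt E x₀).source) :
    tangentCoord x₀ (velocityLift γ s t) ∈ L.coordDomain x₀ :=
  L.tangentCoord_mem_coordDomain hx (h.admissible t ht)

/-- Smoothness, admissibility and the spray equation all depend on germs. Restriction, gluing and
changes of time set are instances of this. -/
theorem isGeodesic_of_locally {γ : ℝ → M} {s : Set ℝ} (hs : UniqueDiffOn ℝ s)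
    (h : ∀ t ∈ s, ∃ (γ' : ℝ → M) (s' : Set ℝ), L.IsGeodesic γ' s' ∧ UniqueDiffOn ℝ s' ∧
      s' ∈ 𝓝[s] t ∧ γ =ᶠ[𝓝[s] t] γ') : L.IsGeodesic γ s := by
  have hγ : ContMDiffOn 𝓘(ℝ, ℝ) 𝓘(ℝ, E) ∞ γ s := fun t ht => by
    obtain ⟨γ', s', hg, hs', hss, he⟩ := h t ht
    exact ((hg.contMDiffOn t (mem_of_mem_nhdsWithin ht hss)).mono_of_mem_nhdsWithin
      hss).congr_of_eventuallyEq_of_mem he ht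
  have key : ∀ t ∈ s, ∃ (γ' : ℝ → M) (s' : Set ℝ), L.IsGeodesic γ' s' ∧ UniqueDiffOn ℝ s' ∧
      s' ∈ 𝓝[s] t ∧ t ∈ s' ∧ velocityLift γ s =ᶠ[𝓝[s] t] velocityLift (E := E) γ' s' := by
    intro t ht
    obtain ⟨γ', s', hg, hs', hss, he⟩ := h t ht
    refine ⟨γ', s', hg, hs', hss, mem_of_mem_nhdsWithin ht hss, ?_⟩
    have h1 : ∀ᶠ τ in 𝓝[s] t, s' ∈ 𝓝[s] τ := eventually_eventually_nhdsWithin.2 hss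
    filter_upwards [h1, eventually_eventually_nhdsWithin.2 he, self_mem_nhdsWithin]
      with τ h1 h2 h3
    exact velocityLift_congr h3 (hs τ h3)
      (hg.mdifferentiableWithinAt (mem_of_mem_nhdsWithin h3 h1)) h1 h2
  have hA : L.IsAdmissible γ s := fun t ht => by
    obtain ⟨γ', s', hg, hs', hss, ht', he⟩ := key t ht
    change velocityLift γ s t ∈ L.domain
    rw [he.eq_of_nhdsWithin ht]
    exact hg.admissible t ht'
  refine ⟨hγ, hA, fun t ht => ?_⟩
  obtain ⟨γ', s', hg, hs', hss, ht', he⟩ := key t ht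
  have e0 := he.eq_of_nhdsWithin ht
  have hx : γ t ∈ (chartAt E (γ t)).source := mem_chart_source E _
  have hx' : γ' t ∈ (chartAt E (γ t)).source := by
    have : γ t = γ' t := congrArg Bundle.TotalSpace.proj e0
    rw [← this]; exact hx
  refine (L.covDerivAlong_velocity_eq_zero_iff hγ hs ht (hA t ht) hx).2 ?_
  have hd := (hg.hasDerivWithinAt hs' ht' hx').mono_of_mem_nhdsWithin hss
  rw [← e0] at hd
  exact hd.congr_of_eventuallyEq_of_mem
    (by filter_upwards [he] with τ hτ using congrArg (tangentCoord (γ t)) hτ) ht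

theorem IsGeodesic.mono {γ : ℝ → M} {s s' : Set ℝ} (h : L.IsGeodesic γ s') (hs : UniqueDiffOn ℝ s)
    (hs' : UniqueDiffOn ℝ s') (hss : s ⊆ s') : L.IsGeodesic γ s :=
  isGeodesic_of_locally hs fun _ _ => ⟨γ, s', h, hs', Filter.mem_of_superset self_mem_nhdsWithin hss,
    Filter.EventuallyEq.rfl⟩

theorem IsGeodesic.velocityLift_mono {γ : ℝ → M} {s s' : Set ℝ} (h : L.IsGeodesic γ s')
    (hs : UniqueDiffOn ℝ s) (hss : s ⊆ s') {t : ℝ} (ht : t ∈ s) :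
    velocityLift (E := E) γ s t = velocityLift γ s' t :=
  velocityLift_congr ht (hs t ht) (h.mdifferentiableWithinAt (hss ht))
    (Filter.mem_of_superset self_mem_nhdsWithin hss) Filter.EventuallyEq.rfl

/-- Integral curves of the spray are lifts of geodesics. -/
theorem isGeodesic_of_hasDerivWithinAt {x₀ : M} {q : ℝ → E × E} {s : Set ℝ}
    (hs : UniqueDiffOn ℝ s) (hq : ∀ t ∈ s, q t ∈ L.coordDomain x₀)
    (hd : ∀ t ∈ s, HasDerivWithinAt q (L.sprayField x₀ (q t)) s t) :
    L.IsGeodesic (fun t => (extChartAt 𝓘(ℝ, E) x₀).symm (q t).1) s ∧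
      ∀ t ∈ s, velocityLift (fun t => (extChartAt 𝓘(ℝ, E) x₀).symm (q t).1) s t
        = (tangentCoordSymm x₀ (q t) : TangentBundle 𝓘(ℝ, E) M) := by
  set γ : ℝ → M := fun t => (extChartAt 𝓘(ℝ, E) x₀).symm (q t).1 with hγdef
  have hqs : ContDiffOn ℝ ∞ q s :=
    contDiffOn_infty_of_hasDerivWithinAt (L.contDiffOn_sprayField x₀) hs hd hq
  have hγ : ContMDiffOn 𝓘(ℝ, ℝ) 𝓘(ℝ, E) ∞ γ s := fun t ht =>
    (contDiff_fst.comp_contDiffOn hqs t ht).contMDiffWithinAt_extChartAt_symm (hq t ht).1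
  have hx : ∀ t ∈ s, γ t ∈ (chartAt E x₀).source := fun t ht =>
    tangentCoordSymm_mem (hq t ht).1
  have hφ : ∀ t ∈ s, extChartAt 𝓘(ℝ, E) x₀ (γ t) = (q t).1 := fun t ht =>
    (extChartAt 𝓘(ℝ, E) x₀).right_inv (hq t ht).1
  have hc : ∀ t ∈ s, tangentCoord x₀ (velocityLift γ s t) = q t := fun t ht => by
    rw [tangentCoord_velocityLift ((hγ t ht).mdifferentiableWithinAt (by simp)) (hs t ht) (hx t ht)]
    refine Prod.ext (hφ t ht) ?_
    have h1 : HasDerivWithinAt (fun t => (q t).1) (q t).2 s t := (hd t ht).fst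
    exact (h1.congr hφ (hφ t ht)).derivWithin (hs t ht)
  have hl : ∀ t ∈ s, velocityLift γ s t = tangentCoordSymm x₀ (q t) := fun t ht => by
    rw [← hc t ht, tangentCoordSymm_tangentCoord]
    exact hx t ht
  have hA : L.IsAdmissible γ s := fun t ht => by
    change velocityLift γ s t ∈ L.domain
    rw [hl t ht]
    exact (hq t ht).2
  refine ⟨⟨hγ, hA, fun t ht => ?_⟩, hl⟩
  refine (L.covDerivAlong_velocity_eq_zero_iff hγ hs ht (hA t ht) (hx t ht)).2 ?_
  rw [hc t ht]
  exact (hd t ht).congr hc (hc t ht)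

end PseudoFinslerMetric

end GeodesicEquation

/-! ### Partial derivatives on a product of time sets and the commutator formula. -/

section TwoParameterCalculus

variable {G : Type*} [NormedAddCommGroup G] [NormedSpace ℝ G]

/-- The partial derivative in the first variable of a map defined on a product with first
factor `T`. -/
noncomputable def partialFst (T : Set ℝ) (f : ℝ × ℝ → G) (p : ℝ × ℝ) : G :=
  derivWithin (fun τ => f (τ, p.2)) T p.1

/-- The partial derivative in the second variable of a map defined on a product with second
factor `S`. -/
noncomputable def partialSnd (S : Set ℝ) (f : ℝ × ℝ → G) (p : ℝ × ℝ) : G :=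
  derivWithin (fun σ => f (p.1, σ)) S p.2

variable {T S : Set ℝ} {f : ℝ × ℝ → G} {p : ℝ × ℝ}

theorem hasDerivWithinAt_fst (hp : p ∈ T ×ˢ S) (hf : DifferentiableWithinAt ℝ f (T ×ˢ S) p) :
    HasDerivWithinAt (fun τ => f (τ, p.2)) (fderivWithin ℝ f (T ×ˢ S) p (1, 0)) T p.1 := by
  have h1 : HasDerivWithinAt (fun τ : ℝ => (τ, p.2)) ((1 : ℝ), (0 : ℝ)) T p.1 :=
    (hasDerivWithinAt_id p.1 T).prodMk (hasDerivWithinAt_const p.1 T p.2)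
  exact HasFDerivWithinAt.comp_hasDerivWithinAt (f := fun τ : ℝ => (τ, p.2)) (t := T ×ˢ S) p.1
    hf.hasFDerivWithinAt h1 fun τ hτ => ⟨hτ, hp.2⟩

theorem hasDerivWithinAt_snd (hp : p ∈ T ×ˢ S) (hf : DifferentiableWithinAt ℝ f (T ×ˢ S) p) :
    HasDerivWithinAt (fun σ => f (p.1, σ)) (fderivWithin ℝ f (T ×ˢ S) p (0, 1)) S p.2 := by
  have h1 : HasDerivWithinAt (fun σ : ℝ => (p.1, σ)) ((0 : ℝ), (1 : ℝ)) S p.2 :=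
    (hasDerivWithinAt_const p.2 S p.1).prodMk (hasDerivWithinAt_id p.2 S)
  exact HasFDerivWithinAt.comp_hasDerivWithinAt (f := fun σ : ℝ => (p.1, σ)) (t := T ×ˢ S) p.2
    hf.hasFDerivWithinAt h1 fun τ hτ => ⟨hp.1, hτ⟩

theorem partialFst_eq (hT : UniqueDiffOn ℝ T) (hp : p ∈ T ×ˢ S)
    (hf : DifferentiableWithinAt ℝ f (T ×ˢ S) p) :
    partialFst T f p = fderivWithin ℝ f (T ×ˢ S) p (1, 0) :=
  (hasDerivWithinAt_fst hp hf).derivWithin (hT p.1 hp.1)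

theorem partialSnd_eq (hS : UniqueDiffOn ℝ S) (hp : p ∈ T ×ˢ S)
    (hf : DifferentiableWithinAt ℝ f (T ×ˢ S) p) :
    partialSnd S f p = fderivWithin ℝ f (T ×ˢ S) p (0, 1) :=
  (hasDerivWithinAt_snd hp hf).derivWithin (hS p.2 hp.2)

theorem ContDiffWithinAt.eventually_differentiableWithinAt {n : ℕ} (hp : p ∈ T ×ˢ S)
    (hf : ContDiffWithinAt ℝ (n + 1) f (T ×ˢ S) p) :
    ∀ᶠ p' in 𝓝[T ×ˢ S] p, DifferentiableWithinAt ℝ f (T ×ˢ S) p' := by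
  have h := hf.eventually (by exact_mod_cast (WithTop.coe_ne_top : ((n + 1 : ℕ) : ℕ∞) ≠ ⊤))
  rw [insert_eq_of_mem hp] at h
  filter_upwards [h] with p' hp' using hp'.differentiableWithinAt (by simp)

theorem ContDiffWithinAt.partialFst {n : ℕ} (hT : UniqueDiffOn ℝ T) (hS : UniqueDiffOn ℝ S)
    (hp : p ∈ T ×ˢ S) (hf : ContDiffWithinAt ℝ (n + 1) f (T ×ˢ S) p) :
    ContDiffWithinAt ℝ n (partialFst T f) (T ×ˢ S) p := by
  have h := (hf.fderivWithin_right (hT.prod hS) le_rfl hp).clm_apply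
    (contDiffWithinAt_const (c := ((1, 0) : ℝ × ℝ)))
  refine h.congr_of_eventuallyEq_of_mem ?_ hp
  filter_upwards [hf.eventually_differentiableWithinAt hp, self_mem_nhdsWithin] with p' h1 h2
    using partialFst_eq hT h2 h1

theorem ContDiffWithinAt.partialSnd {n : ℕ} (hT : UniqueDiffOn ℝ T) (hS : UniqueDiffOn ℝ S)
    (hp : p ∈ T ×ˢ S) (hf : ContDiffWithinAt ℝ (n + 1) f (T ×ˢ S) p) :
    ContDiffWithinAt ℝ n (partialSnd S f) (T ×ˢ S) p := by
  have h := (hf.fderivWithin_right (hT.prod hS) le_rfl hp).clm_apply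
    (contDiffWithinAt_const (c := ((0, 1) : ℝ × ℝ)))
  refine h.congr_of_eventuallyEq_of_mem ?_ hp
  filter_upwards [hf.eventually_differentiableWithinAt hp, self_mem_nhdsWithin] with p' h1 h2
    using partialSnd_eq hS h2 h1

/-- Schwarz's theorem at points that may lie on the boundary, as at the end times of a curve; being
a limit of interior points is what makes the second derivative symmetric there. -/
theorem partialFst_partialSnd (hT : UniqueDiffOn ℝ T) (hS : UniqueDiffOn ℝ S)
    (hp : p ∈ T ×ˢ S) (hpc : p ∈ closure (interior (T ×ˢ S)))
    (hf : ContDiffWithinAt ℝ 2 f (T ×ˢ S) p) :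
    partialFst T (partialSnd S f) p = partialSnd S (partialFst T f) p := by
  have hf' : ContDiffWithinAt ℝ ((1 : ℕ) + 1) f (T ×ˢ S) p := by norm_num; exact hf
  have hd : DifferentiableWithinAt ℝ (fderivWithin ℝ f (T ×ˢ S)) (T ×ˢ S) p :=
    (hf'.fderivWithin_right (hT.prod hS) le_rfl hp).differentiableWithinAt (by simp)
  have hev := hf'.eventually_differentiableWithinAt hp
  have hu := (hT.prod hS) p hp
  have h1 := (hf'.partialSnd hT hS hp).differentiableWithinAt (by simp)
  have h2 := (hf'.partialFst hT hS hp).differentiableWithinAt (by simp)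
  rw [partialFst_eq hT hp h1, partialSnd_eq hS hp h2]
  have e1 : _root_.partialSnd S f =ᶠ[𝓝[T ×ˢ S] p]
      fun p' => fderivWithin ℝ f (T ×ˢ S) p' (0, 1) := by
    filter_upwards [hev, self_mem_nhdsWithin] with p' h1 h2 using partialSnd_eq hS h2 h1
  have e2 : _root_.partialFst T f =ᶠ[𝓝[T ×ˢ S] p]
      fun p' => fderivWithin ℝ f (T ×ˢ S) p' (1, 0) := by
    filter_upwards [hev, self_mem_nhdsWithin] with p' h1 h2 using partialFst_eq hT h2 h1
  rw [e1.fderivWithin_eq_of_mem hp, e2.fderivWithin_eq_of_mem hp,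
    (hd.hasFDerivWithinAt.clm_apply (hasFDerivWithinAt_const _ _ _)).fderivWithin hu,
    (hd.hasFDerivWithinAt.clm_apply (hasFDerivWithinAt_const _ _ _)).fderivWithin hu]
  simpa using (hf.isSymmSndFDerivWithinAt (by simp) (hT.prod hS) hpc hp) (1, 0) (0, 1)

theorem tendsto_prodMk_fst (hp : p ∈ T ×ˢ S) :
    Filter.Tendsto (fun τ => (τ, p.2)) (𝓝[T] p.1) (𝓝[T ×ˢ S] p) :=
  tendsto_nhdsWithin_of_tendsto_nhds_of_eventually_within _
    (((continuous_id.prodMk continuous_const).tendsto' p.1 p rfl).mono_left nhdsWithin_le_nhds)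
    (by filter_upwards [self_mem_nhdsWithin] with τ hτ using ⟨hτ, hp.2⟩)

theorem tendsto_prodMk_snd (hp : p ∈ T ×ˢ S) :
    Filter.Tendsto (fun σ => (p.1, σ)) (𝓝[S] p.2) (𝓝[T ×ˢ S] p) :=
  tendsto_nhdsWithin_of_tendsto_nhds_of_eventually_within _
    (((continuous_const.prodMk continuous_id).tendsto' p.2 p rfl).mono_left nhdsWithin_le_nhds)
    (by filter_upwards [self_mem_nhdsWithin] with τ hτ using ⟨hp.1, hτ⟩)

variable {E : Type*} [NormedAddCommGroup E] [NormedSpace ℝ E]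

/-- The curvature of a connection with direction dependent Christoffel symbols `Γ`, along a curve
with lifted velocity `q`, acceleration `a` and variational field `j` with derivative `j'`. -/
noncomputable def coordCurvature (Γ : E × E → E →L[ℝ] E →L[ℝ] E) (q : E × E) (a j j' z : E) : E :=
  fderiv ℝ Γ q (q.2, a) z j - fderiv ℝ Γ q (j, j') z q.2 + Γ q (Γ q z j) q.2 - Γ q (Γ q z q.2) j

/-- The commutator of covariant derivatives along a two-parameter map, in coordinates. -/
theorem commutator_eq_coordCurvature {Γ : E × E → E →L[ℝ] E →L[ℝ] E} {x z : ℝ × ℝ → E}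
    (hT : UniqueDiffOn ℝ T) (hS : UniqueDiffOn ℝ S)
    (hp : p ∈ T ×ˢ S) (hpc : p ∈ closure (interior (T ×ˢ S)))
    (hx : ContDiffWithinAt ℝ 2 x (T ×ˢ S) p) (hz : ContDiffWithinAt ℝ 2 z (T ×ˢ S) p)
    (hΓ : DifferentiableAt ℝ Γ (x p, partialFst T x p))
    {A B : ℝ × ℝ → E}
    (hA : A = fun p => partialSnd S z p + Γ (x p, partialFst T x p) (z p) (partialSnd S x p))
    (hB : B = fun p => partialFst T z p + Γ (x p, partialFst T x p) (z p) (partialFst T x p)) :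
    partialFst T A p + Γ (x p, partialFst T x p) (A p) (partialFst T x p)
      - (partialSnd S B p + Γ (x p, partialFst T x p) (B p) (partialSnd S x p))
    = coordCurvature Γ (x p, partialFst T x p) (partialFst T (partialFst T x) p)
        (partialSnd S x p) (partialFst T (partialSnd S x) p) (z p) := by
  have hx' : ContDiffWithinAt ℝ ((1 : ℕ) + 1) x (T ×ˢ S) p := by norm_num; exact hx
  have hz' : ContDiffWithinAt ℝ ((1 : ℕ) + 1) z (T ×ˢ S) p := by norm_num; exact hz
  have dx := hx.differentiableWithinAt (by simp)
  have dz := hz.differentiableWithinAt (by simp)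
  have du := (hx'.partialFst hT hS hp).differentiableWithinAt (by simp)
  have dw := (hx'.partialSnd hT hS hp).differentiableWithinAt (by simp)
  have dzt := (hz'.partialFst hT hS hp).differentiableWithinAt (by simp)
  have dzs := (hz'.partialSnd hT hS hp).differentiableWithinAt (by simp)
  have ft : ∀ {f : ℝ × ℝ → E}, DifferentiableWithinAt ℝ f (T ×ˢ S) p →
      HasDerivWithinAt (fun τ => f (τ, p.2)) (partialFst T f p) T p.1 := fun hf => by
    rw [partialFst_eq hT hp hf]; exact hasDerivWithinAt_fst hp hf
  have fs : ∀ {f : ℝ × ℝ → E}, DifferentiableWithinAt ℝ f (T ×ˢ S) p →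
      HasDerivWithinAt (fun σ => f (p.1, σ)) (partialSnd S f p) S p.2 := fun hf => by
    rw [partialSnd_eq hS hp hf]; exact hasDerivWithinAt_snd hp hf
  have hΓt := hΓ.hasFDerivAt.comp_hasDerivWithinAt p.1 ((ft dx).prodMk (ft du))
  have hΓs := hΓ.hasFDerivAt.comp_hasDerivWithinAt p.2 ((fs dx).prodMk (fs du))
  subst hA hB
  have hAt := ((ft dzs).add ((hΓt.clm_apply (ft dz)).clm_apply (ft dw))).derivWithin (hT p.1 hp.1)
  have hBs := ((fs dzt).add ((hΓs.clm_apply (fs dz)).clm_apply (fs du))).derivWithin (hS p.2 hp.2)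
  have hAt' : partialFst T (fun p => partialSnd S z p
    + Γ (x p, partialFst T x p) (z p) (partialSnd S x p)) p = _ := hAt
  have hBs' : partialSnd S (fun p => partialFst T z p
    + Γ (x p, partialFst T x p) (z p) (partialFst T x p)) p = _ := hBs
  -- After interchanging mixed partials, every term with a derivative of `z` or with `Γ` applied to
  -- the mixed partial of `x` occurs twice with opposite signs. The mixed partial survives only
  -- inside the derivative of `Γ`.
  rw [hAt', hBs', partialFst_partialSnd hT hS hp hpc hz,
    partialFst_partialSnd hT hS hp hpc hx, coordCurvature]
  simp only [Function.comp_def, add_apply, map_add]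
  abel

end TwoParameterCalculus

/-! ### The curvature of a two-parameter map in a chart. -/

section VariationCurvature

variable {E : Type*} [NormedAddCommGroup E] [NormedSpace ℝ E]
  {M : Type*} [TopologicalSpace M] [ChartedSpace E M] [IsManifold 𝓘(ℝ, E) ∞ M]

variable (E) in
/-- A two-parameter map in the chart at `x₀`. -/
noncomputable def mapCoord (x₀ : M) (Λ : ℝ → ℝ → M) (p : ℝ × ℝ) : E :=
  extChartAt 𝓘(ℝ, E) x₀ (Λ p.1 p.2)

/-- The components in the chart at `x₀` of a vector field along a two-parameter map. -/
noncomputable def fieldCoord (x₀ : M) {Λ : ℝ → ℝ → M} (Z : ∀ t s, TangentSpace 𝓘(ℝ, E) (Λ t s))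
    (p : ℝ × ℝ) : E :=
  (tangentCoord x₀ (⟨Λ p.1 p.2, Z p.1 p.2⟩ : TangentBundle 𝓘(ℝ, E) M)).2

theorem tangentCoord_longVelocity {Λ : ℝ → ℝ → M} {T S : Set ℝ} {p : ℝ × ℝ} {x₀ : M}
    (hT : UniqueDiffOn ℝ T) (hp : p ∈ T ×ˢ S)
    (hΛ : ContMDiffOn 𝓘(ℝ, ℝ × ℝ) 𝓘(ℝ, E) ∞ (fun q : ℝ × ℝ => Λ q.1 q.2) (T ×ˢ S))
    (hx : Λ p.1 p.2 ∈ (chartAt E x₀).source) :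
    tangentCoord x₀ (⟨Λ p.1 p.2, PseudoFinslerMetric.longVelocity Λ T p.1 p.2⟩ : TangentBundle 𝓘(ℝ, E) M)
      = (mapCoord E x₀ Λ p, partialFst T (mapCoord E x₀ Λ) p) := by
  have h1 : ContMDiffWithinAt 𝓘(ℝ, ℝ) 𝓘(ℝ, E) ∞ (fun τ => Λ τ p.2) T p.1 :=
    (hΛ p hp).comp (g := fun q : ℝ × ℝ => Λ q.1 q.2) (f := fun τ : ℝ => (τ, p.2)) p.1
      (contDiff_id.prodMk contDiff_const).contMDiff.contMDiffAt.contMDiffWithinAt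
      fun τ hτ => ⟨hτ, hp.2⟩
  exact tangentCoord_velocityLift (h1.mdifferentiableWithinAt (by simp)) (hT p.1 hp.1) hx

theorem tangentCoord_transVelocity {Λ : ℝ → ℝ → M} {T S : Set ℝ} {p : ℝ × ℝ} {x₀ : M}
    (hS : UniqueDiffOn ℝ S) (hp : p ∈ T ×ˢ S)
    (hΛ : ContMDiffOn 𝓘(ℝ, ℝ × ℝ) 𝓘(ℝ, E) ∞ (fun q : ℝ × ℝ => Λ q.1 q.2) (T ×ˢ S))
    (hx : Λ p.1 p.2 ∈ (chartAt E x₀).source) :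
    tangentCoord x₀ (⟨Λ p.1 p.2, PseudoFinslerMetric.transVelocity Λ S p.1 p.2⟩ : TangentBundle 𝓘(ℝ, E) M)
      = (mapCoord E x₀ Λ p, partialSnd S (mapCoord E x₀ Λ) p) := by
  have h1 : ContMDiffWithinAt 𝓘(ℝ, ℝ) 𝓘(ℝ, E) ∞ (fun σ => Λ p.1 σ) S p.2 :=
    (hΛ p hp).comp (g := fun q : ℝ × ℝ => Λ q.1 q.2) (f := fun σ : ℝ => (p.1, σ)) p.2
      (contDiff_const.prodMk contDiff_id).contMDiff.contMDiffAt.contMDiffWithinAt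
      fun τ hτ => ⟨hp.1, hτ⟩
  exact tangentCoord_velocityLift (h1.mdifferentiableWithinAt (by simp)) (hS p.2 hp.2) hx

theorem contDiffWithinAt_mapCoord {Λ : ℝ → ℝ → M} {Q : Set (ℝ × ℝ)} {p : ℝ × ℝ} {x₀ : M}
    (hp : p ∈ Q)
    (hΛ : ContMDiffOn 𝓘(ℝ, ℝ × ℝ) 𝓘(ℝ, E) ∞ (fun q : ℝ × ℝ => Λ q.1 q.2) Q)
    (hx : Λ p.1 p.2 ∈ (chartAt E x₀).source) :
    ContDiffWithinAt ℝ ∞ (mapCoord E x₀ Λ) Q p :=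
  (hΛ p hp).contDiffWithinAt_extChartAt le_rfl hx

namespace PseudoFinslerMetric

variable [FiniteDimensional ℝ E] (L : PseudoFinslerMetric E M)

section

variable {Λ : ℝ → ℝ → M} {T S : Set ℝ} {p : ℝ × ℝ} {x₀ : M}
  {Z : ∀ t s, TangentSpace 𝓘(ℝ, E) (Λ t s)}

theorem fieldCoord_covDerivLong (hT : UniqueDiffOn ℝ T) (hp : p ∈ T ×ˢ S)
    (hΛ : ContMDiffOn 𝓘(ℝ, ℝ × ℝ) 𝓘(ℝ, E) ∞ (fun q : ℝ × ℝ => Λ q.1 q.2) (T ×ˢ S))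
    (hA : ∀ s ∈ S, L.IsAdmissible (fun τ => Λ τ s) T)
    (hZ : DifferentiableWithinAt ℝ (fieldCoord x₀ Z) (T ×ˢ S) p)
    (hx : Λ p.1 p.2 ∈ (chartAt E x₀).source) :
    fieldCoord x₀ (L.covDerivLong Λ T Z) p = partialFst T (fieldCoord x₀ Z) p
      + L.christoffelL x₀ (mapCoord E x₀ Λ p, partialFst T (mapCoord E x₀ Λ) p) (fieldCoord x₀ Z p)
        (partialFst T (mapCoord E x₀ Λ) p) := by
  have hd := (contDiffWithinAt_mapCoord hp hΛ hx).differentiableWithinAt (by simp)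
  have hc : ContinuousWithinAt (fun τ => Λ τ p.2) T p.1 :=
    (hΛ p hp).continuousWithinAt.tendsto.comp (tendsto_prodMk_fst hp)
  rw [← tangentCoord_longVelocity hT hp hΛ hx]
  exact L.tangentCoord_covDeriv (γ := fun τ => Λ τ p.2)
    (W := fun τ => PseudoFinslerMetric.longVelocity Λ T τ p.2) (X := fun τ => Z τ p.2) hp.1 (hT p.1 hp.1) hc hx
    (hA p.2 hp.2 p.1 hp.1) (hasDerivWithinAt_fst hp hd).differentiableWithinAt
    (hasDerivWithinAt_fst hp hZ).differentiableWithinAt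

theorem fieldCoord_covDerivTrans (hT : UniqueDiffOn ℝ T) (hS : UniqueDiffOn ℝ S) (hp : p ∈ T ×ˢ S)
    (hΛ : ContMDiffOn 𝓘(ℝ, ℝ × ℝ) 𝓘(ℝ, E) ∞ (fun q : ℝ × ℝ => Λ q.1 q.2) (T ×ˢ S))
    (hA : ∀ s ∈ S, L.IsAdmissible (fun τ => Λ τ s) T)
    (hZ : DifferentiableWithinAt ℝ (fieldCoord x₀ Z) (T ×ˢ S) p)
    (hx : Λ p.1 p.2 ∈ (chartAt E x₀).source) :
    fieldCoord x₀ (L.covDerivTrans Λ T S Z) p = partialSnd S (fieldCoord x₀ Z) p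
      + L.christoffelL x₀ (mapCoord E x₀ Λ p, partialFst T (mapCoord E x₀ Λ) p) (fieldCoord x₀ Z p)
        (partialSnd S (mapCoord E x₀ Λ) p) := by
  have hd := (contDiffWithinAt_mapCoord hp hΛ hx).differentiableWithinAt (by simp)
  have hc : ContinuousWithinAt (fun σ => Λ p.1 σ) S p.2 :=
    (hΛ p hp).continuousWithinAt.tendsto.comp (tendsto_prodMk_snd hp)
  rw [← tangentCoord_longVelocity hT hp hΛ hx]
  exact L.tangentCoord_covDeriv (γ := fun σ => Λ p.1 σ)
    (W := fun σ => PseudoFinslerMetric.longVelocity Λ T p.1 σ) (X := fun σ => Z p.1 σ) hp.2 (hS p.2 hp.2) hc hx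
    (hA p.2 hp.2 p.1 hp.1) (hasDerivWithinAt_snd hp hd).differentiableWithinAt
    (hasDerivWithinAt_snd hp hZ).differentiableWithinAt

/-- The curvature of a two-parameter map in coordinates. -/
theorem tangentCoord_variationCurvature (hT : UniqueDiffOn ℝ T) (hS : UniqueDiffOn ℝ S)
    (hp : p ∈ T ×ˢ S) (hpc : p ∈ closure (interior (T ×ˢ S)))
    (hΛ : ContMDiffOn 𝓘(ℝ, ℝ × ℝ) 𝓘(ℝ, E) ∞ (fun q : ℝ × ℝ => Λ q.1 q.2) (T ×ˢ S))
    (hA : ∀ s ∈ S, L.IsAdmissible (fun τ => Λ τ s) T)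
    (hZ : ContMDiffOn 𝓘(ℝ, ℝ × ℝ) 𝓘(ℝ, E).tangent ∞
      (fun q : ℝ × ℝ => (⟨Λ q.1 q.2, Z q.1 q.2⟩ : TangentBundle 𝓘(ℝ, E) M)) (T ×ˢ S))
    (hx : Λ p.1 p.2 ∈ (chartAt E x₀).source) :
    (tangentCoord x₀ (⟨Λ p.1 p.2, L.variationCurvature Λ T S Z p.1 p.2⟩ :
        TangentBundle 𝓘(ℝ, E) M)).2
      = coordCurvature (L.christoffelL x₀) (mapCoord E x₀ Λ p, partialFst T (mapCoord E x₀ Λ) p)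
          (partialFst T (partialFst T (mapCoord E x₀ Λ)) p) (partialSnd S (mapCoord E x₀ Λ) p)
          (partialFst T (partialSnd S (mapCoord E x₀ Λ)) p) (fieldCoord x₀ Z p) := by
  set x := mapCoord E x₀ Λ with hxdef
  set z := fieldCoord x₀ Z with hzdef
  have hxs : ContDiffWithinAt ℝ ∞ x (T ×ˢ S) p := contDiffWithinAt_mapCoord hp hΛ hx
  have hsz : ∀ {p : ℝ × ℝ}, p ∈ T ×ˢ S → Λ p.1 p.2 ∈ (chartAt E x₀).source →
      ContDiffWithinAt ℝ ∞ z (T ×ˢ S) p := fun hp hx =>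
    (ContMDiffWithinAt.contDiffWithinAt_tangentCoord (hZ _ hp) hx).snd
  have hzs := hsz hp hx
  -- The inner covariant derivatives are to be differentiated again, so their coordinate formulas
  -- are needed near `p` and not only at `p`.
  have hev : ∀ᶠ p' in 𝓝[T ×ˢ S] p, p' ∈ T ×ˢ S ∧ Λ p'.1 p'.2 ∈ (chartAt E x₀).source :=
    Filter.Eventually.and self_mem_nhdsWithin ((hΛ p hp).continuousWithinAt.eventually_mem_source hx)
  set A : ℝ × ℝ → E := fun p => partialSnd S z p
    + L.christoffelL x₀ (x p, partialFst T x p) (z p) (partialSnd S x p) with hAdef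
  set B : ℝ × ℝ → E := fun p => partialFst T z p
    + L.christoffelL x₀ (x p, partialFst T x p) (z p) (partialFst T x p) with hBdef
  have hAe : fieldCoord x₀ (L.covDerivTrans Λ T S Z) =ᶠ[𝓝[T ×ˢ S] p] A := by
    filter_upwards [hev] with p' hp'
    exact L.fieldCoord_covDerivTrans hT hS hp'.1 hΛ hA
      ((hsz hp'.1 hp'.2).differentiableWithinAt (by simp)) hp'.2
  have hBe : fieldCoord x₀ (L.covDerivLong Λ T Z) =ᶠ[𝓝[T ×ˢ S] p] B := by
    filter_upwards [hev] with p' hp'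
    exact L.fieldCoord_covDerivLong hT hp'.1 hΛ hA
      ((hsz hp'.1 hp'.2).differentiableWithinAt (by simp)) hp'.2
  have hq : (x p, partialFst T x p) ∈ L.coordDomain x₀ := by
    rw [← tangentCoord_longVelocity hT hp hΛ hx]
    exact L.tangentCoord_mem_coordDomain hx (hA p.2 hp.2 p.1 hp.1)
  have hΓ : ContDiffAt ℝ ∞ (L.christoffelL x₀) (x p, partialFst T x p) :=
    (L.contDiffOn_christoffelL x₀).contDiffAt ((L.isOpen_coordDomain x₀).mem_nhds hq)
  have h2 : ∀ {f : ℝ × ℝ → E}, ContDiffWithinAt ℝ ∞ f (T ×ˢ S) p →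
      ContDiffWithinAt ℝ ((1 : ℕ) + 1) f (T ×ˢ S) p := fun h => h.of_le (by norm_cast)
  have dA : DifferentiableWithinAt ℝ A (T ×ˢ S) p ∧ DifferentiableWithinAt ℝ B (T ×ˢ S) p := by
    have dx := ((h2 hxs).partialFst hT hS hp).differentiableWithinAt (by simp)
    have dx' := ((h2 hxs).partialSnd hT hS hp).differentiableWithinAt (by simp)
    have dz := ((h2 hzs).partialFst hT hS hp).differentiableWithinAt (by simp)
    have dz' := ((h2 hzs).partialSnd hT hS hp).differentiableWithinAt (by simp)
    have dΓ := (hΓ.differentiableAt (by simp)).comp_differentiableWithinAt p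
      ((hxs.differentiableWithinAt (by simp)).prodMk dx)
    have dΓz := dΓ.clm_apply (hzs.differentiableWithinAt (by simp))
    exact ⟨dz'.add (dΓz.clm_apply dx'), dz.add (dΓz.clm_apply dx)⟩
  have k1 := L.fieldCoord_covDerivLong (Z := L.covDerivTrans Λ T S Z) hT hp hΛ hA
    (dA.1.congr_of_eventuallyEq hAe (hAe.eq_of_nhdsWithin hp)) hx
  have k2 := L.fieldCoord_covDerivTrans (Z := L.covDerivLong Λ T Z) hT hS hp hΛ hA
    (dA.2.congr_of_eventuallyEq hBe (hBe.eq_of_nhdsWithin hp)) hx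
  have e1 : partialFst T (fieldCoord x₀ (L.covDerivTrans Λ T S Z)) p = partialFst T A p :=
    Filter.EventuallyEq.derivWithin_eq ((tendsto_prodMk_fst hp).eventually hAe) (hAe.eq_of_nhdsWithin hp)
  have e2 : partialSnd S (fieldCoord x₀ (L.covDerivLong Λ T Z)) p = partialSnd S B p :=
    Filter.EventuallyEq.derivWithin_eq ((tendsto_prodMk_snd hp).eventually hBe) (hBe.eq_of_nhdsWithin hp)
  rw [hAe.eq_of_nhdsWithin hp, e1] at k1
  rw [hBe.eq_of_nhdsWithin hp, e2] at k2
  have k3 := commutator_eq_coordCurvature hT hS hp hpc (hxs.of_le (by norm_cast))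
    (hzs.of_le (by norm_cast)) (hΓ.differentiableAt (by simp)) hAdef hBdef
  rw [← k3]
  refine (tangentCoord_snd_sub x₀ _ _ _).trans ?_
  exact congrArg₂ (· - ·) k1 k2

end

end PseudoFinslerMetric

end VariationCurvature

/-! ### The curvature along a curve: independence of choices and existence of variations. -/

section CurvatureAlongCurves

variable {E : Type*} [NormedAddCommGroup E] [NormedSpace ℝ E]
  {M : Type*} [TopologicalSpace M] [ChartedSpace E M] [IsManifold 𝓘(ℝ, E) ∞ M]

/-- The time window around `t` keeps nonempty interior even when `t` is an end point of `s`. With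
convexity this gives unique differentiability and the density of interior points needed for
Schwarz's theorem. -/
theorem convex_inter_Ioo_interior_nonempty {s : Set ℝ} (hs : Convex ℝ s)
    (hsi : (interior s).Nonempty) {t ε : ℝ} (ht : t ∈ s) (hε : 0 < ε) :
    Convex ℝ (s ∩ Ioo (t - ε) (t + ε)) ∧ (interior (s ∩ Ioo (t - ε) (t + ε))).Nonempty := by
  refine ⟨hs.inter (convex_Ioo _ _), ?_⟩
  have hc : t ∈ closure (interior s) := by
    rw [hs.closure_interior_eq_closure_of_nonempty_interior hsi]
    exact subset_closure ht
  rw [interior_inter, isOpen_Ioo.interior_eq, inter_comm]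
  exact mem_closure_iff.1 hc _ isOpen_Ioo ⟨by linarith, by linarith⟩

theorem Convex.subset_closure_interior {F : Type*} [NormedAddCommGroup F] [NormedSpace ℝ F]
    {s : Set F} (hs : Convex ℝ s) (hsi : (interior s).Nonempty) : s ⊆ closure (interior s) := by
  rw [hs.closure_interior_eq_closure_of_nonempty_interior hsi]
  exact subset_closure

theorem inter_Ioo_mem_nhdsWithin {s : Set ℝ} {t ε τ : ℝ}
    (hτ : τ ∈ s ∩ Ioo (t - ε) (t + ε)) : s ∩ Ioo (t - ε) (t + ε) ∈ 𝓝[s] τ :=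
  Filter.inter_mem self_mem_nhdsWithin (mem_nhdsWithin_of_mem_nhds (Ioo_mem_nhds hτ.2.1 hτ.2.2))

theorem derivWithin_of_mem_nhdsWithin_of_subset {G : Type*} [NormedAddCommGroup G]
    [NormedSpace ℝ G] (f : ℝ → G) {s T : Set ℝ} {t : ℝ} (hTs : T ⊆ s) (hT : T ∈ 𝓝[s] t) :
    derivWithin f T t = derivWithin f s t := by
  refine derivWithin_congr_set ?_
  filter_upwards [mem_nhdsWithin_iff_eventually.1 hT] with τ hτ using propext ⟨@hTs τ, hτ⟩

/-- The components of a vector field along a curve, in the chart at `x₀`. -/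
noncomputable def alongCoord (x₀ : M) {γ : ℝ → M} (X : ∀ t, TangentSpace 𝓘(ℝ, E) (γ t)) (t : ℝ) :
    E :=
  (tangentCoord x₀ (⟨γ t, X t⟩ : TangentBundle 𝓘(ℝ, E) M)).2

variable (E) in
/-- A curve in the chart at `x₀`. -/
noncomputable def curveCoord (x₀ : M) (γ : ℝ → M) (t : ℝ) : E := extChartAt 𝓘(ℝ, E) x₀ (γ t)

namespace PseudoFinslerMetric

variable [FiniteDimensional ℝ E] {L : PseudoFinslerMetric E M}

/-- Independence of choices: on the right only `γ`, `J` and `Z` remain. Along `σ = 0` the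
longitudinal partials are derivatives of `γ`, and the transverse partial is `J`, whose time
derivative is the mixed partial. -/
theorem IsVariation.tangentCoord_variationCurvature {γ : ℝ → M} {s : Set ℝ}
    (hs : Convex ℝ s) (hsi : (interior s).Nonempty) {t ε : ℝ} (ht : t ∈ s) (hε : 0 < ε)
    (hγ : ContMDiffOn 𝓘(ℝ, ℝ) 𝓘(ℝ, E) ∞ γ s)
    {J Z : ∀ t, TangentSpace 𝓘(ℝ, E) (γ t)} {Λ : ℝ → ℝ → M}
    {Z' : ∀ t s, TangentSpace 𝓘(ℝ, E) (Λ t s)}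
    (h : L.IsVariation γ (s ∩ Ioo (t - ε) (t + ε)) (Ioo (-ε) ε) J Z Λ Z')
    {x₀ : M} (hx : γ t ∈ (chartAt E x₀).source) :
    (tangentCoord x₀ (⟨Λ t 0, L.variationCurvature Λ (s ∩ Ioo (t - ε) (t + ε)) (Ioo (-ε) ε) Z' t 0⟩
      : TangentBundle 𝓘(ℝ, E) M)).2 =
      coordCurvature (L.christoffelL x₀) (curveCoord E x₀ γ t, derivWithin (curveCoord E x₀ γ) s t)
        (derivWithin (derivWithin (curveCoord E x₀ γ) s) s t) (alongCoord x₀ J t)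
        (derivWithin (alongCoord x₀ J) s t) (alongCoord x₀ Z t) := by
  set T := s ∩ Ioo (t - ε) (t + ε) with hTdef
  set S := Ioo (-ε) ε with hSdef
  obtain ⟨hTc, hTi⟩ := convex_inter_Ioo_interior_nonempty hs hsi ht hε
  have hT : UniqueDiffOn ℝ T := uniqueDiffOn_convex hTc hTi
  have hS : UniqueDiffOn ℝ S := isOpen_Ioo.uniqueDiffOn
  have htT : t ∈ T := ⟨ht, by simp [hε]⟩
  have h0S : (0 : ℝ) ∈ S := ⟨by linarith, hε⟩
  have hp : ((t, 0) : ℝ × ℝ) ∈ T ×ˢ S := ⟨htT, h0S⟩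
  have hpc : ((t, 0) : ℝ × ℝ) ∈ closure (interior (T ×ˢ S)) := by
    refine Convex.subset_closure_interior (hTc.prod (convex_Ioo _ _)) ?_ hp
    rw [interior_prod_eq]
    exact hTi.prod ⟨0, by rwa [isOpen_Ioo.interior_eq]⟩
  have hTs : T ⊆ s := inter_subset_left
  have hTn : ∀ {τ}, τ ∈ T → T ∈ 𝓝[s] τ := fun hτ => inter_Ioo_mem_nhdsWithin hτ
  have hx0 : Λ t 0 ∈ (chartAt E x₀).source := by rw [h.base t htT]; exact hx
  rw [L.tangentCoord_variationCurvature (p := (t, 0)) hT hS hp hpc h.contMDiffOn h.admissible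
    h.contMDiffOn_ext hx0]
  have e1 : ∀ τ ∈ T, partialFst T (mapCoord E x₀ Λ) (τ, 0) = derivWithin (curveCoord E x₀ γ) s τ := by
    intro τ hτ
    rw [← derivWithin_of_mem_nhdsWithin_of_subset _ hTs (hTn hτ)]
    exact derivWithin_congr (fun τ' hτ' => congrArg (extChartAt 𝓘(ℝ, E) x₀) (h.base τ' hτ'))
      (congrArg (extChartAt 𝓘(ℝ, E) x₀) (h.base τ hτ))
  have e2 : partialFst T (partialFst T (mapCoord E x₀ Λ)) (t, 0)
      = derivWithin (derivWithin (curveCoord E x₀ γ) s) s t := by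
    rw [← derivWithin_of_mem_nhdsWithin_of_subset _ hTs (hTn htT)]
    exact derivWithin_congr e1 (e1 t htT)
  have e3 : ∀ τ ∈ T, γ τ ∈ (chartAt E x₀).source →
      partialSnd S (mapCoord E x₀ Λ) (τ, 0) = alongCoord x₀ J τ := by
    intro τ hτ hxτ
    have h1 := tangentCoord_transVelocity (p := (τ, 0)) (x₀ := x₀) hS ⟨hτ, h0S⟩ h.contMDiffOn
      (by rw [h.base τ hτ]; exact hxτ)
    exact (congrArg Prod.snd h1).symm.trans
      (congrArg (fun z : TangentBundle 𝓘(ℝ, E) M => (tangentCoord x₀ z).2) (h.variational τ hτ))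
  have e4 : partialFst T (partialSnd S (mapCoord E x₀ Λ)) (t, 0)
      = derivWithin (alongCoord x₀ J) s t := by
    rw [← derivWithin_of_mem_nhdsWithin_of_subset _ hTs (hTn htT)]
    refine Filter.EventuallyEq.derivWithin_eq ?_ (e3 t htT hx)
    filter_upwards [self_mem_nhdsWithin, nhdsWithin_mono t hTs
      ((hγ t ht).continuousWithinAt.eventually_mem_source hx)] with τ h1 h2 using e3 τ h1 h2
  have e5 : fieldCoord x₀ Z' (t, 0) = alongCoord x₀ Z t :=
    congrArg (fun z : TangentBundle 𝓘(ℝ, E) M => (tangentCoord x₀ z).2) (h.extends_field t htT)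
  have e6 : mapCoord E x₀ Λ (t, 0) = curveCoord E x₀ γ t :=
    congrArg (extChartAt 𝓘(ℝ, E) x₀) (h.base t htT)
  rw [e1 t htT, e2, e3 t htT hx, e4, e5, e6]

/-- In a chart the variation is `x + σ j`, with the components of `Z` extended constantly in `σ`.
Since the domain of `L` is open, admissibility persists for small `σ` and times near `t`. -/
theorem exists_isVariation {γ : ℝ → M} {s : Set ℝ} (hs : Convex ℝ s)
    (hsi : (interior s).Nonempty) (hγ : ContMDiffOn 𝓘(ℝ, ℝ) 𝓘(ℝ, E) ∞ γ s)
    (hA : L.IsAdmissible γ s)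
    {J Z : ∀ t, TangentSpace 𝓘(ℝ, E) (γ t)} (hJ : IsSmoothFieldAlong γ s J)
    (hZ : IsSmoothFieldAlong γ s Z) {t : ℝ} (ht : t ∈ s) :
    ∃ ε : ℝ, 0 < ε ∧ ∃ (Λ : ℝ → ℝ → M) (Z' : ∀ t s, TangentSpace 𝓘(ℝ, E) (Λ t s)),
      L.IsVariation γ (s ∩ Ioo (t - ε) (t + ε)) (Ioo (-ε) ε) J Z Λ Z' := by
  have hsu : UniqueDiffOn ℝ s := uniqueDiffOn_convex hs hsi
  set x₀ := γ t with hx₀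
  have hx : γ t ∈ (chartAt E x₀).source := mem_chart_source E _
  set x : ℝ → E := curveCoord E x₀ γ with hxdef
  set j : ℝ → E := alongCoord x₀ J with hjdef
  set z : ℝ → E := alongCoord x₀ Z with hzdef
  have xs : ∀ τ ∈ s, γ τ ∈ (chartAt E x₀).source → ContDiffWithinAt ℝ ∞ x s τ := fun τ h1 h2 =>
    (hγ τ h1).contDiffWithinAt_extChartAt le_rfl h2
  have js : ∀ τ ∈ s, γ τ ∈ (chartAt E x₀).source → ContDiffWithinAt ℝ ∞ j s τ := fun τ h1 h2 =>
    (ContMDiffWithinAt.contDiffWithinAt_tangentCoord (hJ τ h1) h2).snd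
  have zs : ∀ τ ∈ s, γ τ ∈ (chartAt E x₀).source → ContDiffWithinAt ℝ ∞ z s τ := fun τ h1 h2 =>
    (ContMDiffWithinAt.contDiffWithinAt_tangentCoord (hZ τ h1) h2).snd
  -- Position and longitudinal velocity of the perturbed curves, so that admissibility becomes
  -- membership of `Q` in the open set `L.coordDomain x₀`.
  set Q : ℝ × ℝ → E × E := fun p => (x p.1 + p.2 • j p.1,
    derivWithin x s p.1 + p.2 • derivWithin j s p.1) with hQdef
  have hQc : ContinuousWithinAt Q (s ×ˢ univ) (t, 0) := by
    have c1 : ∀ {f : ℝ → E}, ContinuousWithinAt f s t →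
        ContinuousWithinAt (fun p : ℝ × ℝ => f p.1) (s ×ˢ univ) (t, 0) := fun hf =>
      hf.comp (f := fun p : ℝ × ℝ => p.1) (x := (t, (0 : ℝ))) continuous_fst.continuousWithinAt
        fun p hp => hp.1
    have c2 : ContinuousWithinAt (fun p : ℝ × ℝ => p.2) (s ×ˢ univ) (t, 0) :=
      continuous_snd.continuousWithinAt
    exact ((c1 (xs t ht hx).continuousWithinAt).add
      (c2.smul (c1 (js t ht hx).continuousWithinAt))).prodMk
      ((c1 ((xs t ht hx).derivWithin (m := ∞) hsu (by simp) ht).continuousWithinAt).add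
      (c2.smul (c1 ((js t ht hx).derivWithin (m := ∞) hsu (by simp) ht).continuousWithinAt)))
  have hQ0 : Q (t, 0) ∈ L.coordDomain x₀ := by
    have h1 := L.tangentCoord_mem_coordDomain (z := velocityLift γ s t) hx (hA t ht)
    rw [tangentCoord_velocityLift ((hγ t ht).mdifferentiableWithinAt (by simp)) (hsu t ht) hx] at h1
    have h2 : Q (t, 0) = (x t, derivWithin x s t) := by simp [hQdef]
    rw [h2]
    exact h1
  have hev : ∀ᶠ p in 𝓝[s ×ˢ univ] ((t, 0) : ℝ × ℝ),
      γ p.1 ∈ (chartAt E x₀).source ∧ Q p ∈ L.coordDomain x₀ := by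
    refine Filter.Eventually.and ?_ (hQc ((L.isOpen_coordDomain x₀).mem_nhds hQ0))
    have c1 : ContinuousWithinAt (fun p : ℝ × ℝ => γ p.1) (s ×ˢ univ) (t, 0) :=
      (hγ t ht).continuousWithinAt.comp (f := fun p : ℝ × ℝ => p.1) (x := (t, (0 : ℝ)))
        continuous_fst.continuousWithinAt fun p hp => hp.1
    exact c1.eventually_mem_source hx
  obtain ⟨ε, hε, hb⟩ := Metric.mem_nhdsWithin_iff.1 hev
  set T := s ∩ Ioo (t - ε) (t + ε) with hTdef
  obtain ⟨hTc, hTi⟩ := convex_inter_Ioo_interior_nonempty hs hsi ht hε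
  have hT : UniqueDiffOn ℝ T := uniqueDiffOn_convex hTc hTi
  have hTs : T ⊆ s := inter_subset_left
  have hTn : ∀ {τ}, τ ∈ T → T ∈ 𝓝[s] τ := fun hτ => inter_Ioo_mem_nhdsWithin hτ
  have hb' : ∀ τ ∈ T, ∀ σ ∈ Ioo (-ε) ε,
      γ τ ∈ (chartAt E x₀).source ∧ Q (τ, σ) ∈ L.coordDomain x₀ := by
    intro τ hτ σ hσ
    refine @hb (τ, σ) ⟨?_, hτ.1, mem_univ _⟩
    rw [← ball_prod_same, Real.ball_eq_Ioo, Real.ball_eq_Ioo]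
    exact ⟨hτ.2, by simpa using hσ⟩
  have h0S : (0 : ℝ) ∈ Ioo (-ε) ε := ⟨by linarith, hε⟩
  have comp : ∀ {f : ℝ → E} {p : ℝ × ℝ}, p ∈ T ×ˢ Ioo (-ε) ε → ContDiffWithinAt ℝ ∞ f s p.1 →
      ContDiffWithinAt ℝ ∞ (fun p : ℝ × ℝ => f p.1) (T ×ˢ Ioo (-ε) ε) p := fun {f p} _ hf =>
    hf.comp (f := fun p : ℝ × ℝ => p.1) p contDiffWithinAt_fst fun p hp => hp.1.1
  have hXs : ∀ p ∈ T ×ˢ Ioo (-ε) ε, ContDiffWithinAt ℝ ∞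
      (fun p : ℝ × ℝ => x p.1 + p.2 • j p.1) (T ×ˢ Ioo (-ε) ε) p := fun p hp =>
    have h1 := (hb' p.1 hp.1 p.2 hp.2).1
    (comp hp (xs p.1 hp.1.1 h1)).add (contDiffWithinAt_snd.smul (comp hp (js p.1 hp.1.1 h1)))
  -- The base point is taken from the tangent vector with components `z`, so that this vector is a
  -- value of the extended field over `Λ` by its very type.
  set Λ : ℝ → ℝ → M := fun τ σ =>
    (tangentCoordSymm (E := E) x₀ (x τ + σ • j τ, z τ)).1 with hΛdef
  have hΛs : ContMDiffOn 𝓘(ℝ, ℝ × ℝ) 𝓘(ℝ, E) ∞ (fun q : ℝ × ℝ => Λ q.1 q.2)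
      (T ×ˢ Ioo (-ε) ε) := fun p hp =>
    (hXs p hp).contMDiffWithinAt_extChartAt_symm (hb' p.1 hp.1 p.2 hp.2).2.1
  have hΛx : ∀ τ ∈ T, ∀ σ ∈ Ioo (-ε) ε, Λ τ σ ∈ (chartAt E x₀).source := fun τ hτ σ hσ =>
    tangentCoordSymm_mem (hb' τ hτ σ hσ).2.1
  have hΛφ : ∀ τ ∈ T, ∀ σ ∈ Ioo (-ε) ε, mapCoord E x₀ Λ (τ, σ) = x τ + σ • j τ :=
    fun τ hτ σ hσ => (extChartAt 𝓘(ℝ, E) x₀).right_inv (hb' τ hτ σ hσ).2.1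
  have hbase : ∀ τ ∈ T, Λ τ 0 = γ τ := fun τ hτ => by
    have h1 : Λ τ 0 = (extChartAt 𝓘(ℝ, E) x₀).symm (x τ + (0 : ℝ) • j τ) := rfl
    rw [h1, zero_smul, add_zero]
    exact (extChartAt 𝓘(ℝ, E) x₀).left_inv
      (by rw [extChartAt_source]; exact (hb' τ hτ 0 h0S).1)
  refine ⟨ε, hε, Λ, fun τ σ => (tangentCoordSymm (E := E) x₀ (x τ + σ • j τ, z τ)).2, hΛs, ?_,
    hbase, ?_, ?_, ?_⟩
  · intro σ hσ τ hτ
    have h1 := tangentCoord_longVelocity (p := (τ, σ)) hT ⟨hτ, hσ⟩ hΛs (hΛx τ hτ σ hσ)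
    have h2 : partialFst T (mapCoord E x₀ Λ) (τ, σ)
        = derivWithin x s τ + σ • derivWithin j s τ := by
      have hxτ := (hb' τ hτ σ hσ).1
      have d1 := (((xs τ hτ.1 hxτ).differentiableWithinAt (by simp)).hasDerivWithinAt.add
        (((js τ hτ.1 hxτ).differentiableWithinAt (by simp)).hasDerivWithinAt.const_smul σ)).mono hTs
      exact (d1.congr (fun τ' hτ' => hΛφ τ' hτ' σ hσ) (hΛφ τ hτ σ hσ)).derivWithin (hT τ hτ)
    rw [h2, hΛφ τ hτ σ hσ] at h1
    have h3 := tangentCoordSymm_tangentCoord (x₀ := x₀)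
      (z := (⟨Λ τ σ, longVelocity Λ T τ σ⟩ : TangentBundle 𝓘(ℝ, E) M)) (hΛx τ hτ σ hσ)
    change (⟨Λ τ σ, longVelocity Λ T τ σ⟩ : TangentBundle 𝓘(ℝ, E) M) ∈ L.domain
    rw [← h3, h1]
    exact (hb' τ hτ σ hσ).2.2
  · intro τ hτ
    have h1 := tangentCoord_transVelocity (p := (τ, 0)) isOpen_Ioo.uniqueDiffOn ⟨hτ, h0S⟩ hΛs
      (hΛx τ hτ 0 h0S)
    have h2 : partialSnd (Ioo (-ε) ε) (mapCoord E x₀ Λ) (τ, 0) = j τ := by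
      have d1 : HasDerivWithinAt (fun σ : ℝ => x τ + σ • j τ) ((1 : ℝ) • j τ) (Ioo (-ε) ε) 0 :=
        ((hasDerivWithinAt_id (0 : ℝ) _).smul_const (j τ)).const_add (x τ)
      rw [one_smul] at d1
      exact (d1.congr (fun σ hσ => hΛφ τ hτ σ hσ) (hΛφ τ hτ 0 h0S)).derivWithin
        (isOpen_Ioo.uniqueDiffOn 0 h0S)
    rw [h2, hΛφ τ hτ 0 h0S, zero_smul, add_zero] at h1
    exact tangentCoord_injOn (z := ⟨Λ τ 0, transVelocity Λ (Ioo (-ε) ε) τ 0⟩)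
      (z' := ⟨γ τ, J τ⟩) (hΛx τ hτ 0 h0S) (hb' τ hτ 0 h0S).1 h1
  · exact fun p hp => ((hXs p hp).prodMk
      (comp hp (zs p.1 hp.1.1 (hb' p.1 hp.1 p.2 hp.2).1))).contMDiffWithinAt_tangentCoordSymm
      (hb' p.1 hp.1 p.2 hp.2).2.1
  · intro τ hτ
    change tangentCoordSymm (E := E) x₀ (x τ + (0 : ℝ) • j τ, z τ) = _
    rw [zero_smul, add_zero]
    exact tangentCoordSymm_tangentCoord (z := (⟨γ τ, Z τ⟩ : TangentBundle 𝓘(ℝ, E) M))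
      (hb' τ hτ 0 h0S).1

/-- The curvature along a curve in coordinates. -/
theorem alongCoord_curvatureAlong {γ : ℝ → M} {s : Set ℝ} (hs : Convex ℝ s)
    (hsi : (interior s).Nonempty) (hγ : ContMDiffOn 𝓘(ℝ, ℝ) 𝓘(ℝ, E) ∞ γ s)
    (hA : L.IsAdmissible γ s)
    {J Z : ∀ t, TangentSpace 𝓘(ℝ, E) (γ t)} (hJ : IsSmoothFieldAlong γ s J)
    (hZ : IsSmoothFieldAlong γ s Z) {t : ℝ} (ht : t ∈ s)
    {x₀ : M} (hx : γ t ∈ (chartAt E x₀).source) :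
    alongCoord x₀ (L.curvatureAlong γ s J Z) t =
      coordCurvature (L.christoffelL x₀) (curveCoord E x₀ γ t, derivWithin (curveCoord E x₀ γ) s t)
        (derivWithin (derivWithin (curveCoord E x₀ γ) s) s t) (alongCoord x₀ J t)
        (derivWithin (alongCoord x₀ J) s t) (alongCoord x₀ Z t) := by
  have hex : ∃ r : TangentSpace 𝓘(ℝ, E) (γ t),
    ∃ ε : ℝ, 0 < ε ∧ ∃ (Λ : ℝ → ℝ → M) (Z' : ∀ t s, TangentSpace 𝓘(ℝ, E) (Λ t s)),
      L.IsVariation γ (s ∩ Ioo (t - ε) (t + ε)) (Ioo (-ε) ε) J Z Λ Z' ∧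
      (⟨Λ t 0, L.variationCurvature Λ (s ∩ Ioo (t - ε) (t + ε)) (Ioo (-ε) ε) Z' t 0⟩ :
        TangentBundle 𝓘(ℝ, E) M) = ⟨γ t, r⟩ := by
    obtain ⟨ε, hε, Λ, Z', h⟩ := exists_isVariation hs hsi hγ hA hJ hZ ht
    have hb := h.base t ⟨ht, by simp [hε]⟩
    have cast : ∀ (z : TangentBundle 𝓘(ℝ, E) M) (x : M), z.1 = x →
        ∃ r : TangentSpace 𝓘(ℝ, E) x, z = ⟨x, r⟩ := by
      rintro z _ rfl
      exact ⟨z.2, rfl⟩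
    obtain ⟨r, hr⟩ := cast (⟨Λ t 0, L.variationCurvature Λ (s ∩ Ioo (t - ε) (t + ε))
      (Ioo (-ε) ε) Z' t 0⟩ : TangentBundle 𝓘(ℝ, E) M) (γ t) hb
    exact ⟨r, ε, hε, Λ, Z', h, hr⟩
  -- The chosen value comes from some unknown variation, but all variations give the same coordinate
  -- expression.
  obtain ⟨ε, hε, Λ, Z', h, hr⟩ := Classical.epsilon_spec hex
  rw [← h.tangentCoord_variationCurvature hs hsi ht hε hγ hx]
  exact (congrArg (fun z : TangentBundle 𝓘(ℝ, E) M => (tangentCoord x₀ z).2) hr).symm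

end PseudoFinslerMetric

end CurvatureAlongCurves

/-! ### The Jacobi equation as the linearised spray equation. -/

section JacobiEquation

variable {E : Type*} [NormedAddCommGroup E] [NormedSpace ℝ E]
  {M : Type*} [TopologicalSpace M] [ChartedSpace E M] [IsManifold 𝓘(ℝ, E) ∞ M]

theorem IsSmoothFieldAlong.contDiffWithinAt_alongCoord {γ : ℝ → M} {s : Set ℝ}
    {X : ∀ t, TangentSpace 𝓘(ℝ, E) (γ t)} (hX : IsSmoothFieldAlong γ s X) {t : ℝ} (ht : t ∈ s)
    {x₀ : M} (hx : γ t ∈ (chartAt E x₀).source) :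
    ContDiffWithinAt ℝ ∞ (alongCoord x₀ X) s t :=
  (ContMDiffWithinAt.contDiffWithinAt_tangentCoord (hX t ht) hx).snd

theorem isSmoothFieldAlong_velocity {γ : ℝ → M} {s : Set ℝ} (hs : UniqueDiffOn ℝ s)
    (hγ : ContMDiffOn 𝓘(ℝ, ℝ) 𝓘(ℝ, E) ∞ γ s) :
    IsSmoothFieldAlong (E := E) γ s (velocity γ s) := by
  intro t ht
  have h := contDiffWithinAt_velocityLift hγ hs ht (mem_chart_source E (γ t))
  refine (h.contMDiffWithinAt_tangentCoordSymm (x₀ := γ t)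
    ((extChartAt 𝓘(ℝ, E) (γ t)).map_source (mem_extChartAt_source (γ t)))).congr_of_eventuallyEq_of_mem
    ?_ ht
  filter_upwards [(hγ t ht).continuousWithinAt.eventually_mem_source (mem_chart_source E (γ t))]
    with τ hτ
  exact (tangentCoordSymm_tangentCoord (z := velocityLift γ s τ) hτ).symm

theorem hasDerivWithinAt_covariantDerivative_coord {Γ : E × E → E →L[ℝ] E →L[ℝ] E}
    {x x' j j' : ℝ → E} {a b : E} {s : Set ℝ} {t : ℝ} (hΓ : DifferentiableAt ℝ Γ (x t, x' t))
    (dx : HasDerivWithinAt x (x' t) s t) (dx' : HasDerivWithinAt x' a s t)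
    (dj : HasDerivWithinAt j (j' t) s t) (dj' : HasDerivWithinAt j' b s t) :
    HasDerivWithinAt (fun τ => j' τ + Γ (x τ, x' τ) (j τ) (x' τ))
      (b + (fderiv ℝ Γ (x t, x' t) (x' t, a) (j t) (x' t) + Γ (x t, x' t) (j' t) (x' t)
        + Γ (x t, x' t) (j t) a)) s t := by
  have h1 : HasDerivWithinAt (fun τ => Γ (x τ, x' τ)) (fderiv ℝ Γ (x t, x' t) (x' t, a)) s t :=
    hΓ.hasFDerivAt.comp_hasDerivWithinAt t (dx.prodMk dx')
  have h2 := (h1.clm_apply dj).clm_apply dx'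
  rw [add_apply] at h2
  exact dj'.add h2

/-- The acceleration is the geodesic one, `-Γ(u, u)`. By symmetry of `Γ`, the derivative of `Γ`
along the geodesic and all nested `Γ` terms occur on both sides; what is left is the derivative of
`-Γ(y, y)` in the direction `(j, j')`. -/
theorem secondCovariantDerivative_eq_coordCurvature_iff {Γ : E × E → E →L[ℝ] E →L[ℝ] E}
    {x u j j' b : E} (hΓ : ∀ X Y, Γ (x, u) X Y = Γ (x, u) Y X)
    (hΓ' : ∀ ξ X Y, fderiv ℝ Γ (x, u) ξ X Y = fderiv ℝ Γ (x, u) ξ Y X) :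
    b + (fderiv ℝ Γ (x, u) (u, -Γ (x, u) u u) j u + Γ (x, u) j' u + Γ (x, u) j (-Γ (x, u) u u))
        + Γ (x, u) (j' + Γ (x, u) j u) u
      = coordCurvature Γ (x, u) (-Γ (x, u) u u) j j' u ↔
    b = -(fderiv ℝ Γ (x, u) (j, j') u u + (2 : ℝ) • Γ (x, u) j' u) := by
  rw [← sub_eq_zero, ← sub_eq_zero (a := b), coordCurvature]
  simp only [map_neg, map_add, add_apply, two_smul]
  rw [hΓ' _ j, hΓ j u, hΓ j (Γ (x, u) u u)]
  exact iff_of_eq (congrArg (· = 0) (by abel))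

namespace PseudoFinslerMetric

variable [FiniteDimensional ℝ E] (L : PseudoFinslerMetric E M)

theorem christoffelL_symm {x₀ : M} {q : E × E} (hq : q ∈ L.coordDomain x₀) (X Y : E) :
    L.christoffelL x₀ q X Y = L.christoffelL x₀ q Y X := by
  rw [christoffelL_apply, christoffelL_apply, L.christoffel_symm hq]

theorem differentiableAt_christoffelL {x₀ : M} {q : E × E} (hq : q ∈ L.coordDomain x₀) :
    DifferentiableAt ℝ (L.christoffelL x₀) q :=
  ((L.contDiffOn_christoffelL x₀).contDiffAt
    ((L.isOpen_coordDomain x₀).mem_nhds hq)).differentiableAt (by simp)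

theorem fderiv_christoffelL_symm {x₀ : M} {q : E × E} (hq : q ∈ L.coordDomain x₀) (ξ : E × E)
    (X Y : E) : fderiv ℝ (L.christoffelL x₀) q ξ X Y = fderiv ℝ (L.christoffelL x₀) q ξ Y X :=
  fderiv_clm_symm (L.differentiableAt_christoffelL hq)
    (by filter_upwards [(L.isOpen_coordDomain x₀).mem_nhds hq] with q' hq'
          using L.christoffelL_symm hq') ξ X Y

theorem fderiv_sprayField {x₀ : M} {q : E × E} (hq : q ∈ L.coordDomain x₀) (ξ : E × E) :
    fderiv ℝ (L.sprayField x₀) q ξ = (ξ.2, -(fderiv ℝ (L.christoffelL x₀) q ξ q.2 q.2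
      + (2 : ℝ) • L.christoffelL x₀ q ξ.2 q.2)) := by
  have hΓ := (L.differentiableAt_christoffelL hq).hasFDerivAt
  have h2 : HasFDerivAt (fun q : E × E => q.2) (ContinuousLinearMap.snd ℝ E E) q := hasFDerivAt_snd
  have h : HasFDerivAt (L.sprayField x₀) _ q :=
    h2.prodMk (((hΓ.clm_apply h2).clm_apply h2).neg)
  rw [h.fderiv]
  refine Prod.ext rfl ?_
  simp [L.christoffelL_symm hq q.2 ξ.2, two_smul]
  abel

variable {L}

theorem alongCoord_covDerivAlong {γ : ℝ → M} {s : Set ℝ} (hs : UniqueDiffOn ℝ s)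
    (hγ : ContMDiffOn 𝓘(ℝ, ℝ) 𝓘(ℝ, E) ∞ γ s) (hA : L.IsAdmissible γ s)
    {X : ∀ t, TangentSpace 𝓘(ℝ, E) (γ t)} {t : ℝ} (ht : t ∈ s)
    {x₀ : M} (hx : γ t ∈ (chartAt E x₀).source)
    (hX : DifferentiableWithinAt ℝ (alongCoord x₀ X) s t) :
    alongCoord x₀ (L.covDerivAlong γ s X) t = derivWithin (alongCoord x₀ X) s t
      + L.christoffelL x₀ (curveCoord E x₀ γ t, derivWithin (curveCoord E x₀ γ) s t)
          (alongCoord x₀ X t) (derivWithin (curveCoord E x₀ γ) s t) := by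
  have h1 := L.tangentCoord_covDeriv (W := velocity γ s) ht (hs t ht)
    (hγ t ht).continuousWithinAt hx (hA t ht)
    (((hγ t ht).contDiffWithinAt_extChartAt le_rfl hx).differentiableWithinAt (by simp)) hX
  have h2 := tangentCoord_velocityLift ((hγ t ht).mdifferentiableWithinAt (by simp)) (hs t ht) hx
  rw [velocityLift] at h2
  rw [h2] at h1
  exact h1

/-- The Jacobi equation is the linearisation of the geodesic equation. -/
theorem IsGeodesic.jacobi_equation_iff {γ : ℝ → M} {s : Set ℝ} (hg : L.IsGeodesic γ s)
    (hs : Convex ℝ s) (hsi : (interior s).Nonempty) {J : ∀ t, TangentSpace 𝓘(ℝ, E) (γ t)}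
    (hJ : IsSmoothFieldAlong γ s J) {t : ℝ} (ht : t ∈ s)
    {x₀ : M} (hx : γ t ∈ (chartAt E x₀).source) :
    L.covDerivAlong γ s (L.covDerivAlong γ s J) t = L.curvatureAlong γ s J (velocity γ s) t ↔
      HasDerivWithinAt (fun τ => (alongCoord x₀ J τ, derivWithin (alongCoord x₀ J) s τ))
        (fderiv ℝ (L.sprayField x₀) (tangentCoord x₀ (velocityLift γ s t))
          (alongCoord x₀ J t, derivWithin (alongCoord x₀ J) s t)) s t := by
  have hsu : UniqueDiffOn ℝ s := uniqueDiffOn_convex hs hsi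
  have hγ := hg.contMDiffOn
  have hut := hsu t ht
  set x := curveCoord E x₀ γ with hxdef
  set j := alongCoord x₀ J with hjdef
  have hq : tangentCoord x₀ (velocityLift γ s t) = (x t, derivWithin x s t) :=
    tangentCoord_velocityLift (hg.mdifferentiableWithinAt ht) hut hx
  have hqA : (x t, derivWithin x s t) ∈ L.coordDomain x₀ := by
    rw [← hq]; exact hg.mem_coordDomain ht hx
  have hxs : ContDiffWithinAt ℝ ∞ x s t := (hγ t ht).contDiffWithinAt_extChartAt le_rfl hx
  have hjs : ContDiffWithinAt ℝ ∞ j s t := hJ.contDiffWithinAt_alongCoord ht hx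
  have dx : HasDerivWithinAt x (derivWithin x s t) s t :=
    (hxs.differentiableWithinAt (by simp)).hasDerivWithinAt
  have dj : HasDerivWithinAt j (derivWithin j s t) s t :=
    (hjs.differentiableWithinAt (by simp)).hasDerivWithinAt
  have dj' : HasDerivWithinAt (derivWithin j s) (derivWithin (derivWithin j s) s t) s t :=
    ((hjs.derivWithin (m := 1) hsu (by norm_cast) ht).differentiableWithinAt
      (by simp)).hasDerivWithinAt
  have hev := eventually_tangentCoord_velocityLift hγ hsu ht hx
  -- The geodesic equation eliminates the acceleration from both the second covariant derivative and
  -- the curvature.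
  have dx' : HasDerivWithinAt (derivWithin x s)
      (-L.christoffelL x₀ (x t, derivWithin x s t) (derivWithin x s t) (derivWithin x s t)) s t := by
    have h := hg.hasDerivWithinAt hsu ht hx
    rw [hq] at h
    have h2 : HasDerivWithinAt (fun τ => (x τ, derivWithin x s τ))
        (L.sprayField x₀ (x t, derivWithin x s t)) s t :=
      h.congr_of_eventuallyEq_of_mem hev.symm ht
    exact h2.snd
  have e1 : alongCoord x₀ (L.covDerivAlong γ s J) =ᶠ[𝓝[s] t] fun τ => derivWithin j s τ
      + L.christoffelL x₀ (x τ, derivWithin x s τ) (j τ) (derivWithin x s τ) := by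
    filter_upwards [(hγ t ht).continuousWithinAt.eventually_mem_source hx, self_mem_nhdsWithin]
      with τ h1 h2
    exact alongCoord_covDerivAlong hsu hγ hg.admissible h2 h1
      ((hJ.contDiffWithinAt_alongCoord h2 h1).differentiableWithinAt (by simp))
  have dD' := (hasDerivWithinAt_covariantDerivative_coord (L.differentiableAt_christoffelL hqA)
    dx dx' dj dj').congr_of_eventuallyEq_of_mem e1 ht
  have e2 := alongCoord_covDerivAlong hsu hγ hg.admissible ht hx dD'.differentiableWithinAt
  rw [dD'.derivWithin hut, e1.eq_of_nhdsWithin ht] at e2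
  have e3 := alongCoord_curvatureAlong hs hsi hγ hg.admissible hJ
    (isSmoothFieldAlong_velocity hsu hγ) ht hx
  have e4 : alongCoord x₀ (velocity γ s) t = derivWithin x s t := congrArg Prod.snd hq
  rw [e4, dx'.derivWithin hut] at e3
  have inj : L.covDerivAlong γ s (L.covDerivAlong γ s J) t = L.curvatureAlong γ s J (velocity γ s) t
      ↔ alongCoord x₀ (L.covDerivAlong γ s (L.covDerivAlong γ s J)) t
        = alongCoord x₀ (L.curvatureAlong γ s J (velocity γ s)) t :=
    ⟨fun h => congrArg (fun v => (tangentCoord x₀ (⟨γ t, v⟩ : TangentBundle 𝓘(ℝ, E) M)).2) h,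
      fun h => tangentCoord_snd_injective hx h⟩
  rw [inj, e2, e3, hq, L.fderiv_sprayField hqA, secondCovariantDerivative_eq_coordCurvature_iff
    (L.christoffelL_symm hqA) (L.fderiv_christoffelL_symm hqA)]
  constructor
  · intro h
    rw [← h]
    exact dj.prodMk dj'
  · intro h
    have h2 : HasDerivWithinAt (fun τ => derivWithin j s τ) _ s t := h.snd
    exact h2.derivWithin hut

end PseudoFinslerMetric

end JacobiEquation

/-! ### Uniqueness and gluing of geodesics; the maximal geodesic. -/

section GeodesicUniqueness

variable {E : Type*} [NormedAddCommGroup E] [NormedSpace ℝ E]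
  {M : Type*} [TopologicalSpace M] [ChartedSpace E M] [IsManifold 𝓘(ℝ, E) ∞ M]

namespace PseudoFinslerMetric

variable [FiniteDimensional ℝ E] {L : PseudoFinslerMetric E M}

/-- The closed half of the uniqueness argument. The base points at `t` agree as limits in the
Hausdorff space `M`; after that the velocities agree as limits in one chart. -/
theorem IsGeodesic.velocityLift_eq_of_eqOn_left [T2Space M] {γ₁ γ₂ : ℝ → M} {a b t : ℝ}
    (h₁ : L.IsGeodesic γ₁ (Ico a b)) (h₂ : L.IsGeodesic γ₂ (Ico a b)) (hat : a < t) (htb : t < b)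
    (h : ∀ τ ∈ Ico a t, velocityLift (E := E) γ₁ (Ico a b) τ = velocityLift γ₂ (Ico a b) τ) :
    velocityLift (E := E) γ₁ (Ico a b) t = velocityLift γ₂ (Ico a b) t := by
  have ht : t ∈ Ico a b := ⟨hat.le, htb⟩
  have hne : (𝓝[Ico a t] t).NeBot := by
    rw [nhdsWithin_Ico_eq_nhdsLT hat]; infer_instance
  have hle : 𝓝[Ico a t] t ≤ 𝓝[Ico a b] t := nhdsWithin_mono t (Ico_subset_Ico_right htb.le)
  have e : γ₁ t = γ₂ t := by
    refine tendsto_nhds_unique_of_eventuallyEq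
      ((h₁.contMDiffOn t ht).continuousWithinAt.tendsto.mono_left hle)
      ((h₂.contMDiffOn t ht).continuousWithinAt.tendsto.mono_left hle) ?_
    filter_upwards [self_mem_nhdsWithin] with τ hτ
      using congrArg Bundle.TotalSpace.proj (h τ hτ)
  have hx : γ₁ t ∈ (chartAt E (γ₁ t)).source := mem_chart_source E _
  have hx' : γ₂ t ∈ (chartAt E (γ₁ t)).source := by rw [← e]; exact hx
  refine tangentCoord_injOn (x₀ := γ₁ t) hx hx' ?_
  refine tendsto_nhds_unique_of_eventuallyEq
    ((contDiffWithinAt_velocityLift h₁.contMDiffOn (uniqueDiffOn_Ico a b) ht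
      hx).continuousWithinAt.tendsto.mono_left hle)
    ((contDiffWithinAt_velocityLift h₂.contMDiffOn (uniqueDiffOn_Ico a b) ht
      hx').continuousWithinAt.tendsto.mono_left hle) ?_
  filter_upwards [self_mem_nhdsWithin] with τ hτ using congrArg _ (h τ hτ)

/-- The open half: while both curves stay in a common chart, their lifts solve the same spray
equation. -/
theorem IsGeodesic.eqOn_right {γ₁ γ₂ : ℝ → M} {a b t : ℝ}
    (h₁ : L.IsGeodesic γ₁ (Ico a b)) (h₂ : L.IsGeodesic γ₂ (Ico a b)) (ht : t ∈ Ico a b)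
    (h : velocityLift (E := E) γ₁ (Ico a b) t = velocityLift γ₂ (Ico a b) t) :
    ∃ ε > 0, ∀ τ ∈ Ico t (t + ε),
      velocityLift (E := E) γ₁ (Ico a b) τ = velocityLift γ₂ (Ico a b) τ := by
  have e : γ₁ t = γ₂ t := congrArg Bundle.TotalSpace.proj h
  set x₀ := γ₁ t with hx₀
  have hx : γ₁ t ∈ (chartAt E x₀).source := mem_chart_source E _
  have hx' : γ₂ t ∈ (chartAt E x₀).source := by rw [← e]; exact hx
  have hev := ((h₁.contMDiffOn t ht).continuousWithinAt.eventually_mem_source hx).and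
    ((h₂.contMDiffOn t ht).continuousWithinAt.eventually_mem_source hx')
  obtain ⟨δ, hδ, hb⟩ := Metric.mem_nhdsWithin_iff.1 hev
  have hm : t < min b (t + δ) := lt_min ht.2 (by linarith)
  have hsub : Ico t (min b (t + δ)) ⊆ Ico a b := fun τ hτ =>
    ⟨ht.1.trans hτ.1, hτ.2.trans_le (min_le_left _ _)⟩
  have hs : ∀ τ ∈ Ico t (min b (t + δ)),
      γ₁ τ ∈ (chartAt E x₀).source ∧ γ₂ τ ∈ (chartAt E x₀).source := fun τ hτ => by
    refine hb ⟨?_, hsub hτ⟩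
    rw [Metric.mem_ball, Real.dist_eq, abs_lt]
    constructor <;> linarith [hτ.1, hτ.2.trans_le (min_le_right _ _)]
  obtain ⟨ε, hε, H⟩ := ODE_eq_of_eq_forward (f := L.sprayField x₀)
    (c₁ := fun τ => tangentCoord x₀ (velocityLift γ₁ (Ico a b) τ))
    (c₂ := fun τ => tangentCoord x₀ (velocityLift γ₂ (Ico a b) τ)) hm
    ((L.contDiffAt_sprayField (h₁.mem_coordDomain ht hx)).of_le (by norm_cast))
    (fun τ hτ => (h₁.hasDerivWithinAt (uniqueDiffOn_Ico a b) (hsub hτ) (hs τ hτ).1).mono hsub)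
    (fun τ hτ => (h₂.hasDerivWithinAt (uniqueDiffOn_Ico a b) (hsub hτ) (hs τ hτ).2).mono hsub)
    (congrArg _ h)
  refine ⟨min ε (min b (t + δ) - t), lt_min hε (by linarith), fun τ hτ => ?_⟩
  have h3 : τ ∈ Ico t (min b (t + δ)) := ⟨hτ.1, by linarith [hτ.2, min_le_right ε (min b (t + δ) - t)]⟩
  have h4 : τ ∈ Ico t (t + ε) := ⟨hτ.1, by linarith [hτ.2, min_le_left ε (min b (t + δ) - t)]⟩
  exact tangentCoord_injOn (hs τ h3).1 (hs τ h3).2 (H τ h4)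

/-- Uniqueness of geodesics with given initial velocity. -/
theorem IsGeodesic.velocityLift_eq [T2Space M] {γ₁ γ₂ : ℝ → M} {b : ℝ}
    (h₁ : L.IsGeodesic γ₁ (Ico 0 b)) (h₂ : L.IsGeodesic γ₂ (Ico 0 b))
    (h : velocityLift (E := E) γ₁ (Ico 0 b) 0 = velocityLift γ₂ (Ico 0 b) 0) :
    ∀ t ∈ Ico 0 b, velocityLift (E := E) γ₁ (Ico 0 b) t = velocityLift γ₂ (Ico 0 b) t := by
  intro t₁ ht₁
  refine forall_mem_Icc_of_step (b := t₁)
    (P := fun t => velocityLift (E := E) γ₁ (Ico 0 b) t = velocityLift γ₂ (Ico 0 b) t) (fun t ht hP => ?_) t₁ ⟨ht₁.1, le_rfl⟩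
  have htb : t < b := ht.2.trans_lt ht₁.2
  have e : velocityLift (E := E) γ₁ (Ico 0 b) t = velocityLift γ₂ (Ico 0 b) t := by
    rcases ht.1.eq_or_lt with rfl | h0
    · exact h
    · exact h₁.velocityLift_eq_of_eqOn_left h₂ h0 htb hP
  obtain ⟨ε, hε, H⟩ := h₁.eqOn_right h₂ ⟨ht.1, htb⟩ e
  exact ⟨ε, hε, fun τ hτ => H τ hτ.1⟩

/-- Concatenation of geodesics with matching velocities. -/
theorem IsGeodesic.glue {γ₁ γ₂ : ℝ → M} {s b₁ b₂ : ℝ} (hs : 0 ≤ s) (hsb₁ : s < b₁) (hsb₂ : s < b₂)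
    (h₁ : L.IsGeodesic γ₁ (Ico 0 b₁)) (h₂ : L.IsGeodesic γ₂ (Ico s b₂))
    (h : velocityLift (E := E) γ₁ (Ico 0 b₁) s = velocityLift γ₂ (Ico s b₂) s) :
    ∃ γ : ℝ → M, L.IsGeodesic γ (Ico 0 b₂) ∧
      velocityLift (E := E) γ (Ico 0 b₂) 0 = velocityLift γ₁ (Ico 0 b₁) 0 ∧
      ∀ τ ∈ Ico s b₂, velocityLift (E := E) γ (Ico 0 b₂) τ = velocityLift γ₂ (Ico s b₂) τ := by
  classical
  set b := min b₁ b₂ with hb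
  have hsb : s < b := lt_min hsb₁ hsb₂
  have hu := uniqueDiffOn_Ico
  have sub₁ : Ico s b ⊆ Ico 0 b₁ := fun τ hτ => ⟨hs.trans hτ.1, hτ.2.trans_le (min_le_left _ _)⟩
  have sub₂ : Ico s b ⊆ Ico s b₂ := Ico_subset_Ico_right (min_le_right _ _)
  have hss : s ∈ Ico s b := ⟨le_rfl, hsb⟩
  -- Equal velocities at `s` force agreement on `[s, s + δ)`, so the concatenation coincides with
  -- `γ₁` on both sides of `s` and there is no corner to examine.
  obtain ⟨δ, hδ, H⟩ := (h₁.mono (hu s b) (hu 0 b₁) sub₁).eqOn_right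
    (h₂.mono (hu s b) (hu s b₂) sub₂) hss (by
      rw [h₁.velocityLift_mono (hu s b) sub₁ hss, h₂.velocityLift_mono (hu s b) sub₂ hss, h])
  have H' : ∀ τ ∈ Ico s (s + δ), γ₁ τ = γ₂ τ := fun τ hτ =>
    congrArg Bundle.TotalSpace.proj (H τ hτ)
  set γ : ℝ → M := fun τ => if τ ≤ s then γ₁ τ else γ₂ τ with hγ
  have eL : ∀ τ < s + δ, γ τ = γ₁ τ := fun τ hτ => by
    by_cases hle : τ ≤ s
    · simp [hγ, hle]
    · simp only [hγ, hle, if_false]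
      exact (H' τ ⟨(not_le.1 hle).le, hτ⟩).symm
  have eR : ∀ τ, s < τ → γ τ = γ₂ τ := fun τ hτ => by simp [hγ, not_le.2 hτ]
  have mL : ∀ t ∈ Ico 0 b₂, t ≤ s → Ico 0 b₁ ∈ 𝓝[Ico 0 b₂] t ∧ γ =ᶠ[𝓝[Ico 0 b₂] t] γ₁ := by
    intro t ht hts
    constructor
    · filter_upwards [self_mem_nhdsWithin,
        mem_nhdsWithin_of_mem_nhds (Iio_mem_nhds (hts.trans_lt hsb₁))] with τ h1 h2 using ⟨h1.1, h2⟩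
    · filter_upwards [mem_nhdsWithin_of_mem_nhds (Iio_mem_nhds (show t < s + δ by linarith))]
        with τ hτ using eL τ hτ
  have mR : ∀ t ∈ Ico 0 b₂, s < t → Ico s b₂ ∈ 𝓝[Ico 0 b₂] t ∧ γ =ᶠ[𝓝[Ico 0 b₂] t] γ₂ := by
    intro t ht hts
    constructor
    · filter_upwards [self_mem_nhdsWithin, mem_nhdsWithin_of_mem_nhds (Ioi_mem_nhds hts)]
        with τ h1 h2 using ⟨le_of_lt h2, h1.2⟩
    · filter_upwards [mem_nhdsWithin_of_mem_nhds (Ioi_mem_nhds hts)] with τ hτ using eR τ hτ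
  have lL : ∀ t ∈ Ico 0 b₂, t ≤ s →
      velocityLift (E := E) γ (Ico 0 b₂) t = velocityLift γ₁ (Ico 0 b₁) t := fun t ht hts =>
    velocityLift_congr ht (hu _ _ t ht) (h₁.mdifferentiableWithinAt ⟨ht.1, hts.trans_lt hsb₁⟩)
      (mL t ht hts).1 (mL t ht hts).2
  refine ⟨γ, isGeodesic_of_locally (hu _ _) fun t ht => ?_, lL 0 ⟨le_rfl, hs.trans_lt hsb₂⟩ hs, ?_⟩
  · rcases le_or_gt t s with hts | hts
    · exact ⟨γ₁, Ico 0 b₁, h₁, hu _ _, mL t ht hts⟩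
    · exact ⟨γ₂, Ico s b₂, h₂, hu _ _, mR t ht hts⟩
  · intro τ hτ
    have hτ' : τ ∈ Ico 0 b₂ := ⟨hs.trans hτ.1, hτ.2⟩
    rcases hτ.1.eq_or_lt with rfl | hlt
    · rw [lL s hτ' le_rfl, h]
    · exact velocityLift_congr hτ' (hu _ _ τ hτ') (h₂.mdifferentiableWithinAt hτ)
        (mR τ hτ' hlt).1 (mR τ hτ' hlt).2

/-- The lift to the tangent bundle of the maximal geodesic with initial velocity `u`. -/
noncomputable def geodesicFlow (L : PseudoFinslerMetric E M) (p : M) (t : ℝ)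
    (u : TangentSpace 𝓘(ℝ, E) p) : TangentBundle 𝓘(ℝ, E) M :=
  velocityLift (L.geodesic p u) (Ici 0) t

theorem IsGeodesicFrom.velocityLift_zero {p : M} {u : TangentSpace 𝓘(ℝ, E) p} {γ : ℝ → M} {b : ℝ}
    (h : L.IsGeodesicFrom p u γ b) :
    velocityLift γ (Ico 0 b) 0 = (⟨p, u⟩ : TangentBundle 𝓘(ℝ, E) M) := h.2

theorem IsGeodesicFrom.mono {p : M} {u : TangentSpace 𝓘(ℝ, E) p} {γ : ℝ → M} {b b' : ℝ}
    (h : L.IsGeodesicFrom p u γ b) (hb' : 0 < b') (hbb : b' ≤ b) : L.IsGeodesicFrom p u γ b' := by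
  refine ⟨h.1.mono (uniqueDiffOn_Ico _ _) (uniqueDiffOn_Ico _ _) (Ico_subset_Ico_right hbb), ?_⟩
  rw [← h.velocityLift_zero]
  exact h.1.velocityLift_mono (uniqueDiffOn_Ico _ _) (Ico_subset_Ico_right hbb) ⟨le_rfl, hb'⟩

/-- The definition of `geodesic` may choose a different curve for each `t`; uniqueness makes all
choices agree on the common domain. -/
theorem IsGeodesicFrom.geodesic_eq [T2Space M] {p : M} {u : TangentSpace 𝓘(ℝ, E) p} {γ : ℝ → M}
    {b : ℝ} (h : L.IsGeodesicFrom p u γ b) {t : ℝ} (ht : t ∈ Ico 0 b) :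
    L.geodesic p u t = γ t := by
  have hex : ∃ γ : ℝ → M, ∃ b : ℝ, t ∈ Ico 0 b ∧ L.IsGeodesicFrom p u γ b := ⟨γ, b, ht, h⟩
  rw [geodesic, dif_pos hex]
  obtain ⟨b', ht', h'⟩ := hex.choose_spec
  have hb0 : 0 < min b b' := lt_min (ht.1.trans_lt ht.2) (ht.1.trans_lt ht'.2)
  have h1 := h'.mono hb0 (min_le_right _ _)
  have h2 := h.mono hb0 (min_le_left _ _)
  exact congrArg Bundle.TotalSpace.proj (h1.1.velocityLift_eq h2.1
    (h1.velocityLift_zero.trans h2.velocityLift_zero.symm) t ⟨ht.1, lt_min ht.2 ht'.2⟩)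

theorem IsGeodesicFrom.geodesicFlow_eq [T2Space M] {p : M} {u : TangentSpace 𝓘(ℝ, E) p}
    {γ : ℝ → M} {b : ℝ} (h : L.IsGeodesicFrom p u γ b) {t : ℝ} (ht : t ∈ Ico 0 b) :
    L.geodesicFlow p t u = velocityLift γ (Ico 0 b) t := by
  have hm : Ico 0 b ∈ 𝓝[Ici 0] t := by
    filter_upwards [self_mem_nhdsWithin, mem_nhdsWithin_of_mem_nhds (Iio_mem_nhds ht.2)]
      with τ h1 h2 using ⟨h1, h2⟩
  refine velocityLift_congr ht.1 (uniqueDiffOn_Ici 0 t ht.1) (h.1.mdifferentiableWithinAt ht) hm ?_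
  filter_upwards [hm] with τ hτ using h.geodesic_eq hτ

theorem geodesic_zero (L : PseudoFinslerMetric E M) (p : M) (u : TangentSpace 𝓘(ℝ, E) p) :
    L.geodesic p u 0 = p := by
  rw [geodesic]
  split_ifs with h
  · obtain ⟨b, -, hb⟩ := h.choose_spec
    exact congrArg Bundle.TotalSpace.proj hb.2
  · rfl

end PseudoFinslerMetric

end GeodesicUniqueness

/-! ### Differentiability of the geodesic flow in the initial velocity. -/

section GeodesicFlow

variable {E : Type*} [NormedAddCommGroup E] [NormedSpace ℝ E]
  {M : Type*} [TopologicalSpace M] [T2Space M] [ChartedSpace E M] [IsManifold 𝓘(ℝ, E) ∞ M]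

namespace PseudoFinslerMetric

variable [FiniteDimensional ℝ E] {L : PseudoFinslerMetric E M} {p : M}

theorem isGeodesic_of_integralCurve {x₀ : M} {c : ℝ → E × E} {s ε : ℝ}
    (hc : ∀ t ∈ Ioo (-ε) ε, HasDerivAt c (L.sprayField x₀ (c t)) t ∧ c t ∈ L.coordDomain x₀) :
    L.IsGeodesic (fun τ => (extChartAt 𝓘(ℝ, E) x₀).symm (c (τ - s)).1) (Ico s (s + ε)) ∧
      ∀ τ ∈ Ico s (s + ε), velocityLift (fun τ => (extChartAt 𝓘(ℝ, E) x₀).symm (c (τ - s)).1)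
        (Ico s (s + ε)) τ = (tangentCoordSymm x₀ (c (τ - s)) : TangentBundle 𝓘(ℝ, E) M) := by
  have hm : ∀ τ ∈ Ico s (s + ε), τ - s ∈ Ioo (-ε) ε := fun τ hτ =>
    ⟨by linarith [hτ.1, hτ.2], by linarith [hτ.2]⟩
  exact isGeodesic_of_hasDerivWithinAt (q := fun τ => c (τ - s)) (uniqueDiffOn_Ico _ _)
    (fun τ hτ => (hc _ (hm τ hτ)).2)
    (fun τ hτ => ((hc _ (hm τ hτ)).1.comp_sub_const τ s).hasDerivWithinAt)

/-- The length `ε` gained beyond `s` is that of the flow box and does not depend on `b`. This gives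
all nearby initial velocities a common time of existence. -/
theorem IsGeodesicFrom.extend {u : TangentSpace 𝓘(ℝ, E) p} {γ : ℝ → M} {b s ε : ℝ}
    (h : L.IsGeodesicFrom p u γ b) (hs : s ∈ Ico 0 b) (hε : 0 < ε) {x₀ : M}
    (hx : (L.geodesicFlow p s u).1 ∈ (chartAt E x₀).source) {c : ℝ → E × E}
    (hc : ∀ t ∈ Ioo (-ε) ε, HasDerivAt c (L.sprayField x₀ (c t)) t ∧ c t ∈ L.coordDomain x₀)
    (h0 : c 0 = tangentCoord x₀ (L.geodesicFlow p s u)) :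
    ∃ γ' : ℝ → M, L.IsGeodesicFrom p u γ' (s + ε) ∧
      ∀ τ ∈ Ico s (s + ε), L.geodesicFlow p τ u = tangentCoordSymm x₀ (c (τ - s)) := by
  obtain ⟨hg, hl⟩ := isGeodesic_of_integralCurve (s := s) hc
  obtain ⟨γ', h1, h2, h3⟩ := h.1.glue hs.1 hs.2 (by linarith) hg (by
    rw [hl s ⟨le_rfl, by linarith⟩, sub_self, h0, tangentCoordSymm_tangentCoord hx,
      h.geodesicFlow_eq hs])
  have hγ' : L.IsGeodesicFrom p u γ' (s + ε) := ⟨h1, h2.trans h.velocityLift_zero⟩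
  exact ⟨γ', hγ', fun τ hτ => by
    rw [hγ'.geodesicFlow_eq ⟨hs.1.trans hτ.1, hτ.2⟩, h3 τ hτ, hl τ hτ]⟩

/-- At time `t` the geodesic flow is defined near the initial velocity `v` and is differentiable
at `v`. -/
def IsRegularTime (L : PseudoFinslerMetric E M) (p : M) (v : TangentSpace 𝓘(ℝ, E) p) (t : ℝ) :
    Prop :=
  (∀ᶠ u in 𝓝 v, ∃ b > t, ∃ γ : ℝ → M, L.IsGeodesicFrom p u γ b) ∧
    MDifferentiableAt 𝓘(ℝ, E) 𝓘(ℝ, E).tangent (M := E) (L.geodesicFlow p t) v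

theorem mdifferentiableAt_totalSpace_mk (v : TangentSpace 𝓘(ℝ, E) p) :
    MDifferentiableAt 𝓘(ℝ, E) 𝓘(ℝ, E).tangent (M := E)
      (fun u => (⟨p, u⟩ : TangentBundle 𝓘(ℝ, E) M)) v := by
  have h : (fun u : E => (⟨p, u⟩ : TangentBundle 𝓘(ℝ, E) M))
      = fun u => tangentCoordSymm p (extChartAt 𝓘(ℝ, E) p p, u) := by
    funext u
    rw [← tangentCoordSymm_tangentCoord (x₀ := p) (z := (⟨p, u⟩ : TangentBundle 𝓘(ℝ, E) M))
      (mem_chart_source E p)]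
    exact congrArg _ (Prod.ext rfl (tangentCoord_self_snd p u))
  have hd : DifferentiableAt ℝ (fun u : E => (extChartAt 𝓘(ℝ, E) p p, u)) v :=
    (differentiableAt_const _).prodMk differentiableAt_id
  have h1 := hd.mdifferentiableAt_tangentCoordSymm (x₀ := p) (mem_extChartAt_target p)
  rw [← h] at h1
  exact h1

/-- Local existence of geodesics. -/
theorem isRegularTime_zero {v : TangentSpace 𝓘(ℝ, E) p}
    (hv : (⟨p, v⟩ : TangentBundle 𝓘(ℝ, E) M) ∈ L.domain) :
    L.IsRegularTime p v 0 ∧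
      ∀ᶠ u in 𝓝 v, L.geodesicFlow p 0 u = (⟨p, u⟩ : TangentBundle 𝓘(ℝ, E) M) := by
  have := FiniteDimensional.complete ℝ E
  have hx : p ∈ (chartAt E p).source := mem_chart_source E p
  have hq := L.tangentCoord_mem_coordDomain (x₀ := p)
    (z := (⟨p, v⟩ : TangentBundle 𝓘(ℝ, E) M)) hx hv
  obtain ⟨ε, hε, Φ, D, H⟩ := ((L.contDiffAt_sprayField hq).of_le
    (by norm_cast)).exists_local_flow_fderiv ((L.isOpen_coordDomain p).mem_nhds hq)
  have hc : ContinuousAt (fun u : E => tangentCoord p (⟨p, u⟩ : TangentBundle 𝓘(ℝ, E) M)) v :=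
    ((mdifferentiableAt_totalSpace_mk (p := p) v).differentiableAt_tangentCoord
      (x₀ := p) hx).continuousAt
  have hev : ∀ᶠ u in 𝓝 v, ∃ γ : ℝ → M, L.IsGeodesicFrom p u γ ε := by
    filter_upwards [hc (Metric.ball_mem_nhds _ hε)] with u hu
    obtain ⟨h0, hΦ, -, -⟩ := H _ hu
    obtain ⟨hg, hl⟩ := isGeodesic_of_integralCurve (s := 0) hΦ
    rw [zero_add] at hg hl
    refine ⟨_, hg, ?_⟩
    refine (hl 0 ⟨le_rfl, hε⟩).trans ?_
    rw [sub_self, h0]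
    exact tangentCoordSymm_tangentCoord (z := (⟨p, u⟩ : TangentBundle 𝓘(ℝ, E) M)) hx
  have hev' : ∀ᶠ u in 𝓝 v, L.geodesicFlow p 0 u = (⟨p, u⟩ : TangentBundle 𝓘(ℝ, E) M) := by
    filter_upwards [hev] with u hu
    obtain ⟨γ, hγ⟩ := hu
    rw [hγ.geodesicFlow_eq ⟨le_rfl, hε⟩, hγ.velocityLift_zero]
  refine ⟨⟨?_, (mdifferentiableAt_totalSpace_mk (p := p) v).congr_of_eventuallyEq hev'⟩, hev'⟩
  filter_upwards [hev] with u hu using ⟨ε, hε, hu⟩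

/-- The derivative of the geodesic flow with respect to the initial velocity, in the chart
at `x₀`. -/
noncomputable def flowDeriv (L : PseudoFinslerMetric E M) (p x₀ : M) (v : TangentSpace 𝓘(ℝ, E) p)
    (t : ℝ) : E →L[ℝ] E × E :=
  fderiv ℝ (fun u : E => tangentCoord x₀ (L.geodesicFlow p t u)) v

/-- A flow box centred at time `t₀` is entered slightly earlier, at a time `s` where regularity is
already known. For `t₀ = 0` there is no earlier time, and `s = 0` serves. -/
theorem exists_initialTime {v : TangentSpace 𝓘(ℝ, E) p} {γ : ℝ → M} {b t₀ ε : ℝ}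
    (h : L.IsGeodesicFrom p v γ b) (ht₀ : t₀ ∈ Ico 0 b) (hε : 0 < ε) {x₀ : M}
    (hx : γ t₀ ∈ (chartAt E x₀).source) :
    ∃ s ∈ Icc 0 t₀, (s = 0 ∨ s < t₀) ∧ Ico s (s + ε) ∈ 𝓝[Ici 0] t₀ ∧
      tangentCoord x₀ (L.geodesicFlow p s v)
        ∈ Metric.ball (tangentCoord x₀ (L.geodesicFlow p t₀ v)) ε ∧
      (L.geodesicFlow p s v).1 ∈ (chartAt E x₀).source := by
  rcases ht₀.1.eq_or_lt with rfl | h0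
  · refine ⟨0, ⟨le_rfl, le_rfl⟩, Or.inl rfl, ?_, Metric.mem_ball_self hε, ?_⟩
    · filter_upwards [self_mem_nhdsWithin, mem_nhdsWithin_of_mem_nhds (Iio_mem_nhds hε)]
        with τ h1 h2
      rw [zero_add]
      exact ⟨h1, h2⟩
    · rw [h.geodesicFlow_eq ht₀]
      exact hx
  have hne : (𝓝[Ico 0 t₀] t₀).NeBot := by
    rw [nhdsWithin_Ico_eq_nhdsLT h0]; infer_instance
  have hle : 𝓝[Ico 0 t₀] t₀ ≤ 𝓝[Ico 0 b] t₀ := nhdsWithin_mono t₀ (Ico_subset_Ico_right ht₀.2.le)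
  have h1 := hle ((contDiffWithinAt_velocityLift h.1.contMDiffOn (uniqueDiffOn_Ico 0 b) ht₀
      hx).continuousWithinAt (Metric.ball_mem_nhds _ hε))
  have h2 := hle ((h.1.contMDiffOn t₀ ht₀).continuousWithinAt.eventually_mem_source hx)
  have h3 : ∀ᶠ τ in 𝓝[Ico 0 t₀] t₀, t₀ - ε < τ :=
    mem_nhdsWithin_of_mem_nhds (Ioi_mem_nhds (by linarith))
  obtain ⟨s, ⟨⟨hs1, hs2⟩, hs3⟩, hs⟩ :=
    (((Filter.Eventually.and h1 h2).and h3).and self_mem_nhdsWithin).exists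
  have hsb : s ∈ Ico 0 b := ⟨hs.1, hs.2.trans ht₀.2⟩
  refine ⟨s, ⟨hs.1, hs.2.le⟩, Or.inr hs.2, ?_, ?_, ?_⟩
  · exact mem_nhdsWithin_of_mem_nhds
      (Filter.mem_of_superset (Ioo_mem_nhds hs.2 (by linarith)) Ioo_subset_Ico_self)
  · rw [h.geodesicFlow_eq hsb, h.geodesicFlow_eq ht₀]
    exact hs1
  · rw [h.geodesicFlow_eq hsb]
    exact hs2

/-- Near `t₀` the geodesic flow is the local flow run for time `τ - s` after the geodesic flow at
time `s`. The chain rule gives differentiability, and the operator `D` of the local flow carries the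
linearised equation. -/
theorem IsGeodesicFrom.exists_flowBox {v : TangentSpace 𝓘(ℝ, E) p} {γ : ℝ → M} {b t₀ : ℝ}
    (h : L.IsGeodesicFrom p v γ b) (ht₀ : t₀ ∈ Ico 0 b) (h0 : L.IsRegularTime p v 0)
    (hreg : ∀ s ∈ Ico 0 t₀, L.IsRegularTime p v s) {x₀ : M}
    (hx : γ t₀ ∈ (chartAt E x₀).source) :
    ∃ N ∈ 𝓝[Ici 0] t₀, ∀ t ∈ N, L.IsRegularTime p v t ∧
      HasDerivWithinAt (L.flowDeriv p x₀ v)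
        ((fderiv ℝ (L.sprayField x₀) (tangentCoord x₀ (L.geodesicFlow p t v))).comp
          (L.flowDeriv p x₀ v t)) N t := by
  have := FiniteDimensional.complete ℝ E
  have hq : tangentCoord x₀ (L.geodesicFlow p t₀ v) ∈ L.coordDomain x₀ := by
    rw [h.geodesicFlow_eq ht₀]
    exact h.1.mem_coordDomain ht₀ hx
  obtain ⟨ε, hε, Φ, D, H⟩ := ((L.contDiffAt_sprayField hq).of_le
    (by norm_cast)).exists_local_flow_fderiv ((L.isOpen_coordDomain x₀).mem_nhds hq)
  obtain ⟨s, hs, hs', hN, hb, hsx⟩ := exists_initialTime h ht₀ hε hx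
  have hsreg : L.IsRegularTime p v s := by
    rcases hs' with rfl | hs'
    · exact h0
    · exact hreg s ⟨hs.1, hs'⟩
  set Q : E → E × E := fun u => tangentCoord x₀ (L.geodesicFlow p s u) with hQ
  have hQd : DifferentiableAt ℝ Q v := hsreg.2.differentiableAt_tangentCoord hsx
  have hflow : ∀ᶠ u in 𝓝 v, (∃ γ' : ℝ → M, L.IsGeodesicFrom p u γ' (s + ε)) ∧
      ∀ τ ∈ Ico s (s + ε), L.geodesicFlow p τ u = tangentCoordSymm x₀ (Φ (Q u) (τ - s)) ∧
        tangentCoord x₀ (L.geodesicFlow p τ u) = Φ (Q u) (τ - s) := by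
    have hsx' : ∀ᶠ u in 𝓝 v, (L.geodesicFlow p s u).1 ∈ (chartAt E x₀).source :=
      hsreg.2.continuousAt ((isOpen_setOf_proj_mem (E := E) x₀).mem_nhds hsx)
    filter_upwards [hsreg.1, hsx', hQd.continuousAt (Metric.isOpen_ball.mem_nhds hb)] with u h1 h2 h3
    obtain ⟨b', hb', γ', hγ'⟩ := h1
    obtain ⟨hΦ0, hΦ, -, -⟩ := H _ h3
    obtain ⟨γ'', h4, h5⟩ := hγ'.extend ⟨hs.1, hb'⟩ hε h2 hΦ hΦ0
    refine ⟨⟨γ'', h4⟩, fun τ hτ => ⟨h5 τ hτ, ?_⟩⟩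
    rw [h5 τ hτ, tangentCoord_tangentCoordSymm]
    exact (hΦ _ ⟨by linarith [hτ.1, hτ.2], by linarith [hτ.2]⟩).2.1
  obtain ⟨-, hΦ, hD, hΦD⟩ := H _ hb
  have hd : ∀ t ∈ Ico s (s + ε), HasFDerivAt (fun u => Φ (Q u) (t - s))
      ((D (Q v) (t - s)).comp (fderiv ℝ Q v)) v := fun t ht =>
    HasFDerivAt.comp (E := E) (g := fun q => Φ q (t - s)) v (hΦD (t - s) ⟨by linarith [ht.1], by linarith [ht.2]⟩)
      hQd.hasFDerivAt
  have hfd : ∀ t ∈ Ico s (s + ε), L.flowDeriv p x₀ v t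
      = (D (Q v) (t - s)).comp (fderiv ℝ Q v) := fun t ht => by
    refine HasFDerivAt.fderiv ((hd t ht).congr_of_eventuallyEq ?_)
    filter_upwards [hflow] with u hu using (hu.2 t ht).2
  refine ⟨_, hN, fun t ht => ⟨⟨?_, ?_⟩, ?_⟩⟩
  · filter_upwards [hflow] with u hu using ⟨s + ε, ht.2, hu.1⟩
  · have hm : t - s ∈ Ioo (-ε) ε := ⟨by linarith [ht.1, ht.2], by linarith [ht.2]⟩
    refine ((hd t ht).differentiableAt.mdifferentiableAt_tangentCoordSymm (x₀ := x₀)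
      (hΦ _ hm).2.1).congr_of_eventuallyEq ?_
    filter_upwards [hflow] with u hu using (hu.2 t ht).1
  · have hm : t - s ∈ Ioo (-ε) ε := ⟨by linarith [ht.1, ht.2], by linarith [ht.2]⟩
    -- Only the factor `D` depends on time, so the linearised equation for `D` passes to its
    -- composite with the fixed operator `fderiv ℝ Q v`.
    rw [hfd t ht, (hflow.self_of_nhds.2 t ht).2]
    have h1 : HasDerivAt (fun t => (D (Q v) (t - s)).comp (fderiv ℝ Q v))
        (((fderiv ℝ (L.sprayField x₀) (Φ (Q v) (t - s))).comp (D (Q v) (t - s))).comp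
          (fderiv ℝ Q v)) t := by
      have h2 := ((hD _ hm).comp_sub_const t s).clm_comp (hasDerivAt_const t (fderiv ℝ Q v))
      simpa using h2
    exact h1.hasDerivWithinAt.congr hfd (hfd t ht)

theorem IsGeodesicFrom.isRegularTime {v : TangentSpace 𝓘(ℝ, E) p} {γ : ℝ → M} {b : ℝ}
    (h : L.IsGeodesicFrom p v γ b) (hv : (⟨p, v⟩ : TangentBundle 𝓘(ℝ, E) M) ∈ L.domain) :
    ∀ t ∈ Ico 0 b, L.IsRegularTime p v t := by
  intro t₁ ht₁
  refine forall_mem_Icc_of_step (b := t₁) (P := L.IsRegularTime p v) (fun t ht hP => ?_) t₁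
    ⟨ht₁.1, le_rfl⟩
  obtain ⟨N, hN, H⟩ := h.exists_flowBox ⟨ht.1, ht.2.trans_lt ht₁.2⟩ (isRegularTime_zero hv).1 hP
    (mem_chart_source E (γ t))
  obtain ⟨ε, hε, hb⟩ := Metric.mem_nhdsWithin_iff.1 hN
  refine ⟨ε, hε, fun τ hτ => (H τ (hb ⟨?_, hτ.2.1⟩)).1⟩
  rw [Metric.mem_ball, Real.dist_eq, abs_lt]
  constructor <;> linarith [hτ.1.1, hτ.1.2]

/-- The derivative of the geodesic flow satisfies the linearised geodesic equation. -/
theorem IsGeodesicFrom.hasDerivWithinAt_flowDeriv {v : TangentSpace 𝓘(ℝ, E) p} {γ : ℝ → M}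
    {b t : ℝ} (h : L.IsGeodesicFrom p v γ b)
    (hv : (⟨p, v⟩ : TangentBundle 𝓘(ℝ, E) M) ∈ L.domain) (ht : t ∈ Ico 0 b) {x₀ : M}
    (hx : γ t ∈ (chartAt E x₀).source) :
    HasDerivWithinAt (L.flowDeriv p x₀ v)
        ((fderiv ℝ (L.sprayField x₀) (tangentCoord x₀ (L.geodesicFlow p t v))).comp
          (L.flowDeriv p x₀ v t)) (Ici 0) t := by
  obtain ⟨N, hN, H⟩ := h.exists_flowBox ht (isRegularTime_zero hv).1
    (fun s hs => h.isRegularTime hv s ⟨hs.1, hs.2.trans ht.2⟩) hx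
  exact (H t (mem_of_mem_nhdsWithin ht.1 hN)).2.mono_of_mem_nhdsWithin hN

end PseudoFinslerMetric

end GeodesicFlow

/-! ### Uniqueness of Jacobi fields and the variational field of the geodesics from p. -/

section JacobiFields

variable {E : Type*} [NormedAddCommGroup E] [NormedSpace ℝ E]
  {M : Type*} [TopologicalSpace M] [ChartedSpace E M] [IsManifold 𝓘(ℝ, E) ∞ M]

theorem interior_Icc_zero_one_nonempty : (interior (Icc (0 : ℝ) 1)).Nonempty := by
  rw [interior_Icc]; exact nonempty_Ioo.2 zero_lt_one

/-- A vector field on a vector space together with its linearisation. -/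
noncomputable def linearisedField {F : Type*} [NormedAddCommGroup F] [NormedSpace ℝ F] (f : F → F)
    (z : F × F) : F × F := (f z.1, fderiv ℝ f z.1 z.2)

theorem ContDiffOn.linearisedField {F : Type*} [NormedAddCommGroup F] [NormedSpace ℝ F] {f : F → F}
    {U : Set F} (hU : IsOpen U) (hf : ContDiffOn ℝ ∞ f U) :
    ContDiffOn ℝ ∞ (linearisedField f) (U ×ˢ univ) :=
  (hf.comp contDiffOn_fst fun _ h => h.1).prodMk
    (((hf.contDiffOn_fderiv_of_isOpen hU).comp contDiffOn_fst fun _ h => h.1).clm_apply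
      contDiffOn_snd)

namespace PseudoFinslerMetric

variable [FiniteDimensional ℝ E] {L : PseudoFinslerMetric E M}

/-- The Jacobi equation alone has time-dependent coefficients. Adjoining the lift of the geodesic
makes it autonomous, so the uniqueness and smoothness results for autonomous fields apply. -/
theorem IsJacobiField.hasDerivWithinAt {γ : ℝ → M} {J : ∀ t, TangentSpace 𝓘(ℝ, E) (γ t)}
    (h : L.IsJacobiField γ 0 1 J) {t : ℝ} (ht : t ∈ Icc (0 : ℝ) 1) {x₀ : M}
    (hx : γ t ∈ (chartAt E x₀).source) :
    HasDerivWithinAt (fun τ => (tangentCoord x₀ (velocityLift γ (Icc 0 1) τ),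
        (alongCoord x₀ J τ, derivWithin (alongCoord x₀ J) (Icc 0 1) τ)))
      (linearisedField (L.sprayField x₀) (tangentCoord x₀ (velocityLift γ (Icc 0 1) t),
        (alongCoord x₀ J t, derivWithin (alongCoord x₀ J) (Icc 0 1) t))) (Icc 0 1) t :=
  (h.geodesic.hasDerivWithinAt (uniqueDiffOn_Icc zero_lt_one) ht hx).prodMk
    ((h.geodesic.jacobi_equation_iff (convex_Icc 0 1) interior_Icc_zero_one_nonempty h.smooth ht
      hx).1 (h.equation t ht))

theorem IsJacobiField.eq_right {γ : ℝ → M} {J K : ∀ t, TangentSpace 𝓘(ℝ, E) (γ t)}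
    (hJ : L.IsJacobiField γ 0 1 J) (hK : L.IsJacobiField γ 0 1 K) {t : ℝ} (ht : t ∈ Ico (0 : ℝ) 1)
    {x₀ : M} (hx : γ t ∈ (chartAt E x₀).source) (h0 : alongCoord x₀ K t = alongCoord x₀ J t)
    (h1 : derivWithin (alongCoord x₀ K) (Icc 0 1) t = derivWithin (alongCoord x₀ J) (Icc 0 1) t) :
    ∃ ε > 0, ∀ τ ∈ Ico t (t + ε), K τ = J τ := by
  have ht' : t ∈ Icc (0 : ℝ) 1 := ⟨ht.1, ht.2.le⟩
  obtain ⟨δ, hδ, hb⟩ := Metric.mem_nhdsWithin_iff.1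
    ((hJ.geodesic.contMDiffOn t ht').continuousWithinAt.eventually_mem_source hx)
  have hm : t < min 1 (t + δ) := lt_min ht.2 (by linarith)
  have hsub : Ico t (min 1 (t + δ)) ⊆ Icc 0 1 := fun τ hτ =>
    ⟨ht.1.trans hτ.1, (hτ.2.trans_le (min_le_left _ _)).le⟩
  have hs : ∀ τ ∈ Ico t (min 1 (t + δ)), γ τ ∈ (chartAt E x₀).source := fun τ hτ => by
    refine hb ⟨?_, hsub hτ⟩
    rw [Metric.mem_ball, Real.dist_eq, abs_lt]
    constructor <;> linarith [hτ.1, hτ.2.trans_le (min_le_right _ _)]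
  obtain ⟨ε, hε, H⟩ := ODE_eq_of_eq_forward (f := linearisedField (L.sprayField x₀))
    (c₁ := fun τ => (tangentCoord x₀ (velocityLift γ (Icc 0 1) τ),
        (alongCoord x₀ K τ, derivWithin (alongCoord x₀ K) (Icc 0 1) τ)))
    (c₂ := fun τ => (tangentCoord x₀ (velocityLift γ (Icc 0 1) τ),
        (alongCoord x₀ J τ, derivWithin (alongCoord x₀ J) (Icc 0 1) τ))) hm
    ((((L.contDiffOn_sprayField x₀).linearisedField (L.isOpen_coordDomain x₀)).contDiffAt
      (((L.isOpen_coordDomain x₀).prod isOpen_univ).mem_nhds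
        ⟨hJ.geodesic.mem_coordDomain ht' hx, mem_univ _⟩)).of_le (by norm_cast))
    (fun τ hτ => (hK.hasDerivWithinAt (hsub hτ) (hs τ hτ)).mono hsub)
    (fun τ hτ => (hJ.hasDerivWithinAt (hsub hτ) (hs τ hτ)).mono hsub)
    (by simp only [h0, h1])
  refine ⟨min ε (min 1 (t + δ) - t), lt_min hε (by linarith), fun τ hτ => ?_⟩
  have h3 : τ ∈ Ico t (min 1 (t + δ)) := ⟨hτ.1, by linarith [hτ.2, min_le_right ε (min 1 (t + δ) - t)]⟩
  have h4 : τ ∈ Ico t (t + ε) := ⟨hτ.1, by linarith [hτ.2, min_le_left ε (min 1 (t + δ) - t)]⟩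
  exact tangentCoord_snd_injective (hs τ h3) (congrArg (fun z => z.2.1) (H τ h4))

theorem IsJacobiField.eq_of_eqOn_left {γ : ℝ → M} {J K : ∀ t, TangentSpace 𝓘(ℝ, E) (γ t)}
    (hJ : L.IsJacobiField γ 0 1 J) (hK : L.IsJacobiField γ 0 1 K) {t : ℝ} (ht : t ∈ Icc (0 : ℝ) 1)
    (h0 : 0 < t) (h : ∀ τ ∈ Ico 0 t, K τ = J τ) {x₀ : M} (hx : γ t ∈ (chartAt E x₀).source) :
    alongCoord x₀ K t = alongCoord x₀ J t ∧
      derivWithin (alongCoord x₀ K) (Icc 0 1) t = derivWithin (alongCoord x₀ J) (Icc 0 1) t := by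
  have hu : UniqueDiffOn ℝ (Icc (0 : ℝ) 1) := uniqueDiffOn_Icc zero_lt_one
  have hne : (𝓝[Ioo 0 t] t).NeBot := by
    rw [nhdsWithin_Ioo_eq_nhdsLT h0]; infer_instance
  have hle : 𝓝[Ioo 0 t] t ≤ 𝓝[Icc 0 1] t :=
    nhdsWithin_mono t fun τ hτ => ⟨hτ.1.le, hτ.2.le.trans ht.2⟩
  have e : ∀ τ ∈ Ico 0 t, alongCoord x₀ K τ = alongCoord x₀ J τ := fun τ hτ => by
    rw [alongCoord, alongCoord, h τ hτ]
  have hJs := hJ.smooth.contDiffWithinAt_alongCoord ht hx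
  have hKs := hK.smooth.contDiffWithinAt_alongCoord ht hx
  constructor
  · refine tendsto_nhds_unique_of_eventuallyEq (hKs.continuousWithinAt.tendsto.mono_left hle)
      (hJs.continuousWithinAt.tendsto.mono_left hle) ?_
    filter_upwards [self_mem_nhdsWithin] with τ hτ using e τ ⟨hτ.1.le, hτ.2⟩
  · refine tendsto_nhds_unique_of_eventuallyEq
      ((hKs.derivWithin (m := ∞) hu (by simp) ht).continuousWithinAt.tendsto.mono_left hle)
      ((hJs.derivWithin (m := ∞) hu (by simp) ht).continuousWithinAt.tendsto.mono_left hle) ?_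
    filter_upwards [self_mem_nhdsWithin] with τ hτ
    refine Filter.EventuallyEq.derivWithin_eq ?_ (e τ ⟨hτ.1.le, hτ.2⟩)
    filter_upwards [mem_nhdsWithin_of_mem_nhds (Ioo_mem_nhds hτ.1 hτ.2)] with τ' hτ'
      using e τ' ⟨hτ'.1.le, hτ'.2⟩

/-- A Jacobi field is determined by its initial value and initial derivative. -/
theorem IsJacobiField.eq_of_initial {γ : ℝ → M} {J K : ∀ t, TangentSpace 𝓘(ℝ, E) (γ t)}
    (hJ : L.IsJacobiField γ 0 1 J) (hK : L.IsJacobiField γ 0 1 K) (h0 : K 0 = J 0)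
    (h1 : L.covDerivAlong γ (Icc 0 1) K 0 = L.covDerivAlong γ (Icc 0 1) J 0) :
    ∀ t ∈ Icc (0 : ℝ) 1, K t = J t := by
  have hu : UniqueDiffOn ℝ (Icc (0 : ℝ) 1) := uniqueDiffOn_Icc zero_lt_one
  have hz : (0 : ℝ) ∈ Icc (0 : ℝ) 1 := ⟨le_rfl, zero_le_one⟩
  refine forall_mem_Icc_of_step fun t ht hP => ?_
  have hx : γ t ∈ (chartAt E (γ t)).source := mem_chart_source E _
  have e : alongCoord (γ t) K t = alongCoord (γ t) J t ∧
      derivWithin (alongCoord (γ t) K) (Icc 0 1) t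
        = derivWithin (alongCoord (γ t) J) (Icc 0 1) t := by
    rcases ht.1.eq_or_lt with rfl | hlt
    -- At time zero the covariant and the coordinate derivative differ by a Christoffel term that
    -- depends only on the value of the field, so equal values and equal covariant derivatives give
    -- equal coordinate derivatives.
    · have e0 : alongCoord (γ 0) K 0 = alongCoord (γ 0) J 0 := by
        rw [alongCoord, alongCoord, h0]
      refine ⟨e0, ?_⟩
      have k1 := alongCoord_covDerivAlong hu hK.geodesic.contMDiffOn hK.geodesic.admissible hz hx
        ((hK.smooth.contDiffWithinAt_alongCoord hz hx).differentiableWithinAt (by simp))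
      have k2 := alongCoord_covDerivAlong hu hJ.geodesic.contMDiffOn hJ.geodesic.admissible hz hx
        ((hJ.smooth.contDiffWithinAt_alongCoord hz hx).differentiableWithinAt (by simp))
      have k3 : alongCoord (γ 0) (L.covDerivAlong γ (Icc 0 1) K) 0
          = alongCoord (γ 0) (L.covDerivAlong γ (Icc 0 1) J) 0 := by
        rw [alongCoord, alongCoord, h1]
      rw [k1, k2, e0] at k3
      exact add_right_cancel k3
    · exact hJ.eq_of_eqOn_left hK ht hlt hP hx
  have et : K t = J t := tangentCoord_snd_injective hx e.1
  rcases ht.2.eq_or_lt with rfl | hlt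
  -- At the final time the forward interval meets `[0, 1]` only in the point 1, so any positive
  -- radius does.
  · refine ⟨1, zero_lt_one, fun τ hτ => ?_⟩
    obtain rfl : τ = 1 := le_antisymm hτ.2.2 hτ.1.1
    exact et
  · obtain ⟨ε, hε, H⟩ := hJ.eq_right hK ⟨ht.1, hlt⟩ hx e.1 e.2
    exact ⟨ε, hε, fun τ hτ => H τ hτ.1⟩

variable [T2Space M] {p : M}

/-- The variational vector field of the geodesics with initial velocities `v + s w`. -/
noncomputable def jacobiField (L : PseudoFinslerMetric E M) (p : M)
    (v w : TangentSpace 𝓘(ℝ, E) p) (t : ℝ) : TangentSpace 𝓘(ℝ, E) (L.geodesic p v t) :=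
  mfderiv 𝓘(ℝ, E) 𝓘(ℝ, E) (M := E) (fun u => L.geodesic p u t) v w

theorem IsRegularTime.mdifferentiableAt_geodesic {v : TangentSpace 𝓘(ℝ, E) p} {t : ℝ}
    (h : L.IsRegularTime p v t) :
    MDifferentiableAt 𝓘(ℝ, E) 𝓘(ℝ, E) (M := E) (fun u => L.geodesic p u t) v :=
  MDifferentiableAt.comp (M := E) (I' := 𝓘(ℝ, E).tangent)
    (g := fun z : TangentBundle 𝓘(ℝ, E) M => z.1) v
    ((Bundle.contMDiff_proj (n := 1) (IB := 𝓘(ℝ, E)) (F := E) (TangentSpace 𝓘(ℝ, E) (M := M))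
      _).mdifferentiableAt (by simp)) h.2

theorem jacobiField_zero (v w : TangentSpace 𝓘(ℝ, E) p) : L.jacobiField p v w 0 = 0 := by
  -- Stated for a variable map, because the type of the derivative depends on the map being replaced
  -- by a constant one.
  have key : ∀ h : E → M, h = (fun _ => p) → ∀ v w : E, mfderiv 𝓘(ℝ, E) 𝓘(ℝ, E) h v w = 0 := by
    rintro _ rfl v w
    rw [mfderiv_const]
    rfl
  exact key _ (funext fun u => L.geodesic_zero p u) v w

theorem IsRegularTime.alongCoord_jacobiField {v w : TangentSpace 𝓘(ℝ, E) p} {t : ℝ}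
    (h : L.IsRegularTime p v t) {x₀ : M} (hx : L.geodesic p v t ∈ (chartAt E x₀).source) :
    alongCoord x₀ (L.jacobiField p v w) t = (L.flowDeriv p x₀ v t w).1 := by
  have h1 := tangentCoord_mfderivWithin (F := E) (s := univ) (z := v) (x₀ := x₀)
    h.mdifferentiableAt_geodesic.mdifferentiableWithinAt uniqueDiffWithinAt_univ hx w
  rw [mfderivWithin_univ, fderivWithin_univ] at h1
  have h2 : DifferentiableAt ℝ (fun u : E => tangentCoord x₀ (L.geodesicFlow p t u)) v :=
    h.2.differentiableAt_tangentCoord hx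
  have h3 : HasFDerivAt (fun u : E => extChartAt 𝓘(ℝ, E) x₀ (L.geodesic p u t)) _ v :=
    h2.hasFDerivAt.fst
  rw [h3.fderiv] at h1
  exact h1

section

variable {v : TangentSpace 𝓘(ℝ, E) p} {γ : ℝ → M} {b : ℝ}

theorem IsGeodesicFrom.isGeodesic_geodesic (h : L.IsGeodesicFrom p v γ b) (hb : 1 < b) :
    L.IsGeodesic (L.geodesic p v) (Icc 0 1) := by
  have hs : Icc (0 : ℝ) 1 ⊆ Ico 0 b := fun t ht => ⟨ht.1, ht.2.trans_lt hb⟩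
  refine isGeodesic_of_locally (uniqueDiffOn_Icc zero_lt_one) fun t ht => ⟨γ, Ico 0 b, h.1,
    uniqueDiffOn_Ico _ _, Filter.mem_of_superset self_mem_nhdsWithin hs, ?_⟩
  filter_upwards [self_mem_nhdsWithin] with τ hτ using h.geodesic_eq (hs hτ)

theorem IsGeodesicFrom.velocityLift_geodesic (h : L.IsGeodesicFrom p v γ b) (hb : 1 < b) {t : ℝ}
    (ht : t ∈ Icc (0 : ℝ) 1) :
    velocityLift (L.geodesic p v) (Icc 0 1) t = L.geodesicFlow p t v := by
  have hs : Icc (0 : ℝ) 1 ⊆ Ico 0 b := fun t ht => ⟨ht.1, ht.2.trans_lt hb⟩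
  rw [h.geodesicFlow_eq (hs ht)]
  refine velocityLift_congr ht (uniqueDiffOn_Icc zero_lt_one t ht)
    (h.1.mdifferentiableWithinAt (hs ht)) (Filter.mem_of_superset self_mem_nhdsWithin hs) ?_
  filter_upwards [self_mem_nhdsWithin] with τ hτ using h.geodesic_eq (hs hτ)

theorem IsGeodesicFrom.hasDerivWithinAt_flowDeriv_apply (h : L.IsGeodesicFrom p v γ b) (hb : 1 < b)
    (hv : (⟨p, v⟩ : TangentBundle 𝓘(ℝ, E) M) ∈ L.domain) (w : E) {t : ℝ}
    (ht : t ∈ Icc (0 : ℝ) 1) {x₀ : M} (hx : L.geodesic p v t ∈ (chartAt E x₀).source) :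
    HasDerivWithinAt (fun τ => (tangentCoord x₀ (velocityLift (L.geodesic p v) (Icc 0 1) τ),
        L.flowDeriv p x₀ v τ w))
      (linearisedField (L.sprayField x₀)
        (tangentCoord x₀ (velocityLift (L.geodesic p v) (Icc 0 1) t), L.flowDeriv p x₀ v t w))
      (Icc 0 1) t := by
  have ht' : t ∈ Ico 0 b := ⟨ht.1, ht.2.trans_lt hb⟩
  refine ((h.isGeodesic_geodesic hb).hasDerivWithinAt (uniqueDiffOn_Icc zero_lt_one) ht hx).prodMk ?_
  have h1 := (h.hasDerivWithinAt_flowDeriv hv ht' (x₀ := x₀) (by rwa [← h.geodesic_eq ht'])).mono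
    (Icc_subset_Ici_self : Icc (0 : ℝ) 1 ⊆ Ici 0)
  have h2 := h1.clm_apply (hasDerivWithinAt_const t (Icc (0 : ℝ) 1) w)
  rw [map_zero, add_zero] at h2
  rw [h.velocityLift_geodesic hb ht]
  exact h2

/-- The first component of the linearised spray is the fibre part of its argument. Hence the second
component of the flow derivative is the time derivative of the first, which represents the
variational field. -/
theorem IsGeodesicFrom.eventually_jacobiField (h : L.IsGeodesicFrom p v γ b) (hb : 1 < b)
    (hv : (⟨p, v⟩ : TangentBundle 𝓘(ℝ, E) M) ∈ L.domain) (w : TangentSpace 𝓘(ℝ, E) p) {t : ℝ}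
    (ht : t ∈ Icc (0 : ℝ) 1) {x₀ : M} (hx : L.geodesic p v t ∈ (chartAt E x₀).source) :
    (fun τ => (alongCoord x₀ (L.jacobiField p v w) τ,
        derivWithin (alongCoord x₀ (L.jacobiField p v w)) (Icc 0 1) τ))
      =ᶠ[𝓝[Icc 0 1] t] fun τ => L.flowDeriv p x₀ v τ w := by
  have hg := h.isGeodesic_geodesic hb
  have hev := (hg.contMDiffOn t ht).continuousWithinAt.eventually_mem_source hx
  have e1 : ∀ᶠ τ in 𝓝[Icc 0 1] t,
      alongCoord x₀ (L.jacobiField p v w) τ = (L.flowDeriv p x₀ v τ w).1 := by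
    filter_upwards [hev, self_mem_nhdsWithin] with τ h1 h2
    exact (h.isRegularTime hv τ ⟨h2.1, h2.2.trans_lt hb⟩).alongCoord_jacobiField h1
  filter_upwards [e1, hev, self_mem_nhdsWithin, eventually_eventually_nhdsWithin.2 e1]
    with τ h1 h2 h3 h4
  refine Prod.ext h1 ?_
  have h5 := h.hasDerivWithinAt_flowDeriv_apply hb hv w h3 h2
  have h6 : HasDerivWithinAt (fun τ => L.flowDeriv p x₀ v τ w) _ (Icc 0 1) τ := h5.snd
  have h7 : HasDerivWithinAt (fun τ => (L.flowDeriv p x₀ v τ w).1) _ (Icc 0 1) τ := h6.fst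
  refine (h7.congr_of_eventuallyEq_of_mem h4 h3).derivWithin
    (uniqueDiffOn_Icc zero_lt_one τ h3) |>.trans ?_
  exact congrArg Prod.fst (L.fderiv_sprayField (hg.mem_coordDomain h3 h2) (L.flowDeriv p x₀ v τ w))

/-- Smoothness in time comes from the autonomous linearised system that the coordinates solve,
without higher regularity of the flow in the initial velocity. -/
theorem IsGeodesicFrom.isSmoothFieldAlong_jacobiField (h : L.IsGeodesicFrom p v γ b) (hb : 1 < b)
    (hv : (⟨p, v⟩ : TangentBundle 𝓘(ℝ, E) M) ∈ L.domain) (w : TangentSpace 𝓘(ℝ, E) p) :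
    IsSmoothFieldAlong (L.geodesic p v) (Icc 0 1) (L.jacobiField p v w) := by
  intro t ht
  have hg := h.isGeodesic_geodesic hb
  set x₀ := L.geodesic p v t with hx₀
  have hx : L.geodesic p v t ∈ (chartAt E x₀).source := mem_chart_source E _
  obtain ⟨δ, hδ, hball⟩ := Metric.mem_nhdsWithin_iff.1
    ((hg.contMDiffOn t ht).continuousWithinAt.eventually_mem_source hx)
  obtain ⟨hTc, hTi⟩ := convex_inter_Ioo_interior_nonempty (convex_Icc (0 : ℝ) 1)
    interior_Icc_zero_one_nonempty ht hδ
  set T := Icc (0 : ℝ) 1 ∩ Ioo (t - δ) (t + δ) with hT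
  have hTs : T ⊆ Icc 0 1 := inter_subset_left
  have htT : t ∈ T := ⟨ht, by simp [hδ]⟩
  have hxT : ∀ τ ∈ T, L.geodesic p v τ ∈ (chartAt E x₀).source := fun τ hτ =>
    hball ⟨by rw [Real.ball_eq_Ioo]; exact hτ.2, hτ.1⟩
  have hsm := contDiffOn_infty_of_hasDerivWithinAt
    ((L.contDiffOn_sprayField x₀).linearisedField (L.isOpen_coordDomain x₀))
    (uniqueDiffOn_convex hTc hTi)
    (fun τ hτ => (h.hasDerivWithinAt_flowDeriv_apply hb hv w (hTs hτ) (hxT τ hτ)).mono hTs)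
    (fun τ hτ => ⟨hg.mem_coordDomain (hTs hτ) (hxT τ hτ), mem_univ _⟩)
  have hq : ContDiffWithinAt ℝ ∞ (fun τ => (extChartAt 𝓘(ℝ, E) x₀ (L.geodesic p v τ),
      (L.flowDeriv p x₀ v τ w).1)) T t := (hsm t htT).fst.fst.prodMk (hsm t htT).snd.fst
  have htarget : extChartAt 𝓘(ℝ, E) x₀ (L.geodesic p v t) ∈ (extChartAt 𝓘(ℝ, E) x₀).target :=
    (extChartAt 𝓘(ℝ, E) x₀).map_source (by rw [extChartAt_source]; exact hx)
  refine ((hq.contMDiffWithinAt_tangentCoordSymm (x₀ := x₀) htarget).congr_of_eventuallyEq_of_mem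
    ?_ htT).mono_of_mem_nhdsWithin (inter_Ioo_mem_nhdsWithin htT)
  filter_upwards [self_mem_nhdsWithin] with τ hτ
  rw [← tangentCoordSymm_tangentCoord (x₀ := x₀) (z := (⟨L.geodesic p v τ, L.jacobiField p v w τ⟩ :
    TangentBundle 𝓘(ℝ, E) M)) (hxT τ hτ)]
  exact congrArg _ (Prod.ext rfl ((h.isRegularTime hv τ ⟨hτ.1.1,
    hτ.1.2.trans_lt hb⟩).alongCoord_jacobiField (hxT τ hτ)))

theorem IsGeodesicFrom.isJacobiField_jacobiField (h : L.IsGeodesicFrom p v γ b) (hb : 1 < b)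
    (hv : (⟨p, v⟩ : TangentBundle 𝓘(ℝ, E) M) ∈ L.domain) (w : TangentSpace 𝓘(ℝ, E) p) :
    L.IsJacobiField (L.geodesic p v) 0 1 (L.jacobiField p v w) := by
  have hsm := h.isSmoothFieldAlong_jacobiField hb hv w
  refine ⟨h.isGeodesic_geodesic hb, hsm, fun t ht => ?_⟩
  have hx : L.geodesic p v t ∈ (chartAt E (L.geodesic p v t)).source := mem_chart_source E _
  refine ((h.isGeodesic_geodesic hb).jacobi_equation_iff (convex_Icc 0 1)
    interior_Icc_zero_one_nonempty hsm ht hx).2 ?_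
  have he := h.eventually_jacobiField hb hv w ht hx
  have hd : HasDerivWithinAt (fun τ => L.flowDeriv p (L.geodesic p v t) v τ w) _ (Icc 0 1) t :=
    (h.hasDerivWithinAt_flowDeriv_apply hb hv w ht hx).snd
  have e := he.eq_of_nhdsWithin ht
  have hd' := hd.congr_of_eventuallyEq_of_mem he ht
  refine hd'.congr_deriv ?_
  exact congrArg _ e.symm

theorem IsGeodesicFrom.covDerivAlong_jacobiField_zero (h : L.IsGeodesicFrom p v γ b) (hb : 1 < b)
    (hv : (⟨p, v⟩ : TangentBundle 𝓘(ℝ, E) M) ∈ L.domain) (w : TangentSpace 𝓘(ℝ, E) p) :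
    (⟨L.geodesic p v 0, L.covDerivAlong (L.geodesic p v) (Icc 0 1) (L.jacobiField p v w) 0⟩ :
      TangentBundle 𝓘(ℝ, E) M) = ⟨p, w⟩ := by
  have hz : (0 : ℝ) ∈ Icc (0 : ℝ) 1 := ⟨le_rfl, zero_le_one⟩
  have hg := h.isGeodesic_geodesic hb
  have hx' : p ∈ (chartAt E p).source := mem_chart_source E p
  have hx : L.geodesic p v 0 ∈ (chartAt E p).source := by rw [geodesic_zero]; exact hx'
  have hsm := h.isSmoothFieldAlong_jacobiField hb hv w
  refine tangentCoord_injOn (x₀ := p) hx hx' (Prod.ext ?_ ?_)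
  · exact congrArg (extChartAt 𝓘(ℝ, E) p) (L.geodesic_zero p v)
  have h1 := alongCoord_covDerivAlong (uniqueDiffOn_Icc zero_lt_one) hg.contMDiffOn hg.admissible
    hz hx ((hsm.contDiffWithinAt_alongCoord hz hx).differentiableWithinAt (by simp))
  have h2 : alongCoord p (L.jacobiField p v w) 0 = 0 := by
    rw [alongCoord, jacobiField_zero]
    exact tangentCoord_snd_zero _ _
  -- Since the field vanishes at time zero, the Christoffel term drops out and its covariant
  -- derivative there is the coordinate derivative.
  rw [h2, map_zero, zero_apply, add_zero] at h1
  refine h1.trans ?_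
  have h3 := (h.eventually_jacobiField hb hv w hz hx).eq_of_nhdsWithin hz
  refine (congrArg Prod.snd h3).trans ?_
  -- At time zero the flow is the inclusion of the fibre over `p`, which in the chart at `p` is `u ↦
  -- (x(p), u)`.
  have h4 : L.flowDeriv p p v 0 = ContinuousLinearMap.inr ℝ E E := by
    have h5 : (fun u : E => tangentCoord p (L.geodesicFlow p 0 u))
        =ᶠ[𝓝 v] fun u : E => (extChartAt 𝓘(ℝ, E) p p, u) := by
      filter_upwards [(isRegularTime_zero hv).2] with u hu
      rw [hu]
      exact Prod.ext rfl (tangentCoord_self_snd p u)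
    exact (HasFDerivAt.congr_of_eventuallyEq (E := E) (hasFDerivAt_prodMk_right (𝕜 := ℝ) (E := E) (F := E) _ _) h5).fderiv
  rw [h4]
  exact (tangentCoord_self_snd p w).symm

end

end PseudoFinslerMetric

end JacobiFields

theorem proposition3p15 {E : Type*} [NormedAddCommGroup E] [NormedSpace ℝ E]
    [FiniteDimensional ℝ E] {M : Type*} [TopologicalSpace M] [T2Space M] [ChartedSpace E M]
    [IsManifold 𝓘(ℝ, E) ∞ M] (L : PseudoFinslerMetric E M) (p : M)
    (v : TangentSpace 𝓘(ℝ, E) p) (hv : v ∈ L.expDomain p) :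
    L.expDomain p ∈ 𝓝 v ∧
    MDifferentiableAt 𝓘(ℝ, E) 𝓘(ℝ, E) (M := E) (L.exp p) v ∧
    ∀ w : TangentSpace 𝓘(ℝ, E) p,
      ∃ J : ∀ t, TangentSpace 𝓘(ℝ, E) (L.geodesic p v t),
        L.IsJacobiFieldFrom (L.geodesic p v) p w J ∧
        (∀ K : ∀ t, TangentSpace 𝓘(ℝ, E) (L.geodesic p v t),
          L.IsJacobiFieldFrom (L.geodesic p v) p w K → ∀ t ∈ Icc (0 : ℝ) 1, K t = J t) ∧
        mfderiv 𝓘(ℝ, E) 𝓘(ℝ, E) (M := E) (L.exp p) v w = J 1 := by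
  obtain ⟨hvA, b, hb, γ, h⟩ := hv
  have h1 := h.isRegularTime hvA 1 ⟨zero_le_one, hb⟩
  -- The variational field at time 1 is by definition the differential of `L.exp p` at `v`, hence
  -- the `rfl`.
  refine ⟨?_, h1.mdifferentiableAt_geodesic, fun w => ⟨L.jacobiField p v w, ?_, ?_, rfl⟩⟩
  · have hA : ∀ᶠ u in 𝓝 v, (⟨p, u⟩ : TangentBundle 𝓘(ℝ, E) M) ∈ L.domain :=
      (PseudoFinslerMetric.mdifferentiableAt_totalSpace_mk v).continuousAt
        (L.isOpen_domain.mem_nhds hvA)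
    filter_upwards [hA, h1.1] with u hu hu' using ⟨hu, hu'⟩
  · exact ⟨h.isJacobiField_jacobiField hb hvA w, PseudoFinslerMetric.jacobiField_zero v w,
      h.covDerivAlong_jacobiField_zero hb hvA w⟩
  · rintro K ⟨hK, hK0, hK1⟩
    refine (h.isJacobiField_jacobiField hb hvA w).eq_of_initial hK
      (hK0.trans (PseudoFinslerMetric.jacobiField_zero v w).symm) ?_
    have e := hK1.trans (h.covDerivAlong_jacobiField_zero hb hvA w).symm
    simpa using e
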